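/- Let $\omega=dx\wedge dy$ on $\mathbb{R}^2=\mathbb{C}$, let $\mathbb{R},i\mathbb{R}\subset\mathbb{C}$ be the real and imaginary axes and let $I=\mathrm{diag}(1,-1)$ be complex conjugation. For a continuous path $\Lambda:[a,b]\to\mathrm{Lag}(E,\sigma)$, $a<b$, of Lagrangian subspaces of a finite-dimensional symplectic vector space $(E,\sigma)$ and a fixed Lagrangian subspace $V$, let $\mu_{\mathrm{RS}}(\Lambda,V)\in\frac12\mathbb{Z}$ be the Robbin–Salamon index: if all crossings (times $t$ with $\Lambda(t)\cap V\neq0$) are regular, it is $$\tfrac12\,\mathrm{sign}\,\Gamma(a)+\sum_{a<t<b}\mathrm{sign}\,\Gamma(t)+\tfrac12\,\mathrm{sign}\,\Gamma(b),$$ where $\Gamma(t)$ is the crossing form on $\Lambda(t)\cap V$, given by $\Gamma(t)(v)=\sigma(v,\dot u(t))$ for any curve $u(s)\in\Lambda(s)$ with $u(t)=v$ that is differentiable at $t$, and a crossing is regular if $\Lambda$ is differentiable there and $\Gamma(t)$ is nondegenerate; for a general continuous path it is the index of any path with only regular crossings that is homotopic to $\Lambda$ with fixed endpoints through Lagrangian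 paths. For a continuous path $\Psi:[0,T]\to\mathrm{Sp}(\mathbb{R}^2)$ with $\Psi(0)=\mathbf 1$, the Conley–Zehnder index is $$\mu_{\mathrm{CZ}}(\Psi):=\mu_{\mathrm{RS}}\big(\{(x,-\Psi(t)x)\mid x\in\mathbb{R}^2\},\ \{(x,-x)\mid x\in\mathbb{R}^2\}\big)$$ computed in $(\mathbb{R}^2\times\mathbb{R}^2,(-\omega)\oplus\omega)$ (this formula is used whether or not $\det(\Psi(T)-\mathbf 1)\ne0$). **Proposition.** Let $T>0$ and let $\Psi:\mathbb{R}\to\mathrm{Sp}(\mathbb{R}^2)$ be a continuous path of symplectic matrices such that $\Psi(0)=\mathbf 1$, $\Psi(t+T)=\Psi(t)\Psi(T)$ and $\Psi(-t)=I\,\Psi(t)\,I$ for all $t\in\mathbb{R}$. Then $$\mu_{\mathrm{CZ}}(\Psi|_{[0,T]})=\mu_{\mathrm{RS}}(\Psi|_{[0,T/2]}\mathbb{R},\mathbb{R})+\mu_{\mathrm{RS}}(\Psi|_{[0,T/2]}\,i\mathbb{R},i\mathbb{R}).$$ -/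

import Mathlib

open Set Filter Topology

noncomputable section

namespace SymplecticIndex

/-! ## Paths of subspaces and Lagrangian paths -/

section Paths

variable {E : Type*} [NormedAddCommGroup E] [NormedSpace ℝ E]

/-- `Z` is a frame (pointwise basis) of the family of subspaces `Λ` at all points of `s` close to
the point `x` of `s`. -/
def IsLocalFrame {X : Type*} [TopologicalSpace X] {n : ℕ} (Z : X → Fin n → E)
    (Λ : X → Submodule ℝ E) (s : Set X) (x : X) : Prop :=
  ∀ᶠ y in 𝓝[s] x, LinearIndependent ℝ (Z y) ∧ Submodule.span ℝ (range (Z y)) = Λ y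

/-- Continuity on `s`, in the topology of the Grassmannian, of a family of subspaces of `E`:
near each point `x` of `s` the family has a frame that is continuous at `x`. -/
def ContinuousFamilyOn {X : Type*} [TopologicalSpace X]
    (Λ : X → Submodule ℝ E) (s : Set X) : Prop :=
  ∀ x ∈ s, ∃ (n : ℕ) (Z : X → Fin n → E), IsLocalFrame Z Λ s x ∧ ContinuousWithinAt Z s x

/-- `L` is a Lagrangian subspace for `ω`: it equals its own `ω`-orthogonal complement. -/
def IsLagrangian (ω : LinearMap.BilinForm ℝ E) (L : Submodule ℝ E) : Prop :=
  ω.orthogonal L = L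

/-- `Λ` is a continuous family of Lagrangian subspaces over the parameter set `s`. -/
def IsLagrangianFamilyOn {X : Type*} [TopologicalSpace X] (ω : LinearMap.BilinForm ℝ E)
    (Λ : X → Submodule ℝ E) (s : Set X) : Prop :=
  ContinuousFamilyOn Λ s ∧ ∀ x ∈ s, IsLagrangian ω (Λ x)

/-- `Λ₀` and `Λ₁`, as paths of Lagrangian subspaces over `[a, b]`, are homotopic with fixed
endpoints. The first variable of `H` is the homotopy parameter. -/
def LagrangianHomotopic (ω : LinearMap.BilinForm ℝ E) (a b : ℝ) (Λ₀ Λ₁ : ℝ → Submodule ℝ E) :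
    Prop :=
  ∃ H : ℝ × ℝ → Submodule ℝ E,
    IsLagrangianFamilyOn ω H (Icc (0 : ℝ) 1 ×ˢ Icc a b) ∧
    (∀ t ∈ Icc a b, H (0, t) = Λ₀ t) ∧
    (∀ t ∈ Icc a b, H (1, t) = Λ₁ t) ∧
    (∀ s ∈ Icc (0 : ℝ) 1, H (s, a) = Λ₀ a ∧ H (s, b) = Λ₀ b)

/-! ## The Robbin–Salamon index -/

/-- The path `Λ` is differentiable at the time `t` of `[a, b]` (one-sidedly at the endpoints) and
`Q` is its crossing form with `V` at `t`: if `Z` is a frame of `Λ` that is differentiable at `t`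
with derivative `Z'`, then `Q v = ω (v, ∑ cᵢ Z'ᵢ)` for `v = ∑ cᵢ Zᵢ(t)` in `Λ t ∩ V`.
The value does not depend on the frame, because `Λ t` is Lagrangian; it equals the derivative at
`t` of `ω (v, w(·))` for every `w` with `v + w(·) ∈ Λ` and values in a fixed Lagrangian
complement of `Λ t`. -/
def IsCrossingForm (ω : LinearMap.BilinForm ℝ E) (Λ : ℝ → Submodule ℝ E) (V : Submodule ℝ E)
    (a b t : ℝ) (Q : QuadraticForm ℝ ↥(Λ t ⊓ V)) : Prop :=
  ∃ (n : ℕ) (Z : ℝ → Fin n → E) (Z' : Fin n → E),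
    IsLocalFrame Z Λ (Icc a b) t ∧ HasDerivWithinAt Z Z' (Icc a b) t ∧
    ∀ (v : ↥(Λ t ⊓ V)) (c : Fin n → ℝ),
      (v : E) = ∑ i, c i • Z t i → Q v = ω v (∑ i, c i • Z' i)

/-- `Λ` is a continuous path of Lagrangian subspaces over `[a, b]` all of whose crossings with `V`
(times `t` with `Λ t ∩ V ≠ 0`) are regular, that is, have a nondegenerate crossing form; and `μ`
is the sum of the signatures of the crossing forms, a crossing at an endpoint being counted with
weight `1/2`. Regular crossings are isolated, so the set `C` of crossings is finite. Only the
derivatives at the crossings enter, so differentiability is asked for only there. -/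
def HasRegularIndex (ω : LinearMap.BilinForm ℝ E) (Λ : ℝ → Submodule ℝ E) (V : Submodule ℝ E)
    (a b : ℝ) (μ : ℚ) : Prop :=
  IsLagrangianFamilyOn ω Λ (Icc a b) ∧
  ∃ (C : Finset ℝ) (Q : ∀ t, QuadraticForm ℝ ↥(Λ t ⊓ V)),
    (∀ t, t ∈ C ↔ t ∈ Icc a b ∧ Λ t ⊓ V ≠ ⊥) ∧
    (∀ t ∈ C, IsCrossingForm ω Λ V a b t (Q t) ∧
      (Q t).Nondegenerate) ∧
    μ = ∑ t ∈ C, (if t = a ∨ t = b then (1 / 2 : ℚ) else 1) *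
      ((sigPos (Q t) : ℚ) - (sigNeg (Q t) : ℚ))

/-- `μ` is the Robbin–Salamon index of the path `Λ` over `[a, b]` with respect to `V`: `Λ` is
homotopic with fixed endpoints, through paths of Lagrangian subspaces, to a path with only
regular crossings whose weighted sum of signatures is `μ`. -/
def IsRSIndex (ω : LinearMap.BilinForm ℝ E) (Λ : ℝ → Submodule ℝ E) (V : Submodule ℝ E)
    (a b : ℝ) (μ : ℚ) : Prop :=
  ∃ Λ' : ℝ → Submodule ℝ E, LagrangianHomotopic ω a b Λ Λ' ∧ HasRegularIndex ω Λ' V a b μ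

open scoped Classical in
/-- The Robbin–Salamon index of the path `Λ` of Lagrangian subspaces over `[a, b]` with respect to
the Lagrangian subspace `V` (a number `μ` as in `IsRSIndex` exists and is unique for every
continuous path of Lagrangian subspaces over a nontrivial interval `[a, b]`). -/
def rsIndex (ω : LinearMap.BilinForm ℝ E) (Λ : ℝ → Submodule ℝ E) (V : Submodule ℝ E)
    (a b : ℝ) : ℚ :=
  if h : ∃ μ, IsRSIndex ω Λ V a b μ then h.choose else 0

end Paths

/-! ## The symplectic plane and the Conley–Zehnder index -/

/-- The plane `ℝ²`. -/
abbrev Plane : Type := Fin 2 → ℝ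

/-- The standard symplectic form `dx ∧ dy` on the plane. -/
def omegaStd : LinearMap.BilinForm ℝ Plane := Matrix.toBilin' !![0, 1; -1, 0]

/-- The symplectic form `(-ω) ⊕ ω` on `ℝ² × ℝ²`, where `ω = dx ∧ dy`. -/
def omegaProd : LinearMap.BilinForm ℝ (Plane × Plane) :=
  omegaStd.compl₁₂ (LinearMap.snd ℝ Plane Plane) (LinearMap.snd ℝ Plane Plane) -
    omegaStd.compl₁₂ (LinearMap.fst ℝ Plane Plane) (LinearMap.fst ℝ Plane Plane)

/-- The matrix `M` is a linear symplectomorphism of the plane. -/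
def IsSymplectic (M : Matrix (Fin 2) (Fin 2) ℝ) : Prop :=
  ∀ x y : Plane, omegaStd (M.mulVec x) (M.mulVec y) = omegaStd x y

/-- The matrix of complex conjugation on `ℝ² = ℂ`. -/
def conjMatrix : Matrix (Fin 2) (Fin 2) ℝ := !![1, 0; 0, -1]

/-- The real axis in `ℝ² = ℂ`. -/
def realAxis : Submodule ℝ Plane := Submodule.span ℝ {![1, 0]}

/-- The imaginary axis in `ℝ² = ℂ`. -/
def imagAxis : Submodule ℝ Plane := Submodule.span ℝ {![0, 1]}

/-- The path of subspaces `t ↦ Ψ(t) V`. -/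
def movedSubspace (Ψ : ℝ → Matrix (Fin 2) (Fin 2) ℝ) (V : Submodule ℝ Plane) (t : ℝ) :
    Submodule ℝ Plane :=
  V.map (Ψ t).mulVecLin

/-- The twisted graph `{(x, -M x)}` of `M`. -/
def twistedGraph (M : Matrix (Fin 2) (Fin 2) ℝ) : Submodule ℝ (Plane × Plane) :=
  LinearMap.range (LinearMap.prod LinearMap.id (-M.mulVecLin))

/-- The twisted diagonal `{(x, -x)}`. -/
def twistedDiagonal : Submodule ℝ (Plane × Plane) :=
  LinearMap.range (LinearMap.prod LinearMap.id (-LinearMap.id))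

/-- The Conley–Zehnder index of the path `Ψ` of symplectic matrices over `[0, T]`: the
Robbin–Salamon index of the path of twisted graphs of `Ψ(t)` with respect to the twisted
diagonal. -/
def czIndex (Ψ : ℝ → Matrix (Fin 2) (Fin 2) ℝ) (T : ℝ) : ℚ :=
  rsIndex omegaProd (fun t => twistedGraph (Ψ t)) twistedDiagonal 0 T

end SymplecticIndex

end

/-! Each of the three indices is rewritten as an expression in endpoint data, and the expressions
are then compared.

In Darboux coordinates (Q, P) with V = ker P, a frame of a Lagrangian subspace has a complex
determinant D = det(Q + iP) and a real determinant d = det P. D never vanishes, and a change of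
frame multiplies D and d by the same nonzero real number. So D²/|D|² depends only on the subspace,
its argument along a path is invariant under homotopies with fixed endpoints, and the crossings with
V are the zeros of d. One adds a correction g, a function of the subspace with 4g an argument of D⁴,
which is continuous off the crossings and whose limits at a regular crossing are g - (π/2) sign Γ
from the right and g + (π/2) sign Γ from the left. Then (arg D - g)/π takes values in ½ℤ, hence
moves only by these jumps, and its total change is the Robbin–Salamon index with its endpoint
weights 1/2 (`IsMaslovPair.rsIndex_eq`). Such corrections are given for lines in a plane
(`IsDarboux.isMaslovPair_line`) and for planes in dimension four (`IsDarboux.isMaslovPair_plane`).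
That the paths in question have an index at all is shown by deforming the Iwasawa parameters of the
matrices to a path that rotates fast (`IsDarboux.exists_isRSIndex`).

Write A = Ψ(T/2) with rows (a, b) and (c, d). For the two axes D is a + ic and d - ib, and for the
twisted graph it is, up to a factor 2, the number (a + d) + i(c - b), evaluated along all of [0, T].
The symmetries give Ψ(T) = I A⁻¹ I A, and they deform Ψ on [0, T] to the path of commutators I
Ψ(τ)⁻¹ I Ψ(τ), 0 ≤ τ ≤ T/2, whose complex linear part is a multiple of (a - ib)(d + ic). This number
differs from (a + ic)(d - ib) by factors that stay in the slit plane, so the arguments are compared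
by principal values (`exists_isArgLift_linearPart`). What remains is an identity between arctangents
of the entries of A (`arg_sub_arg_eq_planeDefect`). -/

noncomputable section

namespace SymplecticIndex

/-! ## Continuous choices of an argument -/

section ArgLift

variable {X : Type*} [TopologicalSpace X]

/-- `Θ` is a continuous choice of an argument of the complex-valued function `f` on `s`. -/
def IsArgLift (f : X → ℂ) (Θ : X → ℝ) (s : Set X) : Prop :=
  ContinuousOn Θ s ∧ ∀ x ∈ s, f x = ‖f x‖ * Complex.exp (Θ x * Complex.I)

lemma eq_of_continuousOn_of_int {h : X → ℝ} {s : Set X} (hs : IsPreconnected s)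
    (hc : ContinuousOn h s) (hz : ∀ x ∈ s, ∃ n : ℤ, h x = n) {x y : X} (hx : x ∈ s) (hy : y ∈ s) :
    h x = h y := by
  have : IsDiscrete (range ((↑) : ℤ → ℝ)) :=
    ⟨Int.isClosedEmbedding_coe_real.isEmbedding.toHomeomorph.symm.isEmbedding.discreteTopology⟩
  exact hs.constant_of_mapsTo this hc
    (fun z hz' => by obtain ⟨n, hn⟩ := hz z hz'; exact ⟨n, hn.symm⟩) hx hy

/-- The exponential is a covering of ℂ \ 0, so f lifts through it; the imaginary part of the lift is
the argument. -/
lemma exists_isArgLift [SimplyConnectedSpace X] [LocallyPathConnectedSpace X] {f : X → ℂ}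
    (hf : Continuous f) (h0 : ∀ x, f x ≠ 0) (x₀ : X) (θ₀ : ℝ)
    (hθ : f x₀ = ‖f x₀‖ * Complex.exp (θ₀ * Complex.I)) :
    ∃ Θ : X → ℝ, IsArgLift f Θ univ ∧ Θ x₀ = θ₀ := by
  have hpos : 0 < ‖f x₀‖ := norm_pos_iff.2 (h0 x₀)
  obtain ⟨F, ⟨hF0, hF⟩, -⟩ := Complex.isCoveringMapOn_exp.existsUnique_continuousMap_lifts
    (⟨f, hf⟩ : C(X, ℂ)) (a₀ := x₀) (e₀ := (Real.log ‖f x₀‖ : ℝ) + θ₀ * Complex.I)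
    (by
      rw [Complex.exp_add, ← Complex.ofReal_exp, Real.exp_log hpos]
      exact hθ.symm) (fun a => h0 a)
  refine ⟨fun x => (F x).im, ⟨(Complex.continuous_im.comp F.continuous).continuousOn, ?_⟩, ?_⟩
  · intro x _
    have hx : f x = Complex.exp (F x) := (congrFun hF x).symm
    rw [hx, Complex.norm_exp, Complex.ofReal_exp, ← Complex.exp_add, Complex.re_add_im]
  · simp [hF0]

lemma IsArgLift.mono {f : X → ℂ} {Θ : X → ℝ} {s t : Set X} (h : IsArgLift f Θ t) (hst : s ⊆ t) :
    IsArgLift f Θ s :=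
  ⟨h.1.mono hst, fun x hx => h.2 x (hst hx)⟩

lemma IsArgLift.comp {Y : Type*} [TopologicalSpace Y] {f : X → ℂ} {Θ : X → ℝ} {s : Set X}
    (h : IsArgLift f Θ s) {u : Y → X} {t : Set Y} (hu : ContinuousOn u t) (hm : MapsTo u t s) :
    IsArgLift (f ∘ u) (Θ ∘ u) t :=
  ⟨h.1.comp hu hm, fun y hy => h.2 (u y) (hm hy)⟩

lemma IsArgLift.congr {f f' : X → ℂ} {Θ : X → ℝ} {s : Set X} (h : IsArgLift f Θ s)
    (he : ∀ x ∈ s, f' x = f x) : IsArgLift f' Θ s :=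
  ⟨h.1, fun x hx => by rw [he x hx]; exact h.2 x hx⟩

lemma IsArgLift.mul {f f' : X → ℂ} {Θ Θ' : X → ℝ} {s : Set X} (h : IsArgLift f Θ s)
    (h' : IsArgLift f' Θ' s) : IsArgLift (fun x => f x * f' x) (fun x => Θ x + Θ' x) s := by
  refine ⟨h.1.add h'.1, fun x hx => ?_⟩
  beta_reduce
  conv_lhs => rw [h.2 x hx, h'.2 x hx]
  simp only [norm_mul, Complex.ofReal_add, Complex.ofReal_mul, add_mul, Complex.exp_add]
  ring

lemma IsArgLift.star {f : X → ℂ} {Θ : X → ℝ} {s : Set X} (h : IsArgLift f Θ s) :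
    IsArgLift (fun x => (starRingEnd ℂ) (f x)) (fun x => -Θ x) s := by
  refine ⟨h.1.neg, fun x hx => ?_⟩
  beta_reduce
  conv_lhs => rw [h.2 x hx]
  simp [← Complex.exp_conj]

lemma IsArgLift.pos_smul {f : X → ℂ} {Θ : X → ℝ} {s : Set X} (h : IsArgLift f Θ s) {r : X → ℝ}
    (hr : ∀ x ∈ s, 0 < r x) : IsArgLift (fun x => (r x : ℂ) * f x) Θ s := by
  refine ⟨h.1, fun x hx => ?_⟩
  beta_reduce
  conv_lhs => rw [h.2 x hx]
  simp [abs_of_pos (hr x hx), mul_assoc]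

lemma isArgLift_arg {f : X → ℂ} {s : Set X} (hf : ContinuousOn f s)
    (hs : ∀ x ∈ s, f x ∈ Complex.slitPlane) : IsArgLift f (fun x => (f x).arg) s :=
  ⟨fun x hx => (Complex.continuousAt_arg (hs x hx)).comp_continuousWithinAt (hf x hx),
    fun x _ => (Complex.norm_mul_exp_arg_mul_I (f x)).symm⟩

/-- Two arguments of a nonvanishing function differ by a continuous function with values in 2πℤ. -/
lemma IsArgLift.sub_eq_sub {f : X → ℂ} {Θ Θ' : X → ℝ} {s : Set X} (h : IsArgLift f Θ s)
    (h' : IsArgLift f Θ' s) (hs : IsPreconnected s) (h0 : ∀ x ∈ s, f x ≠ 0) {x y : X}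
    (hx : x ∈ s) (hy : y ∈ s) : Θ x - Θ' x = Θ y - Θ' y := by
  have key := eq_of_continuousOn_of_int (h := fun x => (Θ x - Θ' x) / (2 * Real.pi)) hs
    ((h.1.sub h'.1).div_const _) (fun z hz => ?_) hx hy
  · have := Real.pi_pos
    field_simp at key
    linarith
  · have e1 := h.2 z hz
    have e2 := h'.2 z hz
    have hn : (‖f z‖ : ℂ) ≠ 0 := by simpa using h0 z hz
    have e3 := mul_left_cancel₀ hn (e1.symm.trans e2)
    obtain ⟨n, hn⟩ := Complex.exp_eq_exp_iff_exists_int.1 e3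
    refine ⟨n, ?_⟩
    have : ((Θ z : ℝ) : ℂ) = Θ' z + n * (2 * Real.pi) := by
      have hI := Complex.I_ne_zero
      apply mul_right_cancel₀ hI
      rw [hn]; ring
    have h3 : Θ z = Θ' z + n * (2 * Real.pi) := by exact_mod_cast this
    have := Real.pi_pos
    rw [h3]; field_simp; ring

lemma IsArgLift.eq_of_eq {f : X → ℂ} {Θ Θ' : X → ℝ} {s : Set X} (h : IsArgLift f Θ s)
    (h' : IsArgLift f Θ' s) (hs : IsPreconnected s) (h0 : ∀ x ∈ s, f x ≠ 0) {x y : X}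
    (hx : x ∈ s) (hxe : Θ x = Θ' x) (hy : y ∈ s) : Θ y = Θ' y := by
  have := h.sub_eq_sub h' hs h0 hx hy
  linarith

end ArgLift

/-! ## Maslov pairs and the index formula -/

section MaslovPair

variable {E : Type*} [NormedAddCommGroup E] [NormedSpace ℝ E]

/-- A function `ζ` on Lagrangian subspaces with values in `ℂ \ 0` together with a real function
`g` such that `2 g` is an argument of `± ζ`, continuous off the subspaces that meet `V`, and whose
jumps at regular crossings are given by the signatures of crossing forms. -/
structure IsMaslovPair (ω : LinearMap.BilinForm ℝ E) (V : Submodule ℝ E)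
    (ζ : Submodule ℝ E → ℂ) (g : Submodule ℝ E → ℝ) : Prop where
  ne_zero : ∀ L, IsLagrangian ω L → ζ L ≠ 0
  continuousOn : ∀ {X : Type} [TopologicalSpace X] (Λ : X → Submodule ℝ E) (s : Set X),
    IsLagrangianFamilyOn ω Λ s → ContinuousOn (fun x => ζ (Λ x)) s
  sq_eq : ∀ L, IsLagrangian ω L →
    ζ L ^ 2 = (‖ζ L‖ : ℂ) ^ 2 * Complex.exp ((4 * g L : ℝ) * Complex.I)
  continuousWithinAt : ∀ (Λ : ℝ → Submodule ℝ E) (a b t : ℝ),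
    IsLagrangianFamilyOn ω Λ (Icc a b) → t ∈ Icc a b → Λ t ⊓ V = ⊥ →
    ContinuousWithinAt (fun y => g (Λ y)) (Icc a b) t
  eventually_transverse : ∀ (Λ : ℝ → Submodule ℝ E) (a b t : ℝ),
    IsLagrangianFamilyOn ω Λ (Icc a b) → t ∈ Icc a b → Λ t ⊓ V = ⊥ →
    ∀ᶠ y in 𝓝[Icc a b] t, Λ y ⊓ V = ⊥
  isolated : ∀ (Λ : ℝ → Submodule ℝ E) (a b t : ℝ) (Q : QuadraticForm ℝ ↥(Λ t ⊓ V)),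
    IsLagrangianFamilyOn ω Λ (Icc a b) → a < b → t ∈ Icc a b → Λ t ⊓ V ≠ ⊥ →
    IsCrossingForm ω Λ V a b t Q → Q.Nondegenerate →
    ∀ᶠ y in 𝓝[Icc a b \ {t}] t, Λ y ⊓ V = ⊥
  tendsto_right : ∀ (Λ : ℝ → Submodule ℝ E) (a b t : ℝ) (Q : QuadraticForm ℝ ↥(Λ t ⊓ V)),
    IsLagrangianFamilyOn ω Λ (Icc a b) → a < b → t ∈ Icc a b → Λ t ⊓ V ≠ ⊥ →
    IsCrossingForm ω Λ V a b t Q → Q.Nondegenerate →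
    Tendsto (fun y => g (Λ y)) (𝓝[Icc a b ∩ Ioi t] t)
      (𝓝 (g (Λ t) - Real.pi / 2 * ((sigPos Q : ℝ) - sigNeg Q)))
  tendsto_left : ∀ (Λ : ℝ → Submodule ℝ E) (a b t : ℝ) (Q : QuadraticForm ℝ ↥(Λ t ⊓ V)),
    IsLagrangianFamilyOn ω Λ (Icc a b) → a < b → t ∈ Icc a b → Λ t ⊓ V ≠ ⊥ →
    IsCrossingForm ω Λ V a b t Q → Q.Nondegenerate →
    Tendsto (fun y => g (Λ y)) (𝓝[Icc a b ∩ Iio t] t)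
      (𝓝 (g (Λ t) + Real.pi / 2 * ((sigPos Q : ℝ) - sigNeg Q)))

/-- The step function with value `0` on negative numbers, `1 / 2` at `0` and `1` on positive
numbers. -/
def halfStep (x : ℝ) : ℝ := if x < 0 then 0 else if x = 0 then 1 / 2 else 1

lemma halfStep_of_neg {x : ℝ} (h : x < 0) : halfStep x = 0 := by simp [halfStep, h]

lemma halfStep_zero : halfStep 0 = 1 / 2 := by simp [halfStep]

lemma halfStep_of_pos {x : ℝ} (h : 0 < x) : halfStep x = 1 := by
  simp [halfStep, h.le, h.ne']

lemma continuousAt_halfStep {x : ℝ} (h : x ≠ 0) : ContinuousAt halfStep x := by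
  rcases lt_or_gt_of_ne h with h | h
  · exact (continuousAt_const (y := (0 : ℝ))).congr
      ((eventually_lt_nhds h).mono fun y hy => (halfStep_of_neg hy).symm)
  · exact (continuousAt_const (y := (1 : ℝ))).congr
      ((eventually_gt_nhds h).mono fun y hy => (halfStep_of_pos hy).symm)

/-- A function with half-integer values which has jumps `σ c / 2` on both sides of the points `c` of
a finite set and is continuous elsewhere grows by the weighted sum of the jumps. -/
lemma sub_eq_sum_jumps {F : ℝ → ℝ} {a b : ℝ} (hab : a < b) (C : Finset ℝ) (σ : ℝ → ℤ)
    (hC : ∀ t ∈ C, t ∈ Icc a b) (hz : ∀ t ∈ Icc a b, ∃ n : ℤ, 2 * F t = n)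
    (hcont : ∀ t ∈ Icc a b, t ∉ C → ContinuousWithinAt F (Icc a b) t)
    (hr : ∀ t ∈ C, Tendsto F (𝓝[Icc a b ∩ Ioi t] t) (𝓝 (F t + σ t / 2)))
    (hl : ∀ t ∈ C, Tendsto F (𝓝[Icc a b ∩ Iio t] t) (𝓝 (F t - σ t / 2))) :
    F b - F a = ∑ t ∈ C, (if t = a ∨ t = b then (1 / 2 : ℝ) else 1) * σ t := by
  -- Subtracting a step of height σ c at each c, with the midpoint value at c itself, removes every
  -- jump. The difference is continuous and still half-integer valued, hence constant.
  set H : ℝ → ℝ := fun t => F t - ∑ c ∈ C, σ c * halfStep (t - c) with hH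
  have hstep : ∀ c t : ℝ, c ≠ t →
      ContinuousWithinAt (fun t => σ c * halfStep (t - c)) (Icc a b) t := by
    intro c t hct
    have : ContinuousAt (fun t => halfStep (t - c)) t :=
      ContinuousAt.comp (f := fun t => t - c) (g := halfStep)
        (continuousAt_halfStep (sub_ne_zero.2 hct.symm)) (by fun_prop)
    exact (continuousAt_const.mul this).continuousWithinAt
  have hHc : ContinuousOn H (Icc a b) := by
    intro t ht
    by_cases htC : t ∈ C
    · have e : H = fun t' => (F t' - σ t * halfStep (t' - t)) -
          ∑ c ∈ C.erase t, σ c * halfStep (t' - c) := by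
        funext t'
        simp only [hH]
        rw [← Finset.add_sum_erase C _ htC]
        ring
      rw [e]
      refine ContinuousWithinAt.sub ?_ (tendsto_finsetSum _ fun c hc =>
        hstep c t (Finset.ne_of_mem_erase hc))
      have hL : ContinuousWithinAt (fun t' => F t' - σ t * halfStep (t' - t))
          (Icc a b ∩ Iio t) t := by
        have h1 : Tendsto (fun t' => F t' - σ t * halfStep (t' - t)) (𝓝[Icc a b ∩ Iio t] t)
            (𝓝 (F t - σ t / 2)) := by
          refine (hl t htC).congr' ?_
          filter_upwards [self_mem_nhdsWithin] with y hy
          rw [halfStep_of_neg (sub_neg.2 hy.2)]; ring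
        convert h1 using 1
        simp only [ContinuousWithinAt, sub_self, halfStep_zero]
        rw [show F t - σ t * (1 / 2) = F t - σ t / 2 by ring]
      have hR : ContinuousWithinAt (fun t' => F t' - σ t * halfStep (t' - t))
          (Icc a b ∩ Ioi t) t := by
        have h1 : Tendsto (fun t' => F t' - σ t * halfStep (t' - t)) (𝓝[Icc a b ∩ Ioi t] t)
            (𝓝 (F t + σ t / 2 - σ t)) := by
          refine ((hr t htC).sub_const _).congr' ?_
          filter_upwards [self_mem_nhdsWithin] with y hy
          rw [halfStep_of_pos (sub_pos.2 hy.2)]; ring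
        convert h1 using 1
        simp only [ContinuousWithinAt, sub_self, halfStep_zero]
        rw [show F t - σ t * (1 / 2) = F t + σ t / 2 - σ t by ring]
      refine ((hL.union hR).union (continuousWithinAt_singleton (x := t))).mono ?_
      intro y hy
      rcases lt_trichotomy y t with h | h | h
      · exact Or.inl (Or.inl ⟨hy, h⟩)
      · exact Or.inr h
      · exact Or.inl (Or.inr ⟨hy, h⟩)
    · exact (hcont t ht htC).sub (tendsto_finsetSum _ fun c hc =>
        hstep c t (fun h => htC (h ▸ hc)))
  have hHz : ∀ t ∈ Icc a b, ∃ n : ℤ, 2 * H t = n := by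
    intro t ht
    obtain ⟨n, hn⟩ := hz t ht
    have hs : ∀ c : ℝ, ∃ m : ℤ, 2 * halfStep (t - c) = m := by
      intro c
      rcases lt_trichotomy (t - c) 0 with h | h | h
      · exact ⟨0, by simp [halfStep_of_neg h]⟩
      · exact ⟨1, by simp [h, halfStep_zero]⟩
      · exact ⟨2, by simp [halfStep_of_pos h]⟩
    choose m hm using hs
    refine ⟨n - ∑ c ∈ C, σ c * m c, ?_⟩
    push_cast
    rw [← hn]
    simp only [hH, mul_sub, Finset.mul_sum, ← hm]
    congr 1
    exact Finset.sum_congr rfl fun c _ => by ring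
  have key := eq_of_continuousOn_of_int (h := fun t => 2 * H t) isPreconnected_Icc
    (continuousOn_const.mul hHc) hHz (left_mem_Icc.2 hab.le) (right_mem_Icc.2 hab.le)
  have : F b - F a = ∑ c ∈ C, (σ c * halfStep (b - c) - σ c * halfStep (a - c)) := by
    rw [Finset.sum_sub_distrib]
    simp only [hH] at key
    linarith
  rw [this]
  -- The step at an interior c grows by 1 over [a, b]; for c = a or c = b it grows by 1/2, because
  -- of the midpoint value at 0. These are the weights of the index.
  refine Finset.sum_congr rfl fun c hc => ?_
  obtain ⟨h1, h2⟩ := hC c hc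
  rcases h1.eq_or_lt with rfl | h1
  · rw [halfStep_of_pos (sub_pos.2 hab), sub_self, halfStep_zero]
    simp; ring
  · rcases h2.eq_or_lt with rfl | h2
    · rw [halfStep_of_neg (sub_neg.2 hab), sub_self, halfStep_zero]
      simp; ring
    · rw [halfStep_of_neg (sub_neg.2 h1), halfStep_of_pos (sub_pos.2 h2)]
      simp [h1.ne', h2.ne]

variable {ω : LinearMap.BilinForm ℝ E} {V : Submodule ℝ E} {ζ : Submodule ℝ E → ℂ}
  {g : Submodule ℝ E → ℝ}

/-- Both 2Θ and 4g are arguments of ζ², so (Θ - 2g)/2π has values in ½ℤ. As Θ is continuous, its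
jumps are those of -g/π, namely sign Γ / 2 on each side of a crossing. -/
lemma IsMaslovPair.index_of_hasRegularIndex (hM : IsMaslovPair ω V ζ g) {Λ : ℝ → Submodule ℝ E}
    {a b : ℝ} (hab : a < b) {μ : ℚ} (hμ : HasRegularIndex ω Λ V a b μ) {Θ : ℝ → ℝ}
    (hΘ : IsArgLift (fun t => ζ (Λ t)) Θ (Icc a b)) :
    2 * Real.pi * μ = (Θ b - 2 * g (Λ b)) - (Θ a - 2 * g (Λ a)) := by
  obtain ⟨hΛ, C, Q, hC, hQ, rfl⟩ := hμ
  have hpi := Real.pi_pos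
  have hstep := sub_eq_sum_jumps (F := fun t => (Θ t - 2 * g (Λ t)) / (2 * Real.pi)) hab C
    (fun t => (sigPos (Q t) : ℤ) - sigNeg (Q t)) (fun t ht => ((hC t).1 ht).1) ?_ ?_ ?_ ?_
  · have e : (Θ b - 2 * g (Λ b)) - (Θ a - 2 * g (Λ a)) = 2 * Real.pi *
        ((Θ b - 2 * g (Λ b)) / (2 * Real.pi) - (Θ a - 2 * g (Λ a)) / (2 * Real.pi)) := by
      field_simp
    rw [e, hstep]
    push_cast
    congr 1
    refine Finset.sum_congr rfl fun t _ => ?_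
    split_ifs <;> norm_num
  · intro t ht
    have hne := hM.ne_zero _ (hΛ.2 t ht)
    have e1 : ζ (Λ t) = ‖ζ (Λ t)‖ * Complex.exp (Θ t * Complex.I) := hΘ.2 t ht
    have e2 := hM.sq_eq _ (hΛ.2 t ht)
    have hn : (‖ζ (Λ t)‖ : ℂ) ^ 2 ≠ 0 := pow_ne_zero _ (by simpa using hne)
    have e3 : (‖ζ (Λ t)‖ : ℂ) ^ 2 * Complex.exp ((2 * Θ t : ℝ) * Complex.I) =
        (‖ζ (Λ t)‖ : ℂ) ^ 2 * Complex.exp ((4 * g (Λ t) : ℝ) * Complex.I) := by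
      rw [← e2]
      conv_rhs => rw [e1]
      rw [mul_pow, ← Complex.exp_nat_mul]
      congr 2
      push_cast; ring
    obtain ⟨n, hn⟩ := Complex.exp_eq_exp_iff_exists_int.1 (mul_left_cancel₀ hn e3)
    refine ⟨n, ?_⟩
    have h1 : ((2 * Θ t : ℝ) : ℂ) = (4 * g (Λ t) : ℝ) + n * (2 * Real.pi) := by
      apply mul_right_cancel₀ Complex.I_ne_zero
      rw [hn]; ring
    have h2 : 2 * Θ t = 4 * g (Λ t) + n * (2 * Real.pi) := by exact_mod_cast h1
    rw [← mul_div_assoc, div_eq_iff (by positivity)]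
    linarith
  · intro t ht htC
    have : Λ t ⊓ V = ⊥ := by
      by_contra h
      exact htC ((hC t).2 ⟨ht, h⟩)
    exact ((hΘ.1 t ht).sub (continuousWithinAt_const.mul
      (hM.continuousWithinAt Λ a b t hΛ ht this))).div_const _
  · intro t ht
    obtain ⟨h1, h2⟩ := (hC t).1 ht
    have h3 := hM.tendsto_right Λ a b t (Q t) hΛ hab h1 h2 (hQ t ht).1 (hQ t ht).2
    have h4 : Tendsto Θ (𝓝[Icc a b ∩ Ioi t] t) (𝓝 (Θ t)) :=
      (hΘ.1 t h1).mono inter_subset_left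
    have h5 := (h4.sub (h3.const_mul 2)).div_const (2 * Real.pi)
    convert h5 using 2
    push_cast
    field_simp
    ring
  · intro t ht
    obtain ⟨h1, h2⟩ := (hC t).1 ht
    have h3 := hM.tendsto_left Λ a b t (Q t) hΛ hab h1 h2 (hQ t ht).1 (hQ t ht).2
    have h4 : Tendsto Θ (𝓝[Icc a b ∩ Iio t] t) (𝓝 (Θ t)) :=
      (hΘ.1 t h1).mono inter_subset_left
    have h5 := (h4.sub (h3.const_mul 2)).div_const (2 * Real.pi)
    convert h5 using 2
    push_cast
    field_simp
    ring

/-- The argument of ζ lifts over the whole homotopy, and on the two sides where the homotopy is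
constant so is the lift. Hence the right-hand side is the same for the path and its regular
representative. Any admissible value satisfies the formula, so no separate uniqueness argument is
needed. -/
lemma IsMaslovPair.index_of_isRSIndex (hM : IsMaslovPair ω V ζ g) {Λ : ℝ → Submodule ℝ E}
    {a b : ℝ} (hab : a < b) {μ : ℚ} (hμ : IsRSIndex ω Λ V a b μ) {Θ : ℝ → ℝ}
    (hΘ : IsArgLift (fun t => ζ (Λ t)) Θ (Icc a b)) :
    2 * Real.pi * μ = (Θ b - 2 * g (Λ b)) - (Θ a - 2 * g (Λ a)) := by
  obtain ⟨Λ', ⟨H, hH, h0, h1, hend⟩, hreg⟩ := hμ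
  have ha : a ∈ Icc a b := left_mem_Icc.2 hab.le
  have hb : b ∈ Icc a b := right_mem_Icc.2 hab.le
  have u0 : (0 : ℝ) ∈ Icc (0 : ℝ) 1 := by simp
  have u1 : (1 : ℝ) ∈ Icc (0 : ℝ) 1 := by simp
  -- The retraction of the plane onto the parameter rectangle extends ζ ∘ H to a simply connected
  -- space on which arguments can be lifted.
  let pr : ℝ × ℝ → ℝ × ℝ := fun z =>
    (projIcc 0 1 zero_le_one z.1, projIcc a b hab.le z.2)
  have hpr : Continuous pr := by
    refine Continuous.prodMk ?_ ?_
    · exact continuous_subtype_val.comp (continuous_projIcc.comp continuous_fst)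
    · exact continuous_subtype_val.comp (continuous_projIcc.comp continuous_snd)
  have hprm : ∀ z, pr z ∈ Icc (0 : ℝ) 1 ×ˢ Icc a b := fun z => ⟨Subtype.prop _, Subtype.prop _⟩
  have hpre : ∀ z ∈ Icc (0 : ℝ) 1 ×ˢ Icc a b, pr z = z := fun z hz => by
    simp [pr, projIcc_of_mem _ hz.1, projIcc_of_mem _ hz.2]
  have hcont : Continuous fun z => ζ (H (pr z)) :=
    continuousOn_univ.1 ((hM.continuousOn H _ hH).comp hpr.continuousOn fun z _ => hprm z)
  have hne : ∀ z, ζ (H (pr z)) ≠ 0 := fun z => hM.ne_zero _ (hH.2 _ (hprm z))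
  obtain ⟨Φ, hΦ, hΦ0⟩ := exists_isArgLift hcont hne (0, a) (Θ a) (by
    rw [hpre _ ⟨u0, ha⟩, h0 a ha]
    exact hΘ.2 a ha)
  have edge0 : IsArgLift (fun t => ζ (Λ t)) (fun t => Φ (0, t)) (Icc a b) := by
    refine (hΦ.comp (u := fun t : ℝ => ((0 : ℝ), t)) (t := Icc a b) (by fun_prop)
      (mapsTo_univ _ _)).congr fun t ht => ?_
    simp [hpre _ (show ((0 : ℝ), t) ∈ _ from ⟨u0, ht⟩), h0 t ht]
  have edge1 : IsArgLift (fun t => ζ (Λ' t)) (fun t => Φ (1, t)) (Icc a b) := by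
    refine (hΦ.comp (u := fun t : ℝ => ((1 : ℝ), t)) (t := Icc a b) (by fun_prop)
      (mapsTo_univ _ _)).congr fun t ht => ?_
    simp [hpre _ (show ((1 : ℝ), t) ∈ _ from ⟨u1, ht⟩), h1 t ht]
  have side : ∀ t ∈ Icc a b, (∀ s ∈ Icc (0 : ℝ) 1, H (s, t) = Λ t) → Φ (1, t) = Φ (0, t) := by
    intro t ht hs
    have e : IsArgLift (fun _ : ℝ => ζ (Λ t)) (fun s => Φ (s, t)) (Icc 0 1) := by
      refine (hΦ.comp (u := fun s : ℝ => (s, t)) (t := Icc 0 1) (by fun_prop)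
        (mapsTo_univ _ _)).congr fun s hs' => ?_
      simp [hpre _ (show (s, t) ∈ _ from ⟨hs', ht⟩), hs s hs']
    have e' : IsArgLift (fun _ : ℝ => ζ (Λ t)) (fun _ => Φ (0, t)) (Icc 0 1) :=
      ⟨continuousOn_const, fun s _ => e.2 0 u0⟩
    have hL : IsLagrangian ω (Λ t) := by
      rw [← hs 0 u0]; exact hH.2 _ ⟨u0, ht⟩
    exact e.eq_of_eq e' isPreconnected_Icc (fun _ _ => hM.ne_zero _ hL) u0 rfl u1
  have eb : Φ (0, b) = Θ b := edge0.eq_of_eq hΘ isPreconnected_Icc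
    (fun t ht => by rw [← h0 t ht]; exact hM.ne_zero _ (hH.2 _ ⟨u0, ht⟩)) ha hΦ0 hb
  have key := hM.index_of_hasRegularIndex hab hreg edge1
  have la : Λ' a = Λ a := by rw [← h1 a ha, (hend 1 u1).1, ← h0 a ha, (hend 0 u0).1]
  have lb : Λ' b = Λ b := by rw [← h1 b hb, (hend 1 u1).2]
  rw [key, side a ha fun s hs => (hend s hs).1, side b hb fun s hs => (hend s hs).2, eb, hΦ0, la,
    lb]

/-- The Robbin–Salamon index in terms of a Maslov pair. -/
theorem IsMaslovPair.rsIndex_eq (hM : IsMaslovPair ω V ζ g) {Λ : ℝ → Submodule ℝ E}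
    {a b : ℝ} (hab : a < b) (hex : ∃ μ, IsRSIndex ω Λ V a b μ) {Θ : ℝ → ℝ}
    (hΘ : IsArgLift (fun t => ζ (Λ t)) Θ (Icc a b)) :
    2 * Real.pi * rsIndex ω Λ V a b = (Θ b - 2 * g (Λ b)) - (Θ a - 2 * g (Λ a)) := by
  rw [rsIndex, dif_pos hex]
  exact hM.index_of_isRSIndex hab hex.choose_spec hΘ

/-- A path whose crossings all have nondegenerate crossing forms has a regular index. -/
lemma IsMaslovPair.exists_hasRegularIndex (hM : IsMaslovPair ω V ζ g) {Λ : ℝ → Submodule ℝ E}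
    {a b : ℝ} (hab : a < b) (hΛ : IsLagrangianFamilyOn ω Λ (Icc a b))
    (hQ : ∀ t ∈ Icc a b, Λ t ⊓ V ≠ ⊥ →
      ∃ Q : QuadraticForm ℝ ↥(Λ t ⊓ V), IsCrossingForm ω Λ V a b t Q ∧ Q.Nondegenerate) :
    ∃ μ, HasRegularIndex ω Λ V a b μ := by
  -- Infinitely many crossings would accumulate in the compact interval, but points near a
  -- transverse time are transverse, and nondegenerate crossings are isolated.
  have hfin : {t ∈ Icc a b | Λ t ⊓ V ≠ ⊥}.Finite := by
    by_contra hinf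
    obtain ⟨x, hx, hacc⟩ := Set.Infinite.exists_accPt_of_subset_isCompact
      (K := Icc a b) hinf isCompact_Icc (sep_subset _ _)
    have hev : ∀ᶠ y in 𝓝[Icc a b \ {x}] x, Λ y ⊓ V = ⊥ := by
      by_cases hxV : Λ x ⊓ V = ⊥
      · exact nhdsWithin_mono _ sdiff_subset (hM.eventually_transverse Λ a b x hΛ hx hxV)
      · obtain ⟨Q, h1, h2⟩ := hQ x hx hxV
        exact hM.isolated Λ a b x Q hΛ hab hx hxV h1 h2
    rw [accPt_iff_frequently] at hacc
    rw [eventually_nhdsWithin_iff] at hev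
    obtain ⟨y, ⟨h1, h2⟩, h3⟩ := (hacc.and_eventually hev).exists
    exact h2.2 (h3 ⟨h2.1, h1⟩)
  classical
  choose! Q hQ' using hQ
  refine ⟨_, hΛ, hfin.toFinset, Q, fun t => by simp, fun t ht => ?_, rfl⟩
  have ht' : t ∈ Icc a b ∧ Λ t ⊓ V ≠ ⊥ := by simpa using ht
  exact hQ' t ht'.1 ht'.2

end MaslovPair

/-! ## Frames of Lagrangian subspaces in Darboux coordinates -/

section Frames

variable {E : Type*} [NormedAddCommGroup E] [NormedSpace ℝ E] {n : ℕ}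

/-- The frame whose members are the combinations of the members of `Z` with the rows of `A` as
coefficients. -/
def mulFrame (A : Matrix (Fin n) (Fin n) ℝ) (Z : Fin n → E) : Fin n → E :=
  fun i => ∑ j, A i j • Z j

lemma mulFrame_mulFrame (A B : Matrix (Fin n) (Fin n) ℝ) (Z : Fin n → E) :
    mulFrame A (mulFrame B Z) = mulFrame (A * B) Z := by
  funext i
  simp only [mulFrame, Finset.smul_sum, Matrix.mul_apply, Finset.sum_smul, smul_smul]
  exact Finset.sum_comm

lemma mulFrame_one (Z : Fin n → E) : mulFrame 1 Z = Z := by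
  funext i
  simp [mulFrame, Matrix.one_apply, ite_smul]

lemma span_mulFrame_le (A : Matrix (Fin n) (Fin n) ℝ) (Z : Fin n → E) :
    Submodule.span ℝ (range (mulFrame A Z)) ≤ Submodule.span ℝ (range Z) := by
  rw [Submodule.span_le]
  rintro _ ⟨i, rfl⟩
  exact Submodule.sum_mem _ fun j _ => Submodule.smul_mem _ _ (Submodule.subset_span ⟨j, rfl⟩)

lemma span_mulFrame {A : Matrix (Fin n) (Fin n) ℝ} (hA : A.det ≠ 0) (Z : Fin n → E) :
    Submodule.span ℝ (range (mulFrame A Z)) = Submodule.span ℝ (range Z) := by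
  refine le_antisymm (span_mulFrame_le A Z) ?_
  have := span_mulFrame_le A⁻¹ (mulFrame A Z)
  rwa [mulFrame_mulFrame, Matrix.nonsing_inv_mul _ (isUnit_iff_ne_zero.2 hA), mulFrame_one] at this

lemma linearIndependent_mulFrame {A : Matrix (Fin n) (Fin n) ℝ} (hA : A.det ≠ 0) {Z : Fin n → E}
    (hZ : LinearIndependent ℝ Z) : LinearIndependent ℝ (mulFrame A Z) := by
  rw [linearIndependent_iff_card_eq_finrank_span, Set.finrank, span_mulFrame hA]
  rw [linearIndependent_iff_card_eq_finrank_span, Set.finrank] at hZ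
  exact hZ

lemma exists_eq_mulFrame {Z W : Fin n → E} (hW : LinearIndependent ℝ W)
    (h : Submodule.span ℝ (range W) = Submodule.span ℝ (range Z)) :
    ∃ A : Matrix (Fin n) (Fin n) ℝ, A.det ≠ 0 ∧ W = mulFrame A Z := by
  have hm : ∀ i, ∃ c : Fin n → ℝ, ∑ j, c j • Z j = W i := fun i =>
    (Submodule.mem_span_range_iff_exists_fun ℝ).1 (h ▸ Submodule.subset_span ⟨i, rfl⟩)
  choose A hA using hm
  have hWA : W = mulFrame (Matrix.of A) Z := by
    funext i; exact (hA i).symm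
  refine ⟨Matrix.of A, fun h0 => ?_, hWA⟩
  obtain ⟨v, hv, hv0⟩ := Matrix.exists_vecMul_eq_zero_iff.2 h0
  refine hv (funext (Fintype.linearIndependent_iff.1 hW v ?_))
  rw [hWA]
  simp only [mulFrame, Finset.smul_sum, smul_smul]
  rw [Finset.sum_comm]
  refine Finset.sum_eq_zero fun j _ => ?_
  rw [← Finset.sum_smul]
  have := congrFun hv0 j
  simp only [Matrix.vecMul, dotProduct, Pi.zero_apply] at this
  rw [this, zero_smul]

/-- Linear Darboux coordinates for `ω`, up to the factor `c`. -/
structure IsDarboux (ω : LinearMap.BilinForm ℝ E) (c : ℝ) (Q P : E →ₗ[ℝ] (Fin n → ℝ)) : Prop where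
  pos : 0 < c
  form : ∀ x y, ω x y = c * (Q x ⬝ᵥ P y - P x ⬝ᵥ Q y)
  bij : Function.Bijective (Q.prod P)

variable {ω : LinearMap.BilinForm ℝ E} {c : ℝ} {Q P : E →ₗ[ℝ] (Fin n → ℝ)}

lemma IsDarboux.eq_zero (h : IsDarboux ω c Q P) {x : E} (hq : Q x = 0) (hp : P x = 0) : x = 0 :=
  h.bij.1 (by simp [hq, hp])

lemma IsDarboux.finiteDimensional (h : IsDarboux ω c Q P) : FiniteDimensional ℝ E :=
  (LinearEquiv.ofBijective _ h.bij).symm.finiteDimensional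

lemma IsDarboux.finrank (h : IsDarboux ω c Q P) : Module.finrank ℝ E = n + n := by
  rw [(LinearEquiv.ofBijective _ h.bij).finrank_eq]
  simp

lemma IsDarboux.ker_eq_bot (h : IsDarboux ω c Q P) : LinearMap.ker ω = ⊥ := by
  rw [Submodule.eq_bot_iff]
  intro x hx
  have hx' : ∀ y, ω x y = 0 := fun y => by rw [LinearMap.mem_ker.1 hx]; rfl
  -- This y is the image of x under the complex structure of the coordinates; pairing x with it
  -- gives c times the squared norm of x.
  obtain ⟨y, hy⟩ := h.bij.2 (-P x, Q x)
  have h1 : Q y = -P x := congrArg Prod.fst hy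
  have h2 : P y = Q x := congrArg Prod.snd hy
  have := hx' y
  rw [h.form, h1, h2, dotProduct_neg, sub_neg_eq_add] at this
  have h3 := (mul_eq_zero.1 this).resolve_left h.pos.ne'
  have a1 : 0 ≤ Q x ⬝ᵥ Q x := Finset.sum_nonneg fun i _ => mul_self_nonneg _
  have a2 : 0 ≤ P x ⬝ᵥ P x := Finset.sum_nonneg fun i _ => mul_self_nonneg _
  exact h.eq_zero (dotProduct_self_eq_zero.1 (by linarith)) (dotProduct_self_eq_zero.1 (by linarith))

lemma IsDarboux.finrank_lagrangian (h : IsDarboux ω c Q P) {L : Submodule ℝ E}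
    (hL : IsLagrangian ω L) : Module.finrank ℝ L = n := by
  have := h.finiteDimensional
  have e := LinearMap.BilinForm.finrank_add_finrank_orthogonal' (B := ω) L
  rw [h.ker_eq_bot, inf_bot_eq, finrank_bot, h.finrank, show ω.orthogonal L = L from hL] at e
  omega

lemma IsDarboux.isLagrangian_span (h : IsDarboux ω c Q P) {Z : Fin n → E}
    (hZ : LinearIndependent ℝ Z) (h0 : ∀ i j, ω (Z i) (Z j) = 0) :
    IsLagrangian ω (Submodule.span ℝ (range Z)) := by
  have := h.finiteDimensional
  have e := LinearMap.BilinForm.finrank_add_finrank_orthogonal' (B := ω)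
    (Submodule.span ℝ (range Z))
  rw [h.ker_eq_bot, inf_bot_eq, finrank_bot, h.finrank, finrank_span_eq_card hZ,
    Fintype.card_fin] at e
  refine (Submodule.eq_of_le_of_finrank_eq ?_ ?_).symm
  · intro x hx
    rw [LinearMap.BilinForm.mem_orthogonal_iff]
    intro y hy
    obtain ⟨u, rfl⟩ := (Submodule.mem_span_range_iff_exists_fun ℝ).1 hx
    obtain ⟨v, rfl⟩ := (Submodule.mem_span_range_iff_exists_fun ℝ).1 hy
    simp [h0]
  · rw [finrank_span_eq_card hZ, Fintype.card_fin]; omega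

lemma IsLagrangian.apply_eq_zero {L : Submodule ℝ E} (hL : IsLagrangian ω L) {x y : E}
    (hx : x ∈ L) (hy : y ∈ L) : ω x y = 0 := by
  rw [← show ω.orthogonal L = L from hL, LinearMap.BilinForm.mem_orthogonal_iff] at hy
  exact hy x hx

lemma IsDarboux.exists_frame (h : IsDarboux ω c Q P) {L : Submodule ℝ E}
    (hL : IsLagrangian ω L) :
    ∃ Z : Fin n → E, LinearIndependent ℝ Z ∧ Submodule.span ℝ (range Z) = L := by
  have := h.finiteDimensional
  let B := Module.finBasisOfFinrankEq ℝ L (h.finrank_lagrangian hL)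
  refine ⟨fun i => B i, B.linearIndependent.map' L.subtype (Submodule.ker_subtype L), ?_⟩
  have := congrArg (Submodule.map L.subtype) B.span_eq
  rw [Submodule.map_span, ← range_comp, Submodule.map_top, Submodule.range_subtype] at this
  exact this

/-- Linearly independent vectors of a Lagrangian subspace, of the right number, span it. -/
lemma IsDarboux.span_eq (h : IsDarboux ω c Q P) {L : Submodule ℝ E} (hL : IsLagrangian ω L)
    {Z : Fin n → E} (hZ : LinearIndependent ℝ Z) (hm : ∀ i, Z i ∈ L) :
    Submodule.span ℝ (range Z) = L := by
  have := h.finiteDimensional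
  refine Submodule.eq_of_le_of_finrank_eq ?_ ?_
  · rw [Submodule.span_le]
    rintro _ ⟨i, rfl⟩
    exact hm i
  · rw [finrank_span_eq_card hZ, h.finrank_lagrangian hL, Fintype.card_fin]

/-! ### Complex and momentum determinants of a frame -/

variable (Q P) in
/-- The complex matrix with rows `Q (Z i) + i P (Z i)`. -/
def frameMatrix (Z : Fin n → E) : Matrix (Fin n) (Fin n) ℂ :=
  Matrix.of fun i j => (Q (Z i) j : ℂ) + P (Z i) j * Complex.I

variable (Q P) in
/-- The complex determinant of a frame. -/
def frameDet (Z : Fin n → E) : ℂ := (frameMatrix Q P Z).det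

variable (P) in
/-- The real matrix with rows `P (Z i)`. -/
def momentumMatrix (Z : Fin n → E) : Matrix (Fin n) (Fin n) ℝ := Matrix.of fun i => P (Z i)

variable (P) in
/-- The determinant of the momentum components of a frame. -/
def momentumDet (Z : Fin n → E) : ℝ := (momentumMatrix P Z).det

lemma frameDet_mulFrame (A : Matrix (Fin n) (Fin n) ℝ) (Z : Fin n → E) :
    frameDet Q P (mulFrame A Z) = (A.det : ℂ) * frameDet Q P Z := by
  have : frameMatrix Q P (mulFrame A Z) = A.map (algebraMap ℝ ℂ) * frameMatrix Q P Z := by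
    ext i j
    simp [frameMatrix, mulFrame, Matrix.mul_apply, mul_add, Finset.sum_add_distrib, Finset.sum_mul,
      mul_assoc]
  rw [frameDet, this, Matrix.det_mul, frameDet]
  congr 1
  exact (RingHom.map_det (algebraMap ℝ ℂ) A).symm

lemma momentumDet_mulFrame (A : Matrix (Fin n) (Fin n) ℝ) (Z : Fin n → E) :
    momentumDet P (mulFrame A Z) = A.det * momentumDet P Z := by
  have : momentumMatrix P (mulFrame A Z) = A * momentumMatrix P Z := by
    ext i j
    simp [momentumMatrix, mulFrame, Matrix.mul_apply]
  rw [momentumDet, this, Matrix.det_mul, momentumDet]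

/-- A Lagrangian subspace is totally real. A complex linear relation among the rows gives X, Y in
the subspace with Y the image of X under the complex structure up to sign, and then 0 = ω(X, Y) = c
|X|². -/
lemma IsDarboux.frameDet_ne_zero (h : IsDarboux ω c Q P) {Z : Fin n → E}
    (hZ : LinearIndependent ℝ Z) (hL : IsLagrangian ω (Submodule.span ℝ (range Z))) :
    frameDet Q P Z ≠ 0 := by
  intro h0
  obtain ⟨v, hv, hv0⟩ := Matrix.exists_vecMul_eq_zero_iff.2 h0
  set X := ∑ i, (v i).re • Z i with hX
  set Y := ∑ i, (v i).im • Z i with hY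
  have hmem : ∀ u : Fin n → ℝ, ∑ i, u i • Z i ∈ Submodule.span ℝ (range Z) := fun u =>
    (Submodule.mem_span_range_iff_exists_fun ℝ).2 ⟨u, rfl⟩
  have hcomp : ∀ j, ∑ i, v i * ((Q (Z i) j : ℂ) + P (Z i) j * Complex.I) = 0 := fun j => by
    simpa [Matrix.vecMul, dotProduct, frameMatrix] using congrFun hv0 j
  have h1 : Q X = P Y := by
    funext j
    have := congrArg Complex.re (hcomp j)
    simp only [Complex.re_sum, Complex.mul_re, Complex.add_re, Complex.ofReal_re, Complex.I_re,
      mul_zero, Complex.ofReal_im, Complex.I_im, mul_one, sub_self, add_zero, Complex.add_im,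
      Complex.mul_im, zero_add, Complex.zero_re, Finset.sum_sub_distrib] at this
    simp only [hX, hY, map_sum, map_smul, Finset.sum_apply, Pi.smul_apply, smul_eq_mul]
    linarith
  have h2 : P X = -Q Y := by
    funext j
    have := congrArg Complex.im (hcomp j)
    simp only [Complex.im_sum, Complex.mul_re, Complex.add_re, Complex.ofReal_re, Complex.I_re,
      mul_zero, Complex.ofReal_im, Complex.I_im, mul_one, sub_self, add_zero, Complex.add_im,
      Complex.mul_im, zero_add, Complex.zero_im, Finset.sum_add_distrib] at this
    simp only [hX, hY, map_sum, map_smul, Finset.sum_apply, Pi.smul_apply, smul_eq_mul, Pi.neg_apply]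
    linarith
  have h3 : ω X Y = 0 := hL.apply_eq_zero (hmem _) (hmem _)
  have h2' : Q Y = -P X := by rw [h2, neg_neg]
  rw [h.form, ← h1, h2', dotProduct_neg, sub_neg_eq_add] at h3
  have h4 := (mul_eq_zero.1 h3).resolve_left h.pos.ne'
  have a1 : 0 ≤ Q X ⬝ᵥ Q X := Finset.sum_nonneg fun i _ => mul_self_nonneg _
  have a2 : 0 ≤ P X ⬝ᵥ P X := Finset.sum_nonneg fun i _ => mul_self_nonneg _
  have q0 : Q X = 0 := dotProduct_self_eq_zero.1 (by linarith)
  have p0 : P X = 0 := dotProduct_self_eq_zero.1 (by linarith)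
  have X0 : X = 0 := h.eq_zero q0 p0
  have Y0 : Y = 0 := h.eq_zero (by rw [h2', p0, neg_zero]) (by rw [← h1, q0])
  rw [Fintype.linearIndependent_iff] at hZ
  refine hv (funext fun i => Complex.ext ?_ ?_)
  · exact hZ _ X0 i
  · exact hZ _ Y0 i

lemma inf_ker_eq_bot_iff {Z : Fin n → E} (hZ : LinearIndependent ℝ Z) :
    Submodule.span ℝ (range Z) ⊓ LinearMap.ker P = ⊥ ↔ momentumDet P Z ≠ 0 := by
  have hsum : ∀ v : Fin n → ℝ, Matrix.vecMul v (momentumMatrix P Z) = P (∑ i, v i • Z i) := by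
    intro v
    funext j
    simp [Matrix.vecMul, dotProduct, momentumMatrix]
  constructor
  · intro h h0
    obtain ⟨v, hv, hv0⟩ := Matrix.exists_vecMul_eq_zero_iff.2 h0
    rw [hsum] at hv0
    have : ∑ i, v i • Z i ∈ Submodule.span ℝ (range Z) ⊓ LinearMap.ker P :=
      ⟨(Submodule.mem_span_range_iff_exists_fun ℝ).2 ⟨v, rfl⟩, hv0⟩
    rw [h, Submodule.mem_bot] at this
    exact hv (funext (Fintype.linearIndependent_iff.1 hZ v this))
  · intro h
    rw [Submodule.eq_bot_iff]
    rintro x ⟨hx1, hx2⟩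
    obtain ⟨v, rfl⟩ := (Submodule.mem_span_range_iff_exists_fun ℝ).1 hx1
    by_contra hne
    refine h (Matrix.exists_vecMul_eq_zero_iff.1 ⟨v, ?_, ?_⟩)
    · rintro rfl; simp at hne
    · rw [hsum]; exact hx2

lemma IsDarboux.continuous_left (h : IsDarboux ω c Q P) : Continuous Q :=
  have := h.finiteDimensional
  Q.continuous_of_finiteDimensional

lemma IsDarboux.continuous_right (h : IsDarboux ω c Q P) : Continuous P :=
  have := h.finiteDimensional
  P.continuous_of_finiteDimensional

lemma IsDarboux.continuous_frameDet (h : IsDarboux ω c Q P) : Continuous (frameDet Q P) := by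
  have h1 := h.continuous_left
  have h2 := h.continuous_right
  refine Continuous.matrix_det (continuous_matrix fun i j => ?_)
  simp only [frameMatrix, Matrix.of_apply]
  fun_prop

lemma IsDarboux.continuous_momentumDet (h : IsDarboux ω c Q P) :
    Continuous (momentumDet P : (Fin n → E) → ℝ) := by
  have h2 := h.continuous_right
  refine Continuous.matrix_det (continuous_matrix fun i j => ?_)
  simp only [momentumMatrix, Matrix.of_apply]
  fun_prop

/-- A continuous family of Lagrangian subspaces has, close to each point, a frame with `n` members
that is continuous at the point. -/
lemma IsDarboux.exists_localFrame (h : IsDarboux ω c Q P) {X : Type*} [TopologicalSpace X]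
    {Λ : X → Submodule ℝ E} {s : Set X} (hΛ : IsLagrangianFamilyOn ω Λ s) {x : X} (hx : x ∈ s) :
    ∃ Z : X → Fin n → E, IsLocalFrame Z Λ s x ∧ ContinuousWithinAt Z s x := by
  obtain ⟨m, Z, h1, h2⟩ := hΛ.1 x hx
  obtain ⟨h3, h4⟩ := h1.self_of_nhdsWithin hx
  have : m = n := by
    rw [← h.finrank_lagrangian (hΛ.2 x hx), ← h4, finrank_span_eq_card h3, Fintype.card_fin]
  subst this
  exact ⟨Z, h1, h2⟩

/-- A crossing form can be computed with a frame that has prescribed members at the crossing. -/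
lemma IsDarboux.exists_frame_of_isCrossingForm (h : IsDarboux ω c Q P) {Λ : ℝ → Submodule ℝ E}
    {V : Submodule ℝ E} {a b t : ℝ} {q : QuadraticForm ℝ ↥(Λ t ⊓ V)}
    (hL : IsLagrangian ω (Λ t)) (ht : t ∈ Icc a b) (hq : IsCrossingForm ω Λ V a b t q)
    {w : Fin n → E} (hw : LinearIndependent ℝ w) (hm : ∀ i, w i ∈ Λ t) :
    ∃ (Z : ℝ → Fin n → E) (Z' : Fin n → E), Z t = w ∧ IsLocalFrame Z Λ (Icc a b) t ∧
      HasDerivWithinAt Z Z' (Icc a b) t ∧ ∀ (v : ↥(Λ t ⊓ V)) (u : Fin n → ℝ),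
        (v : E) = ∑ i, u i • w i → q v = ω v (∑ i, u i • Z' i) := by
  obtain ⟨m, Z, Z', h1, h2, h3⟩ := hq
  obtain ⟨h4, h5⟩ := h1.self_of_nhdsWithin ht
  have : m = n := by
    rw [← h.finrank_lagrangian hL, ← h5, finrank_span_eq_card h4, Fintype.card_fin]
  subst this
  obtain ⟨A, hA, rfl⟩ := exists_eq_mulFrame hw ((h.span_eq hL hw hm).trans h5.symm)
  refine ⟨fun y => mulFrame A (Z y), mulFrame A Z', rfl, ?_, ?_, ?_⟩
  · filter_upwards [h1] with y hy
    exact ⟨linearIndependent_mulFrame hA hy.1, (span_mulFrame hA _).trans hy.2⟩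
  · rw [hasDerivWithinAt_pi] at h2 ⊢
    intro i
    exact HasDerivWithinAt.fun_sum fun j _ => (h2 j).const_smul (A i j)
  · intro v u hv
    have e : ∀ Y : Fin m → E, ∑ i, u i • mulFrame A Y i = ∑ j, (Matrix.vecMul u A) j • Y j := by
      intro Y
      simp only [mulFrame, Finset.smul_sum, smul_smul, Matrix.vecMul, dotProduct, Finset.sum_smul]
      exact Finset.sum_comm
    rw [e] at hv ⊢
    exact h3 v _ hv

/-! ### Functions of the determinants as functions of the subspace -/

variable (Q P) in
open scoped Classical in
/-- The normalized square of the complex determinant of a frame of `L`. -/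
def maslovSq (L : Submodule ℝ E) : ℂ :=
  if h : ∃ Z : Fin n → E, LinearIndependent ℝ Z ∧ Submodule.span ℝ (range Z) = L then
    frameDet Q P h.choose ^ 2 / (‖frameDet Q P h.choose‖ : ℂ) ^ 2 else 1

/-- Another frame changes the determinant by a nonzero real factor r, and r² = |r|² cancels. -/
lemma maslovSq_eq {L : Submodule ℝ E} {Z : Fin n → E} (hZ : LinearIndependent ℝ Z)
    (hs : Submodule.span ℝ (range Z) = L) :
    maslovSq Q P L = frameDet Q P Z ^ 2 / (‖frameDet Q P Z‖ : ℂ) ^ 2 := by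
  have h : ∃ Z : Fin n → E, LinearIndependent ℝ Z ∧ Submodule.span ℝ (range Z) = L := ⟨Z, hZ, hs⟩
  rw [maslovSq, dif_pos h]
  obtain ⟨A, hA, e⟩ := exists_eq_mulFrame h.choose_spec.1 (h.choose_spec.2.trans hs.symm)
  rw [e, frameDet_mulFrame]
  have hA' : (A.det : ℂ) ≠ 0 := by exact_mod_cast hA
  have habs : ((|A.det| : ℝ) : ℂ) ^ 2 = (A.det : ℂ) ^ 2 := by
    rw [← Complex.ofReal_pow, sq_abs, Complex.ofReal_pow]
  rw [norm_mul, Complex.norm_real, Real.norm_eq_abs, Complex.ofReal_mul, mul_pow, mul_pow, habs]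
  exact mul_div_mul_left _ _ (pow_ne_zero _ hA')

variable (Q P) in
open scoped Classical in
/-- The value on the frames of `L` of a function of the two determinants of frames. -/
def frameValue (G : ℂ → ℝ → ℝ) (L : Submodule ℝ E) : ℝ :=
  if h : ∃ Z : Fin n → E, LinearIndependent ℝ Z ∧ Submodule.span ℝ (range Z) = L then
    G (frameDet Q P h.choose) (momentumDet P h.choose) else 0

lemma frameValue_eq {G : ℂ → ℝ → ℝ} (hG : ∀ (r : ℝ) D d, r ≠ 0 → G (r * D) (r * d) = G D d)
    {L : Submodule ℝ E} {Z : Fin n → E} (hZ : LinearIndependent ℝ Z)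
    (hs : Submodule.span ℝ (range Z) = L) :
    frameValue Q P G L = G (frameDet Q P Z) (momentumDet P Z) := by
  have h : ∃ Z : Fin n → E, LinearIndependent ℝ Z ∧ Submodule.span ℝ (range Z) = L := ⟨Z, hZ, hs⟩
  rw [frameValue, dif_pos h]
  obtain ⟨A, hA, e⟩ := exists_eq_mulFrame h.choose_spec.1 (h.choose_spec.2.trans hs.symm)
  rw [e, frameDet_mulFrame, momentumDet_mulFrame, hG _ _ _ hA]

lemma IsDarboux.maslovSq_ne_zero (h : IsDarboux ω c Q P) {L : Submodule ℝ E}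
    (hL : IsLagrangian ω L) : maslovSq Q P L ≠ 0 := by
  obtain ⟨Z, hZ, rfl⟩ := h.exists_frame hL
  have := h.frameDet_ne_zero hZ hL
  rw [maslovSq_eq hZ rfl]
  exact div_ne_zero (pow_ne_zero _ this) (pow_ne_zero _ (by simpa using this))

lemma IsDarboux.continuousOn_maslovSq (h : IsDarboux ω c Q P) {X : Type*} [TopologicalSpace X]
    {Λ : X → Submodule ℝ E} {s : Set X} (hΛ : IsLagrangianFamilyOn ω Λ s) :
    ContinuousOn (fun x => maslovSq Q P (Λ x)) s := by
  intro x hx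
  obtain ⟨Z, h1, h2⟩ := h.exists_localFrame hΛ hx
  have hd := (h.continuous_frameDet.continuousAt (x := Z x)).comp_continuousWithinAt h2
  obtain ⟨h3, h4⟩ := h1.self_of_nhdsWithin hx
  have hne := h.frameDet_ne_zero h3 (h4.symm ▸ hΛ.2 x hx)
  have hc : ContinuousWithinAt
      (fun y => frameDet Q P (Z y) ^ 2 / (‖frameDet Q P (Z y)‖ : ℂ) ^ 2) s x := by
    refine (hd.pow 2).div ((Complex.continuous_ofReal.continuousAt.comp_continuousWithinAt
      hd.norm).pow 2) (pow_ne_zero _ ?_)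
    simpa using hne
  refine hc.congr_of_eventuallyEq ?_ (maslovSq_eq h3 h4)
  filter_upwards [h1] with y hy
  exact maslovSq_eq hy.1 hy.2

lemma IsDarboux.eventually_transverse (h : IsDarboux ω c Q P) {X : Type*} [TopologicalSpace X]
    {Λ : X → Submodule ℝ E} {s : Set X} (hΛ : IsLagrangianFamilyOn ω Λ s) {x : X} (hx : x ∈ s)
    (h0 : Λ x ⊓ LinearMap.ker P = ⊥) : ∀ᶠ y in 𝓝[s] x, Λ y ⊓ LinearMap.ker P = ⊥ := by
  obtain ⟨Z, h1, h2⟩ := h.exists_localFrame hΛ hx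
  have hd := (h.continuous_momentumDet.continuousAt (x := Z x)).comp_continuousWithinAt h2
  obtain ⟨h3, h4⟩ := h1.self_of_nhdsWithin hx
  rw [← h4, inf_ker_eq_bot_iff h3] at h0
  filter_upwards [h1, hd.eventually_ne h0] with y hy1 hy2
  rw [← hy1.2, inf_ker_eq_bot_iff hy1.1]
  exact hy2

end Frames

/-! ## Arguments and arctangents -/

lemma exp_arctan_mul_I (x : ℝ) :
    (√(1 + x ^ 2) : ℂ) * Complex.exp (Real.arctan x * Complex.I) = 1 + x * Complex.I := by
  have h : (√(1 + x ^ 2) : ℂ) ≠ 0 := by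
    rw [Complex.ofReal_ne_zero]
    positivity
  rw [Complex.exp_mul_I, ← Complex.ofReal_cos, ← Complex.ofReal_sin, Real.cos_arctan,
    Real.sin_arctan]
  push_cast
  field_simp

lemma arg_eq_of_eq_mul_exp {z : ℂ} {r θ : ℝ} (hr : 0 < r) (h1 : -Real.pi < θ) (h2 : θ ≤ Real.pi)
    (h : z = r * Complex.exp (θ * Complex.I)) : z.arg = θ := by
  rw [h, Complex.exp_mul_I]
  exact Complex.arg_mul_cos_add_sin_mul_I hr ⟨h1, h2⟩

lemma arg_one_add_mul_I (x : ℝ) : Complex.arg (1 + x * Complex.I) = Real.arctan x := by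
  have h1 := Real.neg_pi_div_two_lt_arctan x
  have h2 := Real.arctan_lt_pi_div_two x
  have := Real.pi_pos
  exact arg_eq_of_eq_mul_exp (r := √(1 + x ^ 2)) (by positivity) (by linarith) (by linarith)
    (exp_arctan_mul_I x).symm

lemma arg_eq_of_im_pos {z : ℂ} (h : 0 < z.im) :
    z.arg = Real.pi / 2 - Real.arctan (z.re / z.im) := by
  have h1 := Real.neg_pi_div_two_lt_arctan (z.re / z.im)
  have h2 := Real.arctan_lt_pi_div_two (z.re / z.im)
  have hpi := Real.pi_pos
  refine arg_eq_of_eq_mul_exp (r := z.im * √(1 + (-(z.re / z.im)) ^ 2)) (by positivity)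
    (by linarith) (by linarith) ?_
  have e := exp_arctan_mul_I (-(z.re / z.im))
  rw [Complex.ofReal_sub, sub_mul, sub_eq_add_neg, Complex.exp_add, Complex.ofReal_div,
    Complex.ofReal_ofNat, Complex.exp_pi_div_two_mul_I, ← neg_mul, ← Complex.ofReal_neg,
    ← Real.arctan_neg, Complex.ofReal_mul,
    show (z.im : ℂ) * (√(1 + (-(z.re / z.im)) ^ 2) : ℂ) * (Complex.I *
      Complex.exp (Real.arctan (-(z.re / z.im)) * Complex.I)) = z.im * Complex.I *
      ((√(1 + (-(z.re / z.im)) ^ 2) : ℂ) *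
        Complex.exp (Real.arctan (-(z.re / z.im)) * Complex.I)) by ring, e]
  have hz : (z.im : ℂ) ≠ 0 := by exact_mod_cast h.ne'
  conv_lhs => rw [← Complex.re_add_im z]
  push_cast
  field_simp
  linear_combination (z.re : ℂ) * Complex.I_sq

lemma arg_eq_of_im_neg {z : ℂ} (h : z.im < 0) :
    z.arg = -(Real.pi / 2) - Real.arctan (z.re / z.im) := by
  have h1 := Real.neg_pi_div_two_lt_arctan (z.re / z.im)
  have h2 := Real.arctan_lt_pi_div_two (z.re / z.im)
  have hpi := Real.pi_pos
  have hc : 0 < ((starRingEnd ℂ) z).im := by simpa using h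
  have := arg_eq_of_im_pos hc
  rw [Complex.arg_conj, if_neg] at this
  · simp only [Complex.conj_re, Complex.conj_im, div_neg, Real.arctan_neg] at this
    linarith
  · rw [Complex.arg_eq_pi_iff]
    rintro ⟨-, h0⟩
    exact h.ne h0

/-- Off the real axis D = i Im D (1 - i Re D / Im D), and the fourth power removes both i and the
sign of Im D. For real D the conventions x / 0 = 0 and arctan 0 = 0 give the argument 0 of D⁴ ≥ 0.
-/
lemma pow_four_eq_arctan {D : ℂ} :
    D ^ 4 = (‖D‖ : ℂ) ^ 4 * Complex.exp ((4 * -Real.arctan (D.re / D.im) : ℝ) * Complex.I) := by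
  have hn : (‖D‖ : ℂ) ^ 4 = ((D.re ^ 2 + D.im ^ 2 : ℝ) : ℂ) ^ 2 := by
    rw [← Complex.sq_norm_sub_sq_re D]
    push_cast; ring
  by_cases him : D.im = 0
  · have e : D = (D.re : ℂ) := Complex.ext rfl (by simpa using him)
    rw [hn, him]
    simp only [div_zero, Real.arctan_zero, neg_zero, mul_zero, Complex.ofReal_zero, zero_mul,
      Complex.exp_zero, mul_one]
    conv_lhs => rw [e]
    push_cast; ring
  · have e := exp_arctan_mul_I (-(D.re / D.im))
    have him' : (D.im : ℂ) ≠ 0 := by exact_mod_cast him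
    have h4 : Complex.exp ((4 * -Real.arctan (D.re / D.im) : ℝ) * Complex.I) =
        Complex.exp (Real.arctan (-(D.re / D.im)) * Complex.I) ^ 4 := by
      rw [← Complex.exp_nat_mul, Real.arctan_neg]
      congr 1
      push_cast; ring
    have hs : (√(1 + (-(D.re / D.im)) ^ 2) : ℂ) ^ 4 = ((1 + (D.re / D.im) ^ 2 : ℝ) : ℂ) ^ 2 := by
      have : √(1 + (-(D.re / D.im)) ^ 2) ^ 2 = 1 + (D.re / D.im) ^ 2 := by
        rw [Real.sq_sqrt (by positivity), neg_sq]
      rw [← this]; push_cast; ring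
    have hD : D = D.im * Complex.I * (1 + ((-(D.re / D.im) : ℝ) : ℂ) * Complex.I) := by
      conv_lhs => rw [← Complex.re_add_im D]
      push_cast
      field_simp
      linear_combination (D.re : ℂ) * Complex.I_sq
    conv_lhs => rw [hD]
    rw [h4, ← e, hn, mul_pow, mul_pow, mul_pow, hs, Complex.I_pow_four]
    push_cast
    field_simp
    ring

lemma pow_four_eq_arg {D : ℂ} {d : ℝ} (hd : d ≠ 0) :
    D ^ 4 = (‖D‖ : ℂ) ^ 4 * Complex.exp ((4 * (-D / d).arg : ℝ) * Complex.I) := by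
  have h := Complex.norm_mul_exp_arg_mul_I (-D / d)
  have hd' : (d : ℂ) ≠ 0 := by exact_mod_cast hd
  have habs : ((|d| : ℝ) : ℂ) ^ 4 = (d : ℂ) ^ 4 := by
    rw [← Complex.ofReal_pow, ← Complex.ofReal_pow, Even.pow_abs (by decide)]
  have h4 : Complex.exp ((4 * (-D / d).arg : ℝ) * Complex.I) =
      Complex.exp ((-D / d).arg * Complex.I) ^ 4 := by
    rw [← Complex.exp_nat_mul]
    congr 1
    push_cast; ring
  have h5 := congrArg (· ^ 4) h
  simp only [mul_pow, norm_div, norm_neg, Complex.norm_real, Real.norm_eq_abs, Complex.ofReal_div,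
    div_pow, habs] at h5
  rw [h4]
  generalize Complex.exp ((-D / d).arg * Complex.I) = e at h5 ⊢
  have h6 : (-D) ^ 4 = D ^ 4 := by ring
  rw [h6] at h5
  field_simp at h5
  exact h5.symm

/-! ## Signs near a zero with nonzero derivative -/

lemma eventually_pos_right {p : ℝ → ℝ} {p' t : ℝ} {s : Set ℝ} (h : HasDerivWithinAt p p' s t)
    (h0 : p t = 0) (hp : 0 < p') : ∀ᶠ y in 𝓝[s ∩ Ioi t] t, 0 < p y := by
  have h1 := (hasDerivWithinAt_iff_tendsto_slope.1 h).eventually_const_lt hp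
  have h2 : 𝓝[s ∩ Ioi t] t ≤ 𝓝[s \ {t}] t :=
    nhdsWithin_mono _ fun y hy => ⟨hy.1, (mem_Ioi.1 hy.2).ne'⟩
  filter_upwards [h2 h1, self_mem_nhdsWithin] with y hy hy'
  rw [slope_def_field, h0, sub_zero] at hy
  exact (div_pos_iff_of_pos_right (sub_pos.2 hy'.2)).1 hy

lemma eventually_neg_left {p : ℝ → ℝ} {p' t : ℝ} {s : Set ℝ} (h : HasDerivWithinAt p p' s t)
    (h0 : p t = 0) (hp : 0 < p') : ∀ᶠ y in 𝓝[s ∩ Iio t] t, p y < 0 := by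
  have h1 := (hasDerivWithinAt_iff_tendsto_slope.1 h).eventually_const_lt hp
  have h2 : 𝓝[s ∩ Iio t] t ≤ 𝓝[s \ {t}] t :=
    nhdsWithin_mono _ fun y hy => ⟨hy.1, (mem_Iio.1 hy.2).ne⟩
  filter_upwards [h2 h1, self_mem_nhdsWithin] with y hy hy'
  rw [slope_def_field, h0, sub_zero] at hy
  have hn : y - t < 0 := sub_neg.2 hy'.2
  by_contra hc
  exact absurd hy (not_lt.2 (div_nonpos_of_nonneg_of_nonpos (not_lt.1 hc) hn.le))

lemma eventually_neg_right {p : ℝ → ℝ} {p' t : ℝ} {s : Set ℝ} (h : HasDerivWithinAt p p' s t)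
    (h0 : p t = 0) (hp : p' < 0) : ∀ᶠ y in 𝓝[s ∩ Ioi t] t, p y < 0 :=
  (eventually_pos_right h.fun_neg (by simp [h0]) (neg_pos.2 hp)).mono fun _ hy => neg_pos.1 hy

lemma eventually_pos_left {p : ℝ → ℝ} {p' t : ℝ} {s : Set ℝ} (h : HasDerivWithinAt p p' s t)
    (h0 : p t = 0) (hp : p' < 0) : ∀ᶠ y in 𝓝[s ∩ Iio t] t, 0 < p y :=
  (eventually_neg_left h.fun_neg (by simp [h0]) (neg_pos.2 hp)).mono fun _ hy => neg_neg_iff_pos.1 hy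

/-! ## Signatures of quadratic forms of rank one and two -/

section Signature

variable {M : Type*} [AddCommGroup M] [Module ℝ M]

lemma sig_of_posDef [FiniteDimensional ℝ M] {q : QuadraticForm ℝ M} (h : q.PosDef) :
    sigPos q = Module.finrank ℝ M ∧ sigNeg q = 0 := by
  have h1 : Module.finrank ℝ (⊤ : Submodule ℝ M) ≤ sigPos q :=
    le_sigPos_of_posDef q (V := ⊤) fun x hx => h x (by simpa using hx)
  have h2 := QuadraticForm.sigPos_add_sigNeg_add_radical (Q := q)
  rw [finrank_top] at h1
  omega

lemma sig_of_negDef [FiniteDimensional ℝ M] {q : QuadraticForm ℝ M} (h : (-q).PosDef) :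
    sigPos q = 0 ∧ sigNeg q = Module.finrank ℝ M := by
  obtain ⟨h1, h2⟩ := sig_of_posDef h
  rw [sigPos_neg] at h1
  rw [sigNeg_neg] at h2
  exact ⟨h2, h1⟩

lemma sigPos_pos [FiniteDimensional ℝ M] {q : QuadraticForm ℝ M} {x : M} (h : 0 < q x) :
    0 < sigPos q := by
  have hx : x ≠ 0 := by rintro rfl; simp at h
  rw [← Nat.succ_le_iff, Nat.succ_eq_add_one, zero_add, ← finrank_span_singleton (K := ℝ) hx]
  refine le_sigPos_of_posDef q fun ⟨y, hy⟩ hy0 => ?_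
  obtain ⟨r, rfl⟩ := Submodule.mem_span_singleton.1 hy
  have hr : r ≠ 0 := by rintro rfl; simp at hy0
  rw [QuadraticMap.restrict_apply, QuadraticMap.map_smul]
  exact smul_pos (mul_self_pos.2 hr) h

lemma sigNeg_pos [FiniteDimensional ℝ M] {q : QuadraticForm ℝ M} {x : M} (h : q x < 0) :
    0 < sigNeg q := by
  rw [← sigPos_neg]
  exact sigPos_pos (x := x) (by simpa using h)

lemma nondegenerate_of_posDef {q : QuadraticForm ℝ M} (h : q.PosDef) : q.Nondegenerate := by
  have : Invertible (2 : ℝ) := invertibleOfNonzero two_ne_zero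
  rw [QuadraticMap.nondegenerate_iff_radical_eq_bot, Submodule.eq_bot_iff]
  intro x hx
  by_contra hne
  exact (h x hne).ne' hx.1

lemma nondegenerate_of_negDef {q : QuadraticForm ℝ M} (h : (-q).PosDef) : q.Nondegenerate := by
  have : Invertible (2 : ℝ) := invertibleOfNonzero two_ne_zero
  rw [QuadraticMap.nondegenerate_iff_radical_eq_bot, Submodule.eq_bot_iff]
  intro x hx
  by_contra hne
  have := h x hne
  rw [neg_apply, hx.1] at this
  simp at this

lemma eq_zero_of_polar_eq_zero {q : QuadraticForm ℝ M} (h : q.Nondegenerate) {x : M}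
    (h0 : q x = 0) (hp : ∀ y, q (x + y) = q x + q y) : x = 0 := by
  have : x ∈ q.radical := ⟨h0, by ext y; simp [QuadraticMap.polar, hp y]⟩
  rwa [h.radical_eq_bot, Submodule.mem_bot] at this

/-- Signature of a nondegenerate form on a line. -/
lemma sig_of_finrank_one (hM : Module.finrank ℝ M = 1) {q : QuadraticForm ℝ M}
    (hq : q.Nondegenerate) {w : M} (hw : w ≠ 0) :
    (0 < q w ∧ sigPos q = 1 ∧ sigNeg q = 0) ∨ (q w < 0 ∧ sigPos q = 0 ∧ sigNeg q = 1) := by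
  have : FiniteDimensional ℝ M := Module.finite_of_finrank_eq_succ hM
  have hall : ∀ y : M, ∃ r : ℝ, r • w = y := fun y =>
    exists_smul_eq_of_finrank_eq_one hM hw y
  have hne : ∀ r : ℝ, r • w ≠ 0 → 0 < r * r := fun r h =>
    mul_self_pos.2 (by rintro rfl; simp at h)
  rcases lt_trichotomy (q w) 0 with h | h | h
  · have hd : (-q).PosDef := by
      intro y hy
      obtain ⟨r, rfl⟩ := hall y
      rw [neg_apply, QuadraticMap.map_smul, smul_eq_mul]
      have := mul_pos (hne r hy) (neg_pos.2 h)
      linarith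
    obtain ⟨h1, h2⟩ := sig_of_negDef hd
    exact Or.inr ⟨h, h1, h2.trans hM⟩
  · have h0 : ∀ y, q y = 0 := fun y => by
      obtain ⟨r, rfl⟩ := hall y
      rw [QuadraticMap.map_smul, h, smul_zero]
    exact absurd (eq_zero_of_polar_eq_zero hq h fun y => by simp [h0]) hw
  · have hd : q.PosDef := by
      intro y hy
      obtain ⟨r, rfl⟩ := hall y
      rw [QuadraticMap.map_smul, smul_eq_mul]
      exact mul_pos (hne r hy) h
    obtain ⟨h1, h2⟩ := sig_of_posDef hd
    exact Or.inl ⟨h, h1.trans hM, h2⟩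

/-- Signature of a nondegenerate form on a plane. -/
lemma sig_of_finrank_two (hM : Module.finrank ℝ M = 2) {q : QuadraticForm ℝ M}
    (hq : q.Nondegenerate) {e₀ e₁ : M} (hind : ∀ x y : ℝ, x • e₀ + y • e₁ = 0 → x = 0 ∧ y = 0)
    (hspan : ∀ v : M, ∃ x y : ℝ, x • e₀ + y • e₁ = v) {A B C : ℝ}
    (hABC : ∀ x y : ℝ, q (x • e₀ + y • e₁) = A * x ^ 2 + 2 * B * x * y + C * y ^ 2) :
    (A * C - B ^ 2 < 0 ∧ sigPos q = 1 ∧ sigNeg q = 1) ∨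
    (0 < A * C - B ^ 2 ∧ 0 < A + C ∧ sigPos q = 2 ∧ sigNeg q = 0) ∨
    (0 < A * C - B ^ 2 ∧ A + C < 0 ∧ sigPos q = 0 ∧ sigNeg q = 2) := by
  have : FiniteDimensional ℝ M := Module.finite_of_finrank_eq_succ hM
  have hcase : ∀ x y : ℝ, x • e₀ + y • e₁ ≠ 0 → x ≠ 0 ∨ y ≠ 0 := by
    intro x y h
    by_contra! hc
    obtain ⟨rfl, rfl⟩ := hc
    simp at h
  rcases lt_trichotomy (A * C - B ^ 2) 0 with h | h | h
  · have hs := QuadraticForm.sigPos_add_sigNeg_add_radical (Q := q)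
    have hpos : ∃ v, 0 < q v := by
      by_contra! hc
      have key : ∀ x y : ℝ, A * x ^ 2 + 2 * B * x * y + C * y ^ 2 ≤ 0 := fun x y =>
        hABC x y ▸ hc _
      have k1 := key 1 0
      have k2 := key 0 1
      -- At (B, -A) the form is A(AC - B²), and at (C, -B) it is C(AC - B²): with AC - B² < 0 these
      -- have the sign opposite to A and C. The vectors (1, ±1) settle the case A = C = 0.
      have k3 := key B (-A)
      have k4 := key C (-B)
      have k5 := key 1 1
      have k6 := key 1 (-1)
      by_cases hA : A = 0
      · by_cases hC : C = 0
        · subst hA hC; nlinarith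
        · have : C < 0 := lt_of_le_of_ne (by linarith) hC
          nlinarith
      · have : A < 0 := lt_of_le_of_ne (by linarith) hA
        nlinarith
    have hneg : ∃ v, q v < 0 := by
      by_contra! hc
      have key : ∀ x y : ℝ, 0 ≤ A * x ^ 2 + 2 * B * x * y + C * y ^ 2 := fun x y =>
        hABC x y ▸ hc _
      have k1 := key 1 0
      have k2 := key 0 1
      have k3 := key B (-A)
      have k4 := key C (-B)
      have k5 := key 1 1
      have k6 := key 1 (-1)
      by_cases hA : A = 0
      · by_cases hC : C = 0
        · subst hA hC; nlinarith
        · have : 0 < C := lt_of_le_of_ne (by linarith) (Ne.symm hC)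
          nlinarith
      · have : 0 < A := lt_of_le_of_ne (by linarith) (Ne.symm hA)
        nlinarith
    obtain ⟨v, hv⟩ := hpos
    obtain ⟨u, hu⟩ := hneg
    have h1 := sigPos_pos hv
    have h2 := sigNeg_pos hu
    left
    refine ⟨h, ?_, ?_⟩ <;> omega
  · exfalso
    have kill : ∀ x y : ℝ, A * x + B * y = 0 → B * x + C * y = 0 → x = 0 ∧ y = 0 := by
      intro x y h1 h2
      refine hind x y (eq_zero_of_polar_eq_zero hq ?_ fun v => ?_)
      · rw [hABC]; linear_combination x * h1 + y * h2
      · obtain ⟨x', y', rfl⟩ := hspan v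
        rw [show x • e₀ + y • e₁ + (x' • e₀ + y' • e₁) = (x + x') • e₀ + (y + y') • e₁ by module,
          hABC, hABC, hABC]
        linear_combination 2 * x' * h1 + 2 * y' * h2
    -- With vanishing discriminant (B, -A) lies in the radical, so A = B = 0; then (1, 0) does too.
    obtain ⟨h1, h2⟩ := kill B (-A) (by ring) (by linarith)
    have hA : A = 0 := by linarith
    exact one_ne_zero (kill 1 0 (by simp [hA]) (by simp [h1])).1
  · have hAC : 0 < A * C := by nlinarith [sq_nonneg B]
    have hsq : ∀ x y : ℝ, A * (A * x ^ 2 + 2 * B * x * y + C * y ^ 2) =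
        (A * x + B * y) ^ 2 + (A * C - B ^ 2) * y ^ 2 := fun x y => by ring
    have hp : ∀ x y : ℝ, (x ≠ 0 ∨ y ≠ 0) → A ≠ 0 →
        0 < (A * x + B * y) ^ 2 + (A * C - B ^ 2) * y ^ 2 := by
      intro x y hxy hA
      by_cases hy : y = 0
      · subst hy
        have : x ≠ 0 := hxy.resolve_right (by simp)
        simp only [mul_zero, add_zero, ne_eq, OfNat.ofNat_ne_zero, not_false_eq_true, zero_pow]
        positivity
      · have := mul_pos h (pow_pos (abs_pos.2 hy) 2)
        rw [sq_abs] at this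
        nlinarith [sq_nonneg (A * x + B * y)]
    rcases lt_trichotomy A 0 with hA | hA | hA
    · have hC : C < 0 := by nlinarith
      have hd : (-q).PosDef := by
        intro v hv
        obtain ⟨x, y, rfl⟩ := hspan v
        have := hp x y (hcase x y hv) hA.ne
        rw [← hsq] at this
        rw [neg_apply, hABC]
        nlinarith
      obtain ⟨h1, h2⟩ := sig_of_negDef hd
      exact Or.inr (Or.inr ⟨h, by linarith, h1, h2.trans hM⟩)
    · simp [hA] at hAC
    · have hC : 0 < C := by nlinarith
      have hd : q.PosDef := by
        intro v hv
        obtain ⟨x, y, rfl⟩ := hspan v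
        have := hp x y (hcase x y hv) hA.ne'
        rw [← hsq] at this
        rw [hABC]
        nlinarith
      obtain ⟨h1, h2⟩ := sig_of_posDef hd
      exact Or.inr (Or.inl ⟨h, by linarith, h1.trans hM, h2⟩)

end Signature

/-! ### Properties shared by the two Maslov pairs -/

section Pairs

variable {E : Type*} [NormedAddCommGroup E] [NormedSpace ℝ E] {n : ℕ}
  {ω : LinearMap.BilinForm ℝ E} {c : ℝ} {Q P : E →ₗ[ℝ] (Fin n → ℝ)}

lemma IsDarboux.maslovSq_sq_eq (h : IsDarboux ω c Q P) {G : ℂ → ℝ → ℝ}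
    (hG : ∀ (r : ℝ) D d, r ≠ 0 → G (r * D) (r * d) = G D d)
    (hG4 : ∀ D d, D ^ 4 = (‖D‖ : ℂ) ^ 4 * Complex.exp ((4 * G D d : ℝ) * Complex.I))
    {L : Submodule ℝ E} (hL : IsLagrangian ω L) :
    maslovSq Q P L ^ 2 = (‖maslovSq Q P L‖ : ℂ) ^ 2 *
      Complex.exp ((4 * frameValue Q P G L : ℝ) * Complex.I) := by
  obtain ⟨Z, hZ, rfl⟩ := h.exists_frame hL
  have hn : (‖frameDet Q P Z‖ : ℂ) ≠ 0 := by simpa using h.frameDet_ne_zero hZ hL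
  rw [frameValue_eq hG hZ rfl, maslovSq_eq hZ rfl]
  have h1 : ‖frameDet Q P Z ^ 2 / (‖frameDet Q P Z‖ : ℂ) ^ 2‖ = 1 := by
    rw [norm_div, norm_pow, norm_pow, Complex.norm_real, norm_norm]
    exact div_self (pow_ne_zero _ (by simpa using hn))
  rw [h1, div_pow, ← pow_mul, ← pow_mul, Complex.ofReal_one, one_pow, one_mul,
    div_eq_iff (pow_ne_zero _ hn)]
  conv_lhs => rw [hG4 _ (momentumDet P Z)]
  rw [mul_comm]

lemma IsDarboux.frameValue_eventuallyEq {G : ℂ → ℝ → ℝ}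
    (hG : ∀ (r : ℝ) D d, r ≠ 0 → G (r * D) (r * d) = G D d) {X : Type*} [TopologicalSpace X]
    {Λ : X → Submodule ℝ E} {s : Set X} {x : X} {Z : X → Fin n → E} (hZ : IsLocalFrame Z Λ s x) :
    (fun y => frameValue Q P G (Λ y)) =ᶠ[𝓝[s] x]
      fun y => G (frameDet Q P (Z y)) (momentumDet P (Z y)) := by
  filter_upwards [hZ] with y hy
  exact frameValue_eq hG hy.1 hy.2

lemma hasDerivWithinAt_coord (h : IsDarboux ω c Q P) {Z : ℝ → Fin n → E} {Z' : Fin n → E}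
    {s : Set ℝ} {t : ℝ} (hZ : HasDerivWithinAt Z Z' s t) (i j : Fin n) :
    HasDerivWithinAt (fun y => Q (Z y i) j) (Q (Z' i) j) s t ∧
      HasDerivWithinAt (fun y => P (Z y i) j) (P (Z' i) j) s t := by
  have hi := hasDerivWithinAt_pi.1 hZ i
  have key : ∀ R : E →ₗ[ℝ] (Fin n → ℝ), Continuous R →
      HasDerivWithinAt (fun y => R (Z y i) j) (R (Z' i) j) s t := by
    intro R hR
    let R' : E →L[ℝ] (Fin n → ℝ) := ⟨R, hR⟩
    have := R'.hasFDerivAt.comp_hasDerivWithinAt t hi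
    exact hasDerivWithinAt_pi.1 this j
  exact ⟨key Q h.continuous_left, key P h.continuous_right⟩

lemma hasDerivWithinAt_subset_filters {s : Set ℝ} {t : ℝ} :
    𝓝[s ∩ Ioi t] t ≤ 𝓝[s] t ∧ 𝓝[s ∩ Iio t] t ≤ 𝓝[s] t :=
  ⟨nhdsWithin_mono _ inter_subset_left, nhdsWithin_mono _ inter_subset_left⟩

end Pairs

/-! ## The Maslov pair of a line in a symplectic plane -/

section Line

variable {E : Type*} [NormedAddCommGroup E] [NormedSpace ℝ E]
  {ω : LinearMap.BilinForm ℝ E} {c : ℝ} {Q P : E →ₗ[ℝ] (Fin 1 → ℝ)}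

/-- The correction term of lines, as a function of the determinants of a frame. -/
def lineDefect (D : ℂ) (_ : ℝ) : ℝ := -Real.arctan (D.re / D.im)

lemma lineDefect_smul (r : ℝ) (D : ℂ) (d : ℝ) (hr : r ≠ 0) :
    lineDefect (r * D) (r * d) = lineDefect D d := by
  simp [lineDefect, mul_div_mul_left _ _ hr]

lemma frameDet_one (Z : Fin 1 → E) :
    frameDet Q P Z = (Q (Z 0) 0 : ℂ) + P (Z 0) 0 * Complex.I := by
  simp [frameDet, frameMatrix]

lemma momentumDet_one (Z : Fin 1 → E) : momentumDet P Z = P (Z 0) 0 := by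
  simp [momentumDet, momentumMatrix]

/-- With the frame vector w normalized by Q w = 1, P w = 0, the crossing form at w is c p', so the
signature is the sign with which the momentum passes through zero. -/
lemma IsDarboux.exists_frame_line (h : IsDarboux ω c Q P) {Λ : ℝ → Submodule ℝ E} {a b t : ℝ}
    (hΛ : IsLagrangianFamilyOn ω Λ (Icc a b)) (ht : t ∈ Icc a b)
    (hV : Λ t ⊓ LinearMap.ker P ≠ ⊥) {q : QuadraticForm ℝ ↥(Λ t ⊓ LinearMap.ker P)}
    (hq : IsCrossingForm ω Λ (LinearMap.ker P) a b t q) (hnd : q.Nondegenerate) :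
    ∃ (Z : ℝ → Fin 1 → E) (p' : ℝ), Q (Z t 0) 0 = 1 ∧ P (Z t 0) 0 = 0 ∧
      IsLocalFrame Z Λ (Icc a b) t ∧ ContinuousWithinAt Z (Icc a b) t ∧
      HasDerivWithinAt (fun y => P (Z y 0) 0) p' (Icc a b) t ∧
      ((0 < p' ∧ sigPos q = 1 ∧ sigNeg q = 0) ∨ (p' < 0 ∧ sigPos q = 0 ∧ sigNeg q = 1)) := by
  have := h.finiteDimensional
  have hL := hΛ.2 t ht
  obtain ⟨w₀, hw₀, hne⟩ := Submodule.exists_mem_ne_zero_of_ne_bot hV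
  have hPw : P w₀ = 0 := hw₀.2
  have hQw : Q w₀ 0 ≠ 0 := fun h0 => hne (h.eq_zero (by ext i; fin_cases i; exact h0) hPw)
  set w : E := (Q w₀ 0)⁻¹ • w₀ with hw
  have hwmem : w ∈ Λ t ⊓ LinearMap.ker P := Submodule.smul_mem _ _ hw₀
  have hw1 : Q w 0 = 1 := by simp [hw, hQw]
  have hw2 : P w = 0 := hwmem.2
  have hwne : w ≠ 0 := by intro h0; simp [h0] at hw1
  obtain ⟨Z, Z', hZt, hZ, hZd, hform⟩ := h.exists_frame_of_isCrossingForm hL ht hq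
    (w := fun _ => w) (linearIndependent_unique_iff.2 hwne) (fun _ => hwmem.1)
  have hrank : Module.finrank ℝ ↥(Λ t ⊓ LinearMap.ker P) = 1 := by
    refine le_antisymm ?_ ?_
    · exact (Submodule.finrank_mono inf_le_left).trans_eq (h.finrank_lagrangian hL)
    · exact Submodule.one_le_finrank_iff.2 hV
  have hval : q ⟨w, hwmem⟩ = c * P (Z' 0) 0 := by
    rw [hform ⟨w, hwmem⟩ (fun _ => 1) (by simp), h.form]
    simp [hw2, hw1, dotProduct]
  refine ⟨Z, P (Z' 0) 0, by rw [hZt]; exact hw1, by rw [hZt, hw2]; rfl, hZ,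
    hZd.continuousWithinAt, (hasDerivWithinAt_coord h hZd 0 0).2, ?_⟩
  rcases sig_of_finrank_one hrank hnd (w := ⟨w, hwmem⟩) (by simpa using hwne) with ⟨h1, h2⟩ | ⟨h1, h2⟩
  · rw [hval] at h1
    exact Or.inl ⟨(pos_iff_pos_of_mul_pos h1).1 h.pos, h2⟩
  · rw [hval] at h1
    exact Or.inr ⟨by nlinarith [h.pos], h2⟩

/-- On each side of the real axis the defect is the principal argument shifted by ∓π/2, and that
argument tends to arg 1 = 0. -/
lemma tendsto_lineDefect {q p : ℝ → ℝ} {l : Filter ℝ} (hq : Tendsto q l (𝓝 1))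
    (hp : Tendsto p l (𝓝 0)) :
    ((∀ᶠ y in l, 0 < p y) →
      Tendsto (fun y => lineDefect (q y + p y * Complex.I) (p y)) l (𝓝 (-(Real.pi / 2)))) ∧
    ((∀ᶠ y in l, p y < 0) →
      Tendsto (fun y => lineDefect (q y + p y * Complex.I) (p y)) l (𝓝 (Real.pi / 2))) := by
  have hD : Tendsto (fun y => ((q y : ℂ) + p y * Complex.I)) l (𝓝 1) := by
    have := ((Complex.continuous_ofReal.tendsto 1).comp hq).add
      (((Complex.continuous_ofReal.tendsto 0).comp hp).mul_const Complex.I)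
    simpa using this
  have harg : Tendsto (fun y => Complex.arg ((q y : ℂ) + p y * Complex.I)) l (𝓝 0) := by
    have := (Complex.continuousAt_arg (x := 1) (by simp)).tendsto.comp hD
    rwa [Complex.arg_one] at this
  constructor
  · intro hpos
    have h1 := harg.sub_const (Real.pi / 2)
    rw [zero_sub] at h1
    refine h1.congr' ?_
    filter_upwards [hpos] with y hy
    rw [arg_eq_of_im_pos (by simpa using hy), lineDefect]
    ring
  · intro hneg
    have h1 := harg.add_const (Real.pi / 2)
    rw [zero_add] at h1
    refine h1.congr' ?_
    filter_upwards [hneg] with y hy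
    rw [arg_eq_of_im_neg (by simpa using hy), lineDefect]
    ring

theorem IsDarboux.isMaslovPair_line (h : IsDarboux ω c Q P) :
    IsMaslovPair ω (LinearMap.ker P) (maslovSq Q P) (frameValue Q P lineDefect) where
  ne_zero _ hL := h.maslovSq_ne_zero hL
  continuousOn _ _ hΛ := h.continuousOn_maslovSq hΛ
  sq_eq _ hL := h.maslovSq_sq_eq lineDefect_smul (fun _ _ => pow_four_eq_arctan) hL
  eventually_transverse _ _ _ _ hΛ ht h0 := h.eventually_transverse hΛ ht h0
  continuousWithinAt Λ a b t hΛ ht h0 := by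
    obtain ⟨Z, hZ, hc⟩ := h.exists_localFrame hΛ ht
    have hself := hZ.self_of_nhdsWithin ht
    have hev := IsDarboux.frameValue_eventuallyEq (Q := Q) (P := P) lineDefect_smul hZ
    rw [← hself.2, inf_ker_eq_bot_iff hself.1, momentumDet_one] at h0
    refine ContinuousWithinAt.congr_of_eventuallyEq ?_ hev (hev.self_of_nhdsWithin ht)
    have hD := h.continuous_frameDet.continuousAt.comp_continuousWithinAt hc
    simp only [lineDefect]
    refine (Real.continuous_arctan.continuousAt.comp_continuousWithinAt
      (ContinuousWithinAt.div (Complex.continuous_re.continuousAt.comp_continuousWithinAt hD)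
      (Complex.continuous_im.continuousAt.comp_continuousWithinAt hD) ?_)).neg
    simpa [frameDet_one] using h0
  isolated Λ a b t q hΛ hab ht hV hq hnd := by
    obtain ⟨Z, p', h1, h2, hZ, hc, hd, hs⟩ := h.exists_frame_line hΛ ht hV hq hnd
    have hp' : p' ≠ 0 := by rcases hs with hs | hs; exacts [hs.1.ne', hs.1.ne]
    filter_upwards [hd.eventually_ne hp' (c := 0),
      nhdsWithin_mono t (sdiff_subset (t := {t})) hZ] with y hy hy'
    rw [← hy'.2, inf_ker_eq_bot_iff hy'.1, momentumDet_one]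
    exact hy
  tendsto_right Λ a b t q hΛ hab ht hV hq hnd := by
    obtain ⟨Z, p', h1, h2, hZ, hc, hd, hs⟩ := h.exists_frame_line hΛ ht hV hq hnd
    have hev := IsDarboux.frameValue_eventuallyEq (Q := Q) (P := P) lineDefect_smul hZ
    have hle := (hasDerivWithinAt_subset_filters (s := Icc a b) (t := t)).1
    have hcq : ContinuousWithinAt (fun y => Q (Z y 0) 0) (Icc a b) t := by
      have := h.continuous_left
      have h3 : Continuous fun W : Fin 1 → E => Q (W 0) 0 := by fun_prop
      exact h3.continuousAt.comp_continuousWithinAt hc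
    have key := tendsto_lineDefect (q := fun y => Q (Z y 0) 0) (p := fun y => P (Z y 0) 0)
      (l := 𝓝[Icc a b ∩ Ioi t] t) (by simpa [h1] using hcq.tendsto.mono_left hle)
      (by simpa [h2] using hd.continuousWithinAt.tendsto.mono_left hle)
    -- At the crossing Im D = 0, and the convention 1 / 0 = 0 supplies the midpoint of the one-sided
    -- limits ∓π/2.
    have hval : frameValue Q P lineDefect (Λ t) = 0 := by
      refine (hev.self_of_nhdsWithin ht).trans ?_
      simp [frameDet_one, h1, h2, lineDefect]
    rw [hval]
    refine Tendsto.congr' (EventuallyEq.symm (hle hev)) ?_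
    simp only [frameDet_one, momentumDet_one]
    rcases hs with ⟨hp, e1, e2⟩ | ⟨hp, e1, e2⟩
    · convert key.1 (eventually_pos_right hd h2 hp) using 2
      rw [e1, e2]; push_cast; ring
    · convert key.2 (eventually_neg_right hd h2 hp) using 2
      rw [e1, e2]; push_cast; ring
  tendsto_left Λ a b t q hΛ hab ht hV hq hnd := by
    obtain ⟨Z, p', h1, h2, hZ, hc, hd, hs⟩ := h.exists_frame_line hΛ ht hV hq hnd
    have hev := IsDarboux.frameValue_eventuallyEq (Q := Q) (P := P) lineDefect_smul hZ
    have hle := (hasDerivWithinAt_subset_filters (s := Icc a b) (t := t)).2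
    have hcq : ContinuousWithinAt (fun y => Q (Z y 0) 0) (Icc a b) t := by
      have := h.continuous_left
      have h3 : Continuous fun W : Fin 1 → E => Q (W 0) 0 := by fun_prop
      exact h3.continuousAt.comp_continuousWithinAt hc
    have key := tendsto_lineDefect (q := fun y => Q (Z y 0) 0) (p := fun y => P (Z y 0) 0)
      (l := 𝓝[Icc a b ∩ Iio t] t) (by simpa [h1] using hcq.tendsto.mono_left hle)
      (by simpa [h2] using hd.continuousWithinAt.tendsto.mono_left hle)
    have hval : frameValue Q P lineDefect (Λ t) = 0 := by
      refine (hev.self_of_nhdsWithin ht).trans ?_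
      simp [frameDet_one, h1, h2, lineDefect]
    rw [hval]
    refine Tendsto.congr' (EventuallyEq.symm (hle hev)) ?_
    simp only [frameDet_one, momentumDet_one]
    rcases hs with ⟨hp, e1, e2⟩ | ⟨hp, e1, e2⟩
    · convert key.2 (eventually_neg_left hd h2 hp) using 2
      rw [e1, e2]; push_cast; ring
    · convert key.1 (eventually_pos_left hd h2 hp) using 2
      rw [e1, e2]; push_cast; ring

end Line

/-! ## The Maslov pair of a Lagrangian plane in a four-dimensional symplectic space -/

section PlanePair

variable {E : Type*} [NormedAddCommGroup E] [NormedSpace ℝ E]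
  {ω : LinearMap.BilinForm ℝ E} {c : ℝ} {Q P : E →ₗ[ℝ] (Fin 2 → ℝ)}

open scoped Classical in
/-- The correction term of Lagrangian planes, as a function of the determinants of a frame. -/
def planeDefect (D : ℂ) (d : ℝ) : ℝ :=
  if d ≠ 0 then (-D / d).arg else -Real.arctan (D.re / D.im)

lemma planeDefect_smul (r : ℝ) (D : ℂ) (d : ℝ) (hr : r ≠ 0) :
    planeDefect (r * D) (r * d) = planeDefect D d := by
  have hr' : (r : ℂ) ≠ 0 := by exact_mod_cast hr
  simp only [planeDefect, ne_eq, mul_eq_zero, hr, false_or, Complex.ofReal_mul, Complex.re_ofReal_mul,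
    Complex.im_ofReal_mul, mul_div_mul_left _ _ hr]
  rw [← mul_neg, mul_div_mul_left _ _ hr']

lemma pow_four_eq_planeDefect (D : ℂ) (d : ℝ) :
    D ^ 4 = (‖D‖ : ℂ) ^ 4 * Complex.exp ((4 * planeDefect D d : ℝ) * Complex.I) := by
  by_cases hd : d = 0
  · rw [planeDefect, if_neg (not_not.2 hd)]
    exact pow_four_eq_arctan
  · rw [planeDefect, if_pos hd]
    exact pow_four_eq_arg hd

lemma planeDefect_of_pos (D : ℂ) {d : ℝ} (hd : 0 < d) : planeDefect D d = (-D).arg := by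
  rw [planeDefect, if_pos hd.ne', div_eq_inv_mul, ← Complex.ofReal_inv,
    Complex.arg_real_mul _ (inv_pos.2 hd)]

lemma planeDefect_of_neg (D : ℂ) {d : ℝ} (hd : d < 0) : planeDefect D d = D.arg := by
  rw [planeDefect, if_pos hd.ne, neg_div, ← div_neg, ← Complex.ofReal_neg, div_eq_inv_mul,
    ← Complex.ofReal_inv, Complex.arg_real_mul _ (inv_pos.2 (neg_pos.2 hd))]

lemma tendsto_planeDefect {X : Type*} {D : X → ℂ} {d : X → ℝ} {l : Filter X} {D₀ : ℂ}
    (hD : Tendsto D l (𝓝 D₀)) :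
    ((∀ᶠ y in l, 0 < d y) → -D₀ ∈ Complex.slitPlane →
      Tendsto (fun y => planeDefect (D y) (d y)) l (𝓝 (-D₀).arg)) ∧
    ((∀ᶠ y in l, d y < 0) → D₀ ∈ Complex.slitPlane →
      Tendsto (fun y => planeDefect (D y) (d y)) l (𝓝 D₀.arg)) := by
  constructor
  · intro hd hs
    refine ((Complex.continuousAt_arg hs).tendsto.comp hD.neg).congr' ?_
    filter_upwards [hd] with y hy
    exact (planeDefect_of_pos _ hy).symm
  · intro hd hs
    refine ((Complex.continuousAt_arg hs).tendsto.comp hD).congr' ?_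
    filter_upwards [hd] with y hy
    exact (planeDefect_of_neg _ hy).symm

lemma frameDet_two (Z : Fin 2 → E) :
    frameDet Q P Z = ((Q (Z 0) 0 : ℂ) + P (Z 0) 0 * Complex.I) *
      ((Q (Z 1) 1 : ℂ) + P (Z 1) 1 * Complex.I) -
      ((Q (Z 0) 1 : ℂ) + P (Z 0) 1 * Complex.I) *
      ((Q (Z 1) 0 : ℂ) + P (Z 1) 0 * Complex.I) := by
  simp [frameDet, frameMatrix, Matrix.det_fin_two]

lemma frameDet_two_re (Z : Fin 2 → E) :
    (frameDet Q P Z).re = Q (Z 0) 0 * Q (Z 1) 1 - P (Z 0) 0 * P (Z 1) 1 -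
      (Q (Z 0) 1 * Q (Z 1) 0 - P (Z 0) 1 * P (Z 1) 0) := by
  simp [frameDet_two]

lemma frameDet_two_im (Z : Fin 2 → E) :
    (frameDet Q P Z).im = Q (Z 0) 0 * P (Z 1) 1 + P (Z 0) 0 * Q (Z 1) 1 -
      (Q (Z 0) 1 * P (Z 1) 0 + P (Z 0) 1 * Q (Z 1) 0) := by
  simp [frameDet_two]

lemma momentumDet_two (Z : Fin 2 → E) :
    momentumDet P Z = P (Z 0) 0 * P (Z 1) 1 - P (Z 0) 1 * P (Z 1) 0 := by
  simp [momentumDet, momentumMatrix, Matrix.det_fin_two]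

lemma IsDarboux.form_two (h : IsDarboux ω c Q P) (x y : E) :
    ω x y = c * (Q x 0 * P y 0 + Q x 1 * P y 1 - (P x 0 * Q y 0 + P x 1 * Q y 1)) := by
  rw [h.form]
  simp [dotProduct, Fin.sum_univ_two]

/-- Transversality allows a frame with P = 1, for which Q is a symmetric matrix S. If s₁, s₂ are its
eigenvalues, then -det(S + i) = (1 - i s₁)(1 - i s₂), whose argument -arctan s₁ - arctan s₂ lies
strictly between -π and π. So the principal argument is continuous off the crossings. -/
lemma IsDarboux.neg_frameDet_div_mem_slitPlane (h : IsDarboux ω c Q P) {Z : Fin 2 → E}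
    (hL : IsLagrangian ω (Submodule.span ℝ (range Z))) (h0 : momentumDet P Z ≠ 0) :
    -frameDet Q P Z / momentumDet P Z ∈ Complex.slitPlane := by
  set A := (momentumMatrix P Z)⁻¹ with hA
  have hu : IsUnit (momentumMatrix P Z).det := isUnit_iff_ne_zero.2 h0
  have hAdet : A.det ≠ 0 := by
    exact left_ne_zero_of_mul_eq_one (Matrix.det_nonsing_inv_mul_det _ hu)
  set W := mulFrame A Z with hW
  have hP : ∀ i j, P (W i) j = (1 : Matrix (Fin 2) (Fin 2) ℝ) i j := by
    intro i j
    rw [← Matrix.nonsing_inv_mul _ hu, ← hA]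
    simp [hW, mulFrame, momentumMatrix, Matrix.mul_apply]
  have hmem : ∀ i, W i ∈ Submodule.span ℝ (range Z) := fun i =>
    span_mulFrame_le A Z (Submodule.subset_span ⟨i, rfl⟩)
  have hsym := hL.apply_eq_zero (hmem 0) (hmem 1)
  rw [h.form_two] at hsym
  have hsym' := (mul_eq_zero.1 hsym).resolve_left h.pos.ne'
  simp only [hP] at hsym'
  norm_num at hsym'
  have hq : -frameDet Q P Z / momentumDet P Z = -frameDet Q P W := by
    have e1 := frameDet_mulFrame (Q := Q) (P := P) A Z
    have e2 := momentumDet_mulFrame (P := P) A Z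
    have e3 : momentumDet P W = 1 := by
      rw [momentumDet_two]; simp [hP]
    rw [← hW] at e1 e2
    rw [e3] at e2
    have hd : (momentumDet P Z : ℂ) ≠ 0 := by exact_mod_cast h0
    have e2' : (A.det : ℂ) * momentumDet P Z = 1 := by exact_mod_cast e2.symm
    rw [e1, div_eq_iff hd]
    linear_combination -frameDet Q P Z * (-e2')
  rw [hq, Complex.mem_slitPlane_iff]
  by_cases him : (frameDet Q P W).im = 0
  · left
    rw [frameDet_two_im] at him
    simp only [hP] at him
    rw [Complex.neg_re, frameDet_two_re]
    simp only [hP]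
    norm_num at him ⊢
    rw [show Q (W 1) 1 = -Q (W 0) 0 by linarith, show Q (W 1) 0 = Q (W 0) 1 by linarith]
    nlinarith [sq_nonneg (Q (W 0) 0), sq_nonneg (Q (W 0) 1)]
  · right
    simpa using him

/-- Frames of a Lagrangian path close to a regular crossing with the plane `ker P`. -/
lemma IsDarboux.exists_frame_plane (h : IsDarboux ω c Q P) {Λ : ℝ → Submodule ℝ E} {a b t : ℝ}
    (hΛ : IsLagrangianFamilyOn ω Λ (Icc a b)) (hab : a < b) (ht : t ∈ Icc a b)
    (hV : Λ t ⊓ LinearMap.ker P ≠ ⊥) {q : QuadraticForm ℝ ↥(Λ t ⊓ LinearMap.ker P)}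
    (hq : IsCrossingForm ω Λ (LinearMap.ker P) a b t q) (hnd : q.Nondegenerate) :
    ∃ Z : ℝ → Fin 2 → E, IsLocalFrame Z Λ (Icc a b) t ∧ ContinuousWithinAt Z (Icc a b) t ∧
      momentumDet P (Z t) = 0 ∧
      ((0 < (frameDet Q P (Z t)).im ∧ ∃ d',
          HasDerivWithinAt (fun y => momentumDet P (Z y)) d' (Icc a b) t ∧
          ((0 < d' ∧ sigPos q = 1 ∧ sigNeg q = 0) ∨ (d' < 0 ∧ sigPos q = 0 ∧ sigNeg q = 1))) ∨
        (frameDet Q P (Z t) = 1 ∧ (∀ᶠ y in 𝓝[Icc a b \ {t}] t, momentumDet P (Z y) < 0) ∧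
          sigPos q = 1 ∧ sigNeg q = 1) ∨
        (frameDet Q P (Z t) = 1 ∧ (∀ᶠ y in 𝓝[Icc a b \ {t}] t, 0 < momentumDet P (Z y)) ∧
          ∃ d', HasDerivWithinAt (fun y => (frameDet Q P (Z y)).im) d' (Icc a b) t ∧
          ((0 < d' ∧ sigPos q = 2 ∧ sigNeg q = 0) ∨ (d' < 0 ∧ sigPos q = 0 ∧ sigNeg q = 2)))) := by
  have := h.finiteDimensional
  have hL := hΛ.2 t ht
  by_cases hle : Λ t ≤ LinearMap.ker P
  · -- the path meets `ker P` in a plane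
    have hb : ∀ i : Fin 2, ∃ x, Q x = Pi.single i 1 ∧ P x = 0 := fun i => by
      obtain ⟨x, hx⟩ := h.bij.2 (Pi.single i 1, 0)
      exact ⟨x, congrArg Prod.fst hx, congrArg Prod.snd hx⟩
    choose w hwQ hwP using hb
    have hmem : ∀ i, w i ∈ Λ t := fun i => by
      rw [← show ω.orthogonal (Λ t) = Λ t from hL, LinearMap.BilinForm.mem_orthogonal_iff]
      intro y hy
      rw [h.form, hwP, show P y = 0 from hle hy]
      simp
    have hcomb : ∀ (u : Fin 2 → ℝ) j, Q (∑ i, u i • w i) j = u j := by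
      intro u j
      simp [hwQ, Fin.sum_univ_two, Pi.single_apply]
      fin_cases j <;> simp
    have hli : LinearIndependent ℝ w := by
      rw [Fintype.linearIndependent_iff]
      intro u hu j
      rw [← hcomb u j, hu]; simp
    obtain ⟨Z, Z', hZt, hZ, hZd, hform⟩ := h.exists_frame_of_isCrossingForm hL ht hq hli hmem
    have hq00 : Q (Z t 0) 0 = 1 := by rw [hZt, hwQ]; simp
    have hq01 : Q (Z t 0) 1 = 0 := by rw [hZt, hwQ]; simp
    have hq10 : Q (Z t 1) 0 = 0 := by rw [hZt, hwQ]; simp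
    have hq11 : Q (Z t 1) 1 = 1 := by rw [hZt, hwQ]; simp
    have hp : ∀ i j, P (Z t i) j = 0 := fun i j => by rw [hZt, hwP]; rfl
    have dQ := fun i j => (hasDerivWithinAt_coord h hZd i j).1
    have dP := fun i j => (hasDerivWithinAt_coord h hZd i j).2
    -- Differentiating ω(Z₀, Z₁) = 0 at the crossing makes the matrix of momentum derivatives
    -- symmetric; up to the factor c it is the matrix of the crossing form.
    have hsym : P (Z' 0) 1 = P (Z' 1) 0 := by
      have d1 := ((((dQ 0 0).mul (dP 1 0)).add ((dQ 0 1).mul (dP 1 1))).sub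
        (((dP 0 0).mul (dQ 1 0)).add ((dP 0 1).mul (dQ 1 1))))
      have d2 := d1.congr_of_eventuallyEq (f₁ := fun _ => (0 : ℝ)) (by
        filter_upwards [hZ, self_mem_nhdsWithin] with y hy hy'
        have hm : ∀ i, Z y i ∈ Λ y := fun i => hy.2 ▸ Submodule.subset_span ⟨i, rfl⟩
        have e := (hΛ.2 y hy').apply_eq_zero (hm 0) (hm 1)
        rw [h.form_two] at e
        exact ((mul_eq_zero.1 e).resolve_left h.pos.ne').symm) (by
        simp [hp])
      have e := (uniqueDiffOn_Icc hab t ht).eq_deriv _ d2 (hasDerivWithinAt_const t _ 0)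
      simp only [hq00, hq01, hq10, hq11, hp, mul_zero, mul_one, one_mul, zero_mul, zero_add,
        add_zero] at e
      linarith
    have hfull : Λ t ⊓ LinearMap.ker P = Λ t := inf_eq_left.2 hle
    have hrank : Module.finrank ℝ ↥(Λ t ⊓ LinearMap.ker P) = 2 := by
      rw [hfull]; exact h.finrank_lagrangian hL
    have hmem' : ∀ i, w i ∈ Λ t ⊓ LinearMap.ker P := fun i => ⟨hmem i, hwP i⟩
    have hABC : ∀ x y : ℝ, q (x • ⟨w 0, hmem' 0⟩ + y • ⟨w 1, hmem' 1⟩) =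
        (c * P (Z' 0) 0) * x ^ 2 + 2 * (c * P (Z' 0) 1) * x * y + (c * P (Z' 1) 1) * y ^ 2 := by
      intro x y
      rw [hform _ ![x, y] (by simp [Fin.sum_univ_two]), h.form_two]
      simp [Fin.sum_univ_two, hwQ, hwP]
      rw [← hsym]; ring
    have hsig := sig_of_finrank_two hrank hnd (e₀ := ⟨w 0, hmem' 0⟩) (e₁ := ⟨w 1, hmem' 1⟩)
      (fun x y hxy => by
        have e : ∑ i, (![x, y] : Fin 2 → ℝ) i • w i = 0 := by
          have := congrArg Subtype.val hxy
          simpa [Fin.sum_univ_two] using this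
        have := Fintype.linearIndependent_iff.1 hli _ e
        exact ⟨this 0, this 1⟩)
      (fun v => by
        have hv : (v : E) ∈ Submodule.span ℝ (range w) := by
          rw [h.span_eq hL hli hmem]; exact v.2.1
        obtain ⟨u, hu⟩ := (Submodule.mem_span_range_iff_exists_fun ℝ).1 hv
        refine ⟨u 0, u 1, Subtype.ext ?_⟩
        simpa [Fin.sum_univ_two] using hu) hABC
    have hdet : frameDet Q P (Z t) = 1 := by
      rw [frameDet_two]
      simp [hq00, hq01, hq10, hq11, hp]
    -- All momenta vanish at t, so d vanishes to second order and has the same sign on both sides,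
    -- that of the determinant of the crossing form. In the definite case the sign of the form is
    -- read off from its trace, which is c times the derivative of Im D.
    have hslope : Tendsto (fun y => momentumDet P (Z y) / (y - t) ^ 2) (𝓝[Icc a b \ {t}] t)
        (𝓝 (P (Z' 0) 0 * P (Z' 1) 1 - P (Z' 0) 1 * P (Z' 1) 0)) := by
      have s := fun i j => hasDerivWithinAt_iff_tendsto_slope.1 (dP i j)
      refine (((s 0 0).mul (s 1 1)).sub ((s 0 1).mul (s 1 0))).congr' ?_
      filter_upwards [self_mem_nhdsWithin] with y hy
      have hyt : y - t ≠ 0 := sub_ne_zero.2 hy.2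
      simp only [slope_def_field, hp, sub_zero, momentumDet_two]
      field_simp
    have hsq : ∀ᶠ y in 𝓝[Icc a b \ {t}] t, 0 < (y - t) ^ 2 := by
      filter_upwards [self_mem_nhdsWithin] with y hy
      have hyt : y - t ≠ 0 := sub_ne_zero.2 hy.2
      positivity
    have hcc : c * P (Z' 0) 0 * (c * P (Z' 1) 1) - (c * P (Z' 0) 1) ^ 2 =
        c ^ 2 * (P (Z' 0) 0 * P (Z' 1) 1 - P (Z' 0) 1 * P (Z' 1) 0) := by
      rw [← hsym]; ring
    have hc2 : 0 < c ^ 2 := pow_pos h.pos 2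
    have htr : c * P (Z' 0) 0 + c * P (Z' 1) 1 = c * (P (Z' 0) 0 + P (Z' 1) 1) := by ring
    have hposev : 0 < c ^ 2 * (P (Z' 0) 0 * P (Z' 1) 1 - P (Z' 0) 1 * P (Z' 1) 0) →
        ∀ᶠ y in 𝓝[Icc a b \ {t}] t, 0 < momentumDet P (Z y) := by
      intro h1
      filter_upwards [hslope.eventually_const_lt ((pos_iff_pos_of_mul_pos h1).1 hc2), hsq]
        with y hy hy'
      exact (div_pos_iff_of_pos_right hy').1 hy
    have hdim : HasDerivWithinAt (fun y => (frameDet Q P (Z y)).im)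
        (P (Z' 0) 0 + P (Z' 1) 1) (Icc a b) t := by
      have d1 := ((((dQ 0 0).mul (dP 1 1)).add ((dP 0 0).mul (dQ 1 1))).sub
        (((dQ 0 1).mul (dP 1 0)).add ((dP 0 1).mul (dQ 1 0))))
      simp only [frameDet_two_im]
      refine HasDerivWithinAt.congr_deriv d1 ?_
      simp only [hq00, hq01, hq10, hq11, hp]
      ring
    refine ⟨Z, hZ, hZd.continuousWithinAt, by rw [momentumDet_two]; simp [hp], ?_⟩
    rw [hcc, htr] at hsig
    rcases hsig with ⟨h1, h2⟩ | ⟨h1, h3, h2⟩ | ⟨h1, h3, h2⟩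
    · refine Or.inr (Or.inl ⟨hdet, ?_, h2⟩)
      have hneg : P (Z' 0) 0 * P (Z' 1) 1 - P (Z' 0) 1 * P (Z' 1) 0 < 0 := by
        by_contra hc
        exact absurd h1 (not_lt.2 (mul_nonneg hc2.le (not_lt.1 hc)))
      filter_upwards [hslope.eventually_lt_const hneg, hsq] with y hy hy'
      by_contra hc
      exact absurd hy (not_lt.2 (div_nonneg (not_lt.1 hc) hy'.le))
    · exact Or.inr (Or.inr ⟨hdet, hposev h1, _, hdim,
        Or.inl ⟨(pos_iff_pos_of_mul_pos h3).1 h.pos, h2⟩⟩)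
    · refine Or.inr (Or.inr ⟨hdet, hposev h1, _, hdim, Or.inr ⟨?_, h2⟩⟩)
      by_contra hc
      exact absurd h3 (not_lt.2 (mul_nonneg h.pos.le (not_lt.1 hc)))
  · -- the path meets `ker P` in a line
    obtain ⟨w₀, hw₀, hne⟩ := Submodule.exists_mem_ne_zero_of_ne_bot hV
    obtain ⟨x₁, hx₁, hx₁'⟩ := SetLike.not_le_iff_exists.1 hle
    have hPw : ∀ j, P w₀ j = 0 := fun j => congrFun (show P w₀ = 0 from hw₀.2) j
    have hqpos : 0 < Q w₀ 0 ^ 2 + Q w₀ 1 ^ 2 := by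
      rcases (add_nonneg (sq_nonneg (Q w₀ 0)) (sq_nonneg (Q w₀ 1))).lt_or_eq with hlt | heq
      · exact hlt
      · exfalso
        refine hne (h.eq_zero ?_ hw₀.2)
        funext j
        have e0 : Q w₀ 0 = 0 := by nlinarith [sq_nonneg (Q w₀ 0), sq_nonneg (Q w₀ 1)]
        have e1 : Q w₀ 1 = 0 := by nlinarith [sq_nonneg (Q w₀ 0), sq_nonneg (Q w₀ 1)]
        fin_cases j
        exacts [e0, e1]
    have horth : ∀ x ∈ Λ t, Q w₀ 0 * P x 0 + Q w₀ 1 * P x 1 = 0 := by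
      intro x hx
      have e := hL.apply_eq_zero hw₀.1 hx
      rw [h.form_two] at e
      have := (mul_eq_zero.1 e).resolve_left h.pos.ne'
      simpa [hPw] using this
    -- By isotropy every momentum of Λ t is orthogonal to Q w₀. If P x₁ were also parallel to Q w₀,
    -- it would vanish.
    have hκ : Q w₀ 0 * P x₁ 1 - Q w₀ 1 * P x₁ 0 ≠ 0 := by
      intro h0
      have e := horth x₁ hx₁
      have z1 : (Q w₀ 0 ^ 2 + Q w₀ 1 ^ 2) * P x₁ 0 = 0 := by
        linear_combination Q w₀ 0 * e - Q w₀ 1 * h0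
      have z2 : (Q w₀ 0 ^ 2 + Q w₀ 1 ^ 2) * P x₁ 1 = 0 := by
        linear_combination Q w₀ 1 * e + Q w₀ 0 * h0
      refine hx₁' ?_
      rw [LinearMap.mem_ker]
      funext j
      fin_cases j
      exacts [(mul_eq_zero.1 z1).resolve_left hqpos.ne', (mul_eq_zero.1 z2).resolve_left hqpos.ne']
    obtain ⟨w₁, hw₁, hκ⟩ : ∃ w₁ ∈ Λ t, 0 < Q w₀ 0 * P w₁ 1 - Q w₀ 1 * P w₁ 0 := by
      rcases lt_or_gt_of_ne hκ with hlt | hgt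
      · refine ⟨-x₁, Submodule.neg_mem _ hx₁, ?_⟩
        simp only [map_neg, Pi.neg_apply]
        linarith
      · exact ⟨x₁, hx₁, hgt⟩
    have hli : LinearIndependent ℝ ![w₀, w₁] := by
      rw [LinearIndependent.pair_iff]
      intro x y hxy
      have hP : ∀ j, y * P w₁ j = 0 := fun j => by
        have := congrFun (congrArg P hxy) j
        simpa [hPw] using this
      have hy : y = 0 := by
        have e : y * (Q w₀ 0 * P w₁ 1 - Q w₀ 1 * P w₁ 0) = 0 := by
          linear_combination Q w₀ 0 * hP 1 - Q w₀ 1 * hP 0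
        exact (mul_eq_zero.1 e).resolve_right hκ.ne'
      subst hy
      rw [zero_smul, add_zero, smul_eq_zero] at hxy
      exact ⟨hxy.resolve_right hne, rfl⟩
    obtain ⟨Z, Z', hZt, hZ, hZd, hform⟩ := h.exists_frame_of_isCrossingForm hL ht hq hli
      (fun i => by fin_cases i; exacts [hw₀.1, hw₁])
    have hZ0 : Z t 0 = w₀ := by rw [hZt]; rfl
    have hZ1 : Z t 1 = w₁ := by rw [hZt]; rfl
    have dP := fun i j => (hasDerivWithinAt_coord h hZd i j).2
    have hrank : Module.finrank ℝ ↥(Λ t ⊓ LinearMap.ker P) = 1 := by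
      have h1 : 1 ≤ Module.finrank ℝ ↥(Λ t ⊓ LinearMap.ker P) :=
        Submodule.one_le_finrank_iff.2 hV
      have h2 : Module.finrank ℝ ↥(Λ t ⊓ LinearMap.ker P) < Module.finrank ℝ ↥(Λ t) :=
        Submodule.finrank_lt_finrank_of_lt (inf_lt_left.2 hle)
      have h3 := h.finrank_lagrangian hL
      omega
    have hval : q ⟨w₀, hw₀⟩ = c * (Q w₀ 0 * P (Z' 0) 0 + Q w₀ 1 * P (Z' 0) 1) := by
      rw [hform ⟨w₀, hw₀⟩ ![1, 0] (by simp [Fin.sum_univ_two]), h.form_two]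
      simp [hPw, Fin.sum_univ_two]
    have hd : HasDerivWithinAt (fun y => momentumDet P (Z y))
        (P (Z' 0) 0 * P w₁ 1 - P (Z' 0) 1 * P w₁ 0) (Icc a b) t := by
      have d1 := ((dP 0 0).mul (dP 1 1)).sub ((dP 0 1).mul (dP 1 0))
      simp only [momentumDet_two]
      refine HasDerivWithinAt.congr_deriv d1 ?_
      simp only [hZ0, hZ1, hPw]
      ring
    -- As P w₁ is Q w₀ turned by a quarter and scaled, the derivative of d is a multiple of the
    -- crossing form at w₀. The multiple is positive because w₁ was oriented so that Im D > 0.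
    have hkey : (P (Z' 0) 0 * P w₁ 1 - P (Z' 0) 1 * P w₁ 0) * (Q w₀ 0 ^ 2 + Q w₀ 1 ^ 2) =
        (Q w₀ 0 * P w₁ 1 - Q w₀ 1 * P w₁ 0) *
          (Q w₀ 0 * P (Z' 0) 0 + Q w₀ 1 * P (Z' 0) 1) := by
      linear_combination (Q w₀ 1 * P (Z' 0) 0 - Q w₀ 0 * P (Z' 0) 1) * horth w₁ hw₁
    refine ⟨Z, hZ, hZd.continuousWithinAt, by rw [momentumDet_two, hZ0]; simp [hPw],
      Or.inl ⟨?_, _, hd, ?_⟩⟩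
    · rw [frameDet_two_im, hZ0, hZ1]
      simpa [hPw] using hκ
    · rcases sig_of_finrank_one hrank hnd (w := ⟨w₀, hw₀⟩) (by simpa using hne) with
        ⟨h1, h2⟩ | ⟨h1, h2⟩
      · rw [hval] at h1
        refine Or.inl ⟨?_, h2⟩
        have := mul_pos hκ ((pos_iff_pos_of_mul_pos h1).1 h.pos)
        rw [← hkey] at this
        exact (pos_iff_pos_of_mul_pos this).2 hqpos
      · rw [hval] at h1
        refine Or.inr ⟨?_, h2⟩
        have h3 : Q w₀ 0 * P (Z' 0) 0 + Q w₀ 1 * P (Z' 0) 1 < 0 := by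
          by_contra hc
          exact absurd h1 (not_lt.2 (mul_nonneg h.pos.le (not_lt.1 hc)))
        have := mul_neg_of_pos_of_neg hκ h3
        rw [← hkey] at this
        by_contra hc
        exact absurd this (not_lt.2 (mul_nonneg (not_lt.1 hc) hqpos.le))

lemma nhdsWithin_inter_Ioi_le (s : Set ℝ) (t : ℝ) : 𝓝[s ∩ Ioi t] t ≤ 𝓝[s \ {t}] t :=
  nhdsWithin_mono _ fun _ hy => ⟨hy.1, (mem_Ioi.1 hy.2).ne'⟩

lemma nhdsWithin_inter_Iio_le (s : Set ℝ) (t : ℝ) : 𝓝[s ∩ Iio t] t ≤ 𝓝[s \ {t}] t :=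
  nhdsWithin_mono _ fun _ hy => ⟨hy.1, (mem_Iio.1 hy.2).ne⟩

/-- Limits of `planeDefect` along a filter at a full crossing with definite crossing form. -/
lemma tendsto_planeDefect_of_im {X : Type*} {D : X → ℂ} {d : X → ℝ} {l : Filter X}
    (hD : Tendsto D l (𝓝 1)) (hd : ∀ᶠ y in l, 0 < d y) :
    ((∀ᶠ y in l, 0 < (D y).im) →
      Tendsto (fun y => planeDefect (D y) (d y)) l (𝓝 (-Real.pi))) ∧
    ((∀ᶠ y in l, (D y).im < 0) →
      Tendsto (fun y => planeDefect (D y) (d y)) l (𝓝 Real.pi)) := by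
  have hD' : Tendsto (fun y => -D y) l (𝓝 (-1)) := hD.neg
  constructor
  · intro him
    refine ((Complex.tendsto_arg_nhdsWithin_im_neg_of_re_neg_of_im_zero (z := -1) (by simp)
      (by simp)).comp (tendsto_nhdsWithin_iff.2 ⟨hD', ?_⟩)).congr' ?_
    · filter_upwards [him] with y hy
      simpa using hy
    · filter_upwards [hd] with y hy
      exact (planeDefect_of_pos _ hy).symm
  · intro him
    refine ((Complex.tendsto_arg_nhdsWithin_im_nonneg_of_re_neg_of_im_zero (z := -1) (by simp)
      (by simp)).comp (tendsto_nhdsWithin_iff.2 ⟨hD', ?_⟩)).congr' ?_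
    · filter_upwards [him] with y hy
      simpa using hy.le
    · filter_upwards [hd] with y hy
      exact (planeDefect_of_pos _ hy).symm

theorem IsDarboux.isMaslovPair_plane (h : IsDarboux ω c Q P) :
    IsMaslovPair ω (LinearMap.ker P) (maslovSq Q P) (frameValue Q P planeDefect) where
  ne_zero _ hL := h.maslovSq_ne_zero hL
  continuousOn _ _ hΛ := h.continuousOn_maslovSq hΛ
  sq_eq _ hL := h.maslovSq_sq_eq planeDefect_smul pow_four_eq_planeDefect hL
  eventually_transverse _ _ _ _ hΛ ht h0 := h.eventually_transverse hΛ ht h0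
  continuousWithinAt Λ a b t hΛ ht h0 := by
    obtain ⟨Z, hZ, hc⟩ := h.exists_localFrame hΛ ht
    have hself := hZ.self_of_nhdsWithin ht
    have hev := IsDarboux.frameValue_eventuallyEq (Q := Q) (P := P) planeDefect_smul hZ
    rw [← hself.2, inf_ker_eq_bot_iff hself.1] at h0
    refine ContinuousWithinAt.congr_of_eventuallyEq ?_ hev (hev.self_of_nhdsWithin ht)
    have hD := h.continuous_frameDet.continuousAt.comp_continuousWithinAt hc
    have hd := h.continuous_momentumDet.continuousAt.comp_continuousWithinAt hc
    have h0' : (momentumDet P (Z t) : ℂ) ≠ 0 := by exact_mod_cast h0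
    have hquot : ContinuousWithinAt
        (fun y => -frameDet Q P (Z y) / momentumDet P (Z y)) (Icc a b) t :=
      hD.neg.div (Complex.continuous_ofReal.continuousAt.comp_continuousWithinAt hd) h0'
    have harg : ContinuousWithinAt
        (fun y => (-frameDet Q P (Z y) / momentumDet P (Z y)).arg) (Icc a b) t :=
      (Complex.continuousAt_arg (h.neg_frameDet_div_mem_slitPlane (hself.2.symm ▸ hΛ.2 t ht)
        h0)).comp_continuousWithinAt (f := fun y => -frameDet Q P (Z y) / momentumDet P (Z y)) hquot
    refine harg.congr_of_eventuallyEq ?_ (if_pos h0)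
    filter_upwards [hd.eventually_ne h0] with y hy
    exact if_pos hy
  isolated Λ a b t q hΛ hab ht hV hq hnd := by
    obtain ⟨Z, hZ, hc, hd0, hs⟩ := h.exists_frame_plane hΛ hab ht hV hq hnd
    have hev : ∀ᶠ y in 𝓝[Icc a b \ {t}] t, momentumDet P (Z y) ≠ 0 := by
      rcases hs with ⟨-, d', hd, hs⟩ | ⟨-, hd, -⟩ | ⟨-, hd, -⟩
      · exact hd.eventually_ne (by rcases hs with hs | hs; exacts [hs.1.ne', hs.1.ne])
      · exact hd.mono fun y hy => hy.ne
      · exact hd.mono fun y hy => hy.ne'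
    filter_upwards [hev, nhdsWithin_mono t (sdiff_subset (t := {t})) hZ] with y hy hy'
    rw [← hy'.2, inf_ker_eq_bot_iff hy'.1]
    exact hy
  tendsto_right Λ a b t q hΛ hab ht hV hq hnd := by
    obtain ⟨Z, hZ, hc, hd0, hs⟩ := h.exists_frame_plane hΛ hab ht hV hq hnd
    have hev := IsDarboux.frameValue_eventuallyEq (Q := Q) (P := P) planeDefect_smul hZ
    have hle := (hasDerivWithinAt_subset_filters (s := Icc a b) (t := t)).1
    have hle' := nhdsWithin_inter_Ioi_le (Icc a b) t
    have hD : Tendsto (fun y => frameDet Q P (Z y)) _ (𝓝 (frameDet Q P (Z t))) :=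
      (h.continuous_frameDet.continuousAt.comp_continuousWithinAt hc).tendsto.mono_left hle
    have hval : frameValue Q P planeDefect (Λ t) =
        -Real.arctan ((frameDet Q P (Z t)).re / (frameDet Q P (Z t)).im) :=
      (hev.self_of_nhdsWithin ht).trans (if_neg (not_not.2 hd0))
    rw [hval]
    refine Tendsto.congr' (EventuallyEq.symm (hle hev)) ?_
    -- At a line crossing D has Im D > 0, and the limit is arg(-D) or arg D according to the sign of
    -- d; these are -arctan(Re D / Im D) ∓ π/2. At a full crossing D = 1 and the value is 0: an
    -- indefinite form gives d < 0 and limit arg 1 = 0, a definite one gives d > 0 and limit ∓π.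
    rcases hs with ⟨him, d', hd, ⟨hp, e1, e2⟩ | ⟨hp, e1, e2⟩⟩ | ⟨h1, hd, e1, e2⟩ |
      ⟨h1, hd, d', him, ⟨hp, e1, e2⟩ | ⟨hp, e1, e2⟩⟩
    · have hneg : (-frameDet Q P (Z t)).im < 0 := by simpa using him
      convert (tendsto_planeDefect hD).1 (eventually_pos_right hd hd0 hp)
        (Complex.mem_slitPlane_iff.2 (Or.inr hneg.ne)) using 2
      rw [arg_eq_of_im_neg hneg, e1, e2, Complex.neg_re, Complex.neg_im, neg_div_neg_eq]
      push_cast; ring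
    · convert (tendsto_planeDefect hD).2 (eventually_neg_right hd hd0 hp)
        (Complex.mem_slitPlane_iff.2 (Or.inr him.ne')) using 2
      rw [arg_eq_of_im_pos him, e1, e2]
      push_cast; ring
    · rw [h1] at hD
      convert (tendsto_planeDefect hD).2 (hle' hd) (by simp) using 2
      rw [h1, e1, e2]
      simp
    · rw [h1] at hD
      convert (tendsto_planeDefect_of_im hD (hle' hd)).1
        (eventually_pos_right him (by rw [h1]; simp) hp) using 2
      rw [h1, e1, e2]
      simp
    · rw [h1] at hD
      convert (tendsto_planeDefect_of_im hD (hle' hd)).2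
        (eventually_neg_right him (by rw [h1]; simp) hp) using 2
      rw [h1, e1, e2]
      simp
  tendsto_left Λ a b t q hΛ hab ht hV hq hnd := by
    obtain ⟨Z, hZ, hc, hd0, hs⟩ := h.exists_frame_plane hΛ hab ht hV hq hnd
    have hev := IsDarboux.frameValue_eventuallyEq (Q := Q) (P := P) planeDefect_smul hZ
    have hle := (hasDerivWithinAt_subset_filters (s := Icc a b) (t := t)).2
    have hle' := nhdsWithin_inter_Iio_le (Icc a b) t
    have hD : Tendsto (fun y => frameDet Q P (Z y)) _ (𝓝 (frameDet Q P (Z t))) :=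
      (h.continuous_frameDet.continuousAt.comp_continuousWithinAt hc).tendsto.mono_left hle
    have hval : frameValue Q P planeDefect (Λ t) =
        -Real.arctan ((frameDet Q P (Z t)).re / (frameDet Q P (Z t)).im) :=
      (hev.self_of_nhdsWithin ht).trans (if_neg (not_not.2 hd0))
    rw [hval]
    refine Tendsto.congr' (EventuallyEq.symm (hle hev)) ?_
    rcases hs with ⟨him, d', hd, ⟨hp, e1, e2⟩ | ⟨hp, e1, e2⟩⟩ | ⟨h1, hd, e1, e2⟩ |
      ⟨h1, hd, d', him, ⟨hp, e1, e2⟩ | ⟨hp, e1, e2⟩⟩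
    · convert (tendsto_planeDefect hD).2 (eventually_neg_left hd hd0 hp)
        (Complex.mem_slitPlane_iff.2 (Or.inr him.ne')) using 2
      rw [arg_eq_of_im_pos him, e1, e2]
      push_cast; ring
    · have hneg : (-frameDet Q P (Z t)).im < 0 := by simpa using him
      convert (tendsto_planeDefect hD).1 (eventually_pos_left hd hd0 hp)
        (Complex.mem_slitPlane_iff.2 (Or.inr hneg.ne)) using 2
      rw [arg_eq_of_im_neg hneg, e1, e2, Complex.neg_re, Complex.neg_im, neg_div_neg_eq]
      push_cast; ring
    · rw [h1] at hD
      convert (tendsto_planeDefect hD).2 (hle' hd) (by simp) using 2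
      rw [h1, e1, e2]
      simp
    · rw [h1] at hD
      convert (tendsto_planeDefect_of_im hD (hle' hd)).2
        (eventually_neg_left him (by rw [h1]; simp) hp) using 2
      rw [h1, e1, e2]
      simp
    · rw [h1] at hD
      convert (tendsto_planeDefect_of_im hD (hle' hd)).1
        (eventually_pos_left him (by rw [h1]; simp) hp) using 2
      rw [h1, e1, e2]
      simp

end PlanePair

/-! ## Regular representatives of paths of symplectic matrices -/

/-- The product of the rotation by `φ` and the upper triangular matrix with rows
`(exp l, m * exp l)` and `(0, exp (-l))`. -/
def iwasawa (φ l m : ℝ) : Matrix (Fin 2) (Fin 2) ℝ :=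
  !![Real.cos φ * Real.exp l, Real.cos φ * (m * Real.exp l) - Real.sin φ * Real.exp (-l);
    Real.sin φ * Real.exp l, Real.sin φ * (m * Real.exp l) + Real.cos φ * Real.exp (-l)]

lemma det_iwasawa (φ l m : ℝ) : (iwasawa φ l m).det = 1 := by
  have h : Real.exp l * Real.exp (-l) = 1 := by rw [← Real.exp_add]; simp
  rw [Matrix.det_fin_two]
  simp only [iwasawa, Matrix.of_apply, Matrix.cons_val', Matrix.cons_val_zero, Matrix.cons_val_one,
    Matrix.cons_val_fin_one]
  linear_combination (Real.cos φ ^ 2 + Real.sin φ ^ 2) * h + Real.sin_sq_add_cos_sq φ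

lemma continuous_iwasawa {X : Type*} [TopologicalSpace X] {φ l m : X → ℝ} (hφ : Continuous φ)
    (hl : Continuous l) (hm : Continuous m) : Continuous fun x => iwasawa (φ x) (l x) (m x) := by
  refine continuous_matrix fun i j => ?_
  fin_cases i <;> fin_cases j <;> simp only [iwasawa] <;> simp <;> fun_prop

/-- The logarithmic derivative of a path of matrices `iwasawa φ l m` whose parameters have the
derivatives `φ'`, `l'`, `m'`, where `k = m' * exp (2 l)`. -/
def iwasawaLogDeriv (φ φ' l' k : ℝ) : Matrix (Fin 2) (Fin 2) ℝ :=
  !![l' * (Real.cos φ ^ 2 - Real.sin φ ^ 2) - k * Real.cos φ * Real.sin φ,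
      -φ' + 2 * l' * Real.cos φ * Real.sin φ + k * Real.cos φ ^ 2;
    φ' + 2 * l' * Real.cos φ * Real.sin φ - k * Real.sin φ ^ 2,
      -(l' * (Real.cos φ ^ 2 - Real.sin φ ^ 2)) + k * Real.cos φ * Real.sin φ]

/-- For M = R U with R the rotation and U triangular, M' M⁻¹ = φ' J + R (U' U⁻¹) R⁻¹, with J the
quarter turn and U' U⁻¹ having rows (l', k), (0, -l'). -/
lemma hasDerivWithinAt_iwasawa {φ l m : ℝ → ℝ} {φ' l' m' t : ℝ} {s : Set ℝ}
    (hφ : HasDerivWithinAt φ φ' s t) (hl : HasDerivWithinAt l l' s t)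
    (hm : HasDerivWithinAt m m' s t) (i j : Fin 2) :
    HasDerivWithinAt (fun y => iwasawa (φ y) (l y) (m y) i j)
      ((iwasawaLogDeriv (φ t) φ' l' (m' * Real.exp (2 * l t)) *
        iwasawa (φ t) (l t) (m t)) i j) s t := by
  have hc := hφ.cos
  have hs := hφ.sin
  have he := hl.exp
  have hn := hl.fun_neg.exp
  have e2 : Real.exp (2 * l t) * Real.exp (-l t) = Real.exp (l t) := by
    rw [← Real.exp_add]; congr 1; ring
  have hsc := Real.sin_sq_add_cos_sq (φ t)
  rw [Matrix.mul_apply, Fin.sum_univ_two]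
  fin_cases i <;> fin_cases j <;>
    simp only [iwasawa, iwasawaLogDeriv, Matrix.of_apply, Matrix.cons_val', Matrix.cons_val_zero,
      Matrix.cons_val_one, Matrix.cons_val_fin_one, Fin.zero_eta, Fin.mk_one]
  · refine HasDerivWithinAt.congr_deriv (hc.mul he) ?_
    linear_combination (-(l' * Real.cos (φ t) * Real.exp (l t))) * hsc
  · refine HasDerivWithinAt.congr_deriv ((hc.mul (hm.fun_mul he)).sub (hs.mul hn)) ?_
    linear_combination (-(l' * Real.cos (φ t) * m t * Real.exp (l t)) - l' * Real.sin (φ t) * Real.exp (-l t)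
      - m' * Real.exp (2 * l t) * Real.cos (φ t) * Real.exp (-l t)) * hsc
      - m' * Real.cos (φ t) * e2
  · refine HasDerivWithinAt.congr_deriv (hs.mul he) ?_
    linear_combination (-(l' * Real.sin (φ t) * Real.exp (l t))) * hsc
  · refine HasDerivWithinAt.congr_deriv ((hs.mul (hm.fun_mul he)).add (hc.mul hn)) ?_
    linear_combination (-(l' * Real.sin (φ t) * m t * Real.exp (l t)) + l' * Real.cos (φ t) * Real.exp (-l t)
      - m' * Real.exp (2 * l t) * Real.sin (φ t) * Real.exp (-l t)) * hsc
      - m' * Real.sin (φ t) * e2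

lemma omegaStd_apply (x y : Plane) : omegaStd x y = x 0 * y 1 - x 1 * y 0 := by
  simp [omegaStd, Matrix.toBilin'_apply, Fin.sum_univ_two]
  ring

lemma sq_add_sq_pos_of_ne_zero {x : Plane} (hx : x ≠ 0) : 0 < x 0 ^ 2 + x 1 ^ 2 := by
  by_contra hc
  refine hx (funext fun i => ?_)
  have h0 : x 0 ^ 2 = 0 := by nlinarith [sq_nonneg (x 0), sq_nonneg (x 1)]
  have h1 : x 1 ^ 2 = 0 := by nlinarith [sq_nonneg (x 0), sq_nonneg (x 1)]
  fin_cases i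
  · exact pow_eq_zero_iff two_ne_zero |>.1 h0
  · exact pow_eq_zero_iff two_ne_zero |>.1 h1

/-- In the coordinates (y, w) rotated by φ the form is φ'(y² + w²) - 2 l' y w - k w². So fast
rotation dominates the triangular part and makes the form definite. -/
lemma abs_omegaStd_iwasawaLogDeriv_sub_le (φ φ' l' k : ℝ) (x : Plane) :
    |omegaStd x ((iwasawaLogDeriv φ φ' l' k).mulVec x) - φ' * (x 0 ^ 2 + x 1 ^ 2)| ≤
      (|l'| + |k|) * (x 0 ^ 2 + x 1 ^ 2) := by
  set y := Real.cos φ * x 0 + Real.sin φ * x 1 with hy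
  set w := -Real.sin φ * x 0 + Real.cos φ * x 1 with hw
  have hsc := Real.sin_sq_add_cos_sq φ
  have hnorm : x 0 ^ 2 + x 1 ^ 2 = y ^ 2 + w ^ 2 := by
    rw [hy, hw]; linear_combination (-(x 0 ^ 2 + x 1 ^ 2)) * hsc
  have he : omegaStd x ((iwasawaLogDeriv φ φ' l' k).mulVec x) - φ' * (x 0 ^ 2 + x 1 ^ 2) =
      -(l' * (2 * y * w) + k * w ^ 2) := by
    rw [omegaStd_apply]
    simp only [iwasawaLogDeriv, Matrix.mulVec, dotProduct, Fin.sum_univ_two, Matrix.of_apply,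
      Matrix.cons_val', Matrix.cons_val_zero, Matrix.cons_val_one, Matrix.cons_val_fin_one, hy, hw]
    ring
  rw [he, hnorm, abs_neg, add_mul]
  refine (abs_add_le _ _).trans (add_le_add ?_ ?_)
  · rw [abs_mul]
    refine mul_le_mul_of_nonneg_left ?_ (abs_nonneg _)
    rw [abs_le]
    constructor <;> nlinarith [sq_nonneg (y + w), sq_nonneg (y - w)]
  · rw [abs_mul, abs_of_nonneg (sq_nonneg w)]
    refine mul_le_mul_of_nonneg_left ?_ (abs_nonneg _)
    nlinarith [sq_nonneg y]

lemma omegaStd_iwasawaLogDeriv_pos {φ φ' l' k : ℝ} (h : |l'| + |k| < φ') {x : Plane}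
    (hx : x ≠ 0) : 0 < omegaStd x ((iwasawaLogDeriv φ φ' l' k).mulVec x) := by
  have h1 := (abs_le.1 (abs_omegaStd_iwasawaLogDeriv_sub_le φ φ' l' k x)).1
  have h2 := mul_lt_mul_of_pos_right h (sq_add_sq_pos_of_ne_zero hx)
  linarith

lemma omegaStd_iwasawaLogDeriv_neg {φ φ' l' k : ℝ} (h : |l'| + |k| < -φ') {x : Plane}
    (hx : x ≠ 0) : omegaStd x ((iwasawaLogDeriv φ φ' l' k).mulVec x) < 0 := by
  have h1 := (abs_le.1 (abs_omegaStd_iwasawaLogDeriv_sub_le φ φ' l' k x)).2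
  have h2 := mul_lt_mul_of_pos_right h (sq_add_sq_pos_of_ne_zero hx)
  linarith

/-- The polar coordinates of the first column give φ and exp l. The parameter m is the component of
the second column along the first, and determinant one forces the remaining component. -/
lemma exists_eq_iwasawa {Ψ : ℝ → Matrix (Fin 2) (Fin 2) ℝ} (hc : Continuous Ψ)
    (hdet : ∀ t, (Ψ t).det = 1) (h1 : Ψ 0 = 1) :
    ∃ φ l m : ℝ → ℝ, Continuous φ ∧ Continuous l ∧ Continuous m ∧ φ 0 = 0 ∧ l 0 = 0 ∧ m 0 = 0 ∧
      ∀ t, Ψ t = iwasawa (φ t) (l t) (m t) := by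
  have hent : ∀ i j, Continuous fun t => Ψ t i j := fun i j => hc.matrix_elem i j
  set f : ℝ → ℂ := fun t => (Ψ t 0 0 : ℂ) + Ψ t 1 0 * Complex.I with hf
  have hfc : Continuous f := by
    have := hent 0 0
    have := hent 1 0
    fun_prop
  have hf0 : ∀ t, f t ≠ 0 := by
    intro t h
    have e0 : Ψ t 0 0 = 0 := by simpa [hf] using congrArg Complex.re h
    have e1 : Ψ t 1 0 = 0 := by simpa [hf] using congrArg Complex.im h
    have := hdet t
    rw [Matrix.det_fin_two, e0, e1] at this
    simp at this
  have hfone : f 0 = 1 := by simp [hf, h1]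
  obtain ⟨φ, ⟨hφc, hφ⟩, hφ0⟩ := exists_isArgLift hfc hf0 0 0 (by simp [hfone])
  have hφc' : Continuous φ := continuousOn_univ.1 hφc
  have hnpos : ∀ t, 0 < ‖f t‖ := fun t => norm_pos_iff.2 (hf0 t)
  have hexp : ∀ t, Real.exp (Real.log ‖f t‖) = ‖f t‖ := fun t => Real.exp_log (hnpos t)
  refine ⟨φ, fun t => Real.log ‖f t‖,
    fun t => (Real.cos (φ t) * Ψ t 0 1 + Real.sin (φ t) * Ψ t 1 1) / ‖f t‖, hφc', ?_, ?_, hφ0, ?_,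
    ?_, ?_⟩
  · exact hfc.norm.log fun t => (hnpos t).ne'
  · have := hent 0 1
    have := hent 1 1
    exact Continuous.div (by fun_prop) hfc.norm fun t => (hnpos t).ne'
  · simp [hfone]
  · simp [hφ0, h1]
  · intro t
    have ht := hφ t (mem_univ t)
    rw [Complex.exp_mul_I, ← Complex.ofReal_cos, ← Complex.ofReal_sin] at ht
    have e0 : Ψ t 0 0 = ‖f t‖ * Real.cos (φ t) := by
      have := congrArg Complex.re ht
      simpa [hf, -Complex.ofReal_cos, -Complex.ofReal_sin] using this
    have e1 : Ψ t 1 0 = ‖f t‖ * Real.sin (φ t) := by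
      have := congrArg Complex.im ht
      simpa [hf, -Complex.ofReal_cos, -Complex.ofReal_sin] using this
    have hd := hdet t
    rw [Matrix.det_fin_two, e0, e1] at hd
    have hsc := Real.sin_sq_add_cos_sq (φ t)
    have hn := (hnpos t).ne'
    have hd' : Real.cos (φ t) * Ψ t 1 1 - Real.sin (φ t) * Ψ t 0 1 = ‖f t‖⁻¹ := by
      field_simp
      linear_combination hd
    ext i j
    fin_cases i <;> fin_cases j <;>
      simp only [iwasawa, Matrix.of_apply, Matrix.cons_val', Matrix.cons_val_zero,
        Matrix.cons_val_one, Matrix.cons_val_fin_one, Fin.zero_eta, Fin.mk_one, Real.exp_neg,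
        hexp, div_mul_cancel₀ _ hn, ← hd']
    · rw [e0]; ring
    · linear_combination (-(Ψ t 0 1)) * hsc
    · rw [e1]; ring
    · linear_combination (-(Ψ t 1 1)) * hsc

/-! ### Existence of the index for paths induced by symplectic matrices -/

section Existence

variable {E : Type*} [NormedAddCommGroup E] [NormedSpace ℝ E] {n : ℕ}
  {ω : LinearMap.BilinForm ℝ E} {c : ℝ} {Q P : E →ₗ[ℝ] (Fin n → ℝ)}
  {ζ : Submodule ℝ E → ℂ} {g : Submodule ℝ E → ℝ}

/-- `z` assigns to matrices of determinant one frames of Lagrangian subspaces, and the crossing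
forms of the resulting paths with `V` inherit definiteness from the forms `ω (x, B x)`, where `B`
is the logarithmic derivative of the path of matrices. -/
structure IsLagrangianFrameMap (ω : LinearMap.BilinForm ℝ E) (V : Submodule ℝ E)
    (z : Matrix (Fin 2) (Fin 2) ℝ → Fin n → E) : Prop where
  continuous : Continuous z
  linearIndependent : ∀ M, M.det = 1 → LinearIndependent ℝ (z M)
  isotropic : ∀ M, M.det = 1 → ∀ i j, ω (z M i) (z M j) = 0
  exists_deriv : ∀ B : Matrix (Fin 2) (Fin 2) ℝ, ∃ R : E →ₗ[ℝ] E,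
    (∀ (M : ℝ → Matrix (Fin 2) (Fin 2) ℝ) (s : Set ℝ) (t : ℝ),
      (∀ i j, HasDerivWithinAt (fun y => M y i j) ((B * M t) i j) s t) →
      HasDerivWithinAt (fun y => z (M y)) (fun i => R (z (M t) i)) s t) ∧
    ((∀ x : Plane, x ≠ 0 → 0 < omegaStd x (B.mulVec x)) → ∀ v ∈ V, v ≠ 0 → 0 < ω v (R v)) ∧
    ((∀ x : Plane, x ≠ 0 → omegaStd x (B.mulVec x) < 0) → ∀ v ∈ V, v ≠ 0 → ω v (R v) < 0)

lemma IsDarboux.isLagrangianFamilyOn (h : IsDarboux ω c Q P) {V : Submodule ℝ E}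
    {z : Matrix (Fin 2) (Fin 2) ℝ → Fin n → E} (hz : IsLagrangianFrameMap ω V z)
    {X : Type*} [TopologicalSpace X] {K : X → Matrix (Fin 2) (Fin 2) ℝ} (hK : Continuous K)
    (hdet : ∀ x, (K x).det = 1) (s : Set X) :
    IsLagrangianFamilyOn ω (fun x => Submodule.span ℝ (range (z (K x)))) s :=
  ⟨fun _ _ => ⟨n, fun x => z (K x), Eventually.of_forall fun y =>
    ⟨hz.linearIndependent _ (hdet y), rfl⟩, (hz.continuous.comp hK).continuousWithinAt⟩,
    fun x _ => h.isLagrangian_span (hz.linearIndependent _ (hdet x)) (hz.isotropic _ (hdet x))⟩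

/-- A path with definite logarithmic derivative at its crossings has a nondegenerate crossing
form there. -/
lemma IsLagrangianFrameMap.exists_crossingForm {V : Submodule ℝ E}
    {z : Matrix (Fin 2) (Fin 2) ℝ → Fin n → E} (hz : IsLagrangianFrameMap ω V z)
    {K : ℝ → Matrix (Fin 2) (Fin 2) ℝ} (hdet : ∀ t, (K t).det = 1) {a b t : ℝ}
    {B : Matrix (Fin 2) (Fin 2) ℝ}
    (hd : ∀ i j, HasDerivWithinAt (fun y => K y i j) ((B * K t) i j) (Icc a b) t)
    (hB : (∀ x : Plane, x ≠ 0 → 0 < omegaStd x (B.mulVec x)) ∨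
      (∀ x : Plane, x ≠ 0 → omegaStd x (B.mulVec x) < 0)) :
    ∃ q : QuadraticForm ℝ ↥(Submodule.span ℝ (range (z (K t))) ⊓ V),
      IsCrossingForm ω (fun t => Submodule.span ℝ (range (z (K t)))) V a b t q ∧
        q.Nondegenerate := by
  obtain ⟨R, h1, h2, h3⟩ := hz.exists_deriv B
  let q₀ : QuadraticForm ℝ E := LinearMap.BilinMap.toQuadraticMap (ω.compl₂ R)
  have hq₀ : ∀ v, q₀ v = ω v (R v) := fun v => rfl
  refine ⟨q₀.restrict _, ⟨n, fun y => z (K y), _, ?_, h1 K _ t hd, ?_⟩, ?_⟩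
  · exact Eventually.of_forall fun y => ⟨hz.linearIndependent _ (hdet y), rfl⟩
  · intro v u hv
    rw [QuadraticMap.restrict_apply, hq₀, hv]
    simp [map_sum]
  · rcases hB with hB | hB
    · refine nondegenerate_of_posDef fun v hv => ?_
      rw [QuadraticMap.restrict_apply, hq₀]
      exact h2 hB v v.2.2 (by simpa using hv)
    · refine nondegenerate_of_negDef fun v hv => ?_
      rw [neg_apply, QuadraticMap.restrict_apply, hq₀]
      exact neg_pos.2 (h3 hB v v.2.2 (by simpa using hv))

/-- Existence of the Robbin–Salamon index of the Lagrangian path induced by a path of symplectic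
matrices, provided that the matrices `iwasawa θ l m` induce subspaces transverse to `ker P`. -/
lemma IsDarboux.exists_isRSIndex (h : IsDarboux ω c Q P)
    (hM : IsMaslovPair ω (LinearMap.ker P) ζ g) {z : Matrix (Fin 2) (Fin 2) ℝ → Fin n → E}
    (hz : IsLagrangianFrameMap ω (LinearMap.ker P) z) {Ψ : ℝ → Matrix (Fin 2) (Fin 2) ℝ}
    (hc : Continuous Ψ) (hdet : ∀ t, (Ψ t).det = 1) (hone : Ψ 0 = 1) {T : ℝ} (hT : 0 < T) {θ : ℝ}
    (hθ : ∀ l m, momentumDet P (z (iwasawa θ l m)) ≠ 0) :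
    ∃ μ, IsRSIndex ω (fun t => Submodule.span ℝ (range (z (Ψ t)))) (LinearMap.ker P) 0 T μ := by
  obtain ⟨φ, l, m, hφ, hl, hm, hφ0, hl0, hm0, hΨ⟩ := exists_eq_iwasawa hc hdet hone
  set κ := φ T / T with hκ
  set lam := l T / T with hlam
  set ρ := m T / T with hρ
  have hpi := Real.pi_pos
  -- Extra full turns make the slope N exceed the mean rotation speed plus the triangular terms; the
  -- exponential bounds the factor exp(2l) along the path.
  obtain ⟨k, hk⟩ : ∃ k : ℕ, |κ| + (|lam| + |ρ| * Real.exp (2 * (|lam| * T))) <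
      (2 * (θ + k * (2 * Real.pi)) - φ T) / T := by
    obtain ⟨k, hk⟩ := exists_nat_gt ((T * (|κ| + (|lam| + |ρ| * Real.exp (2 * (|lam| * T)))) + φ T -
      2 * θ) / (4 * Real.pi))
    refine ⟨k, ?_⟩
    rw [div_lt_iff₀ (by positivity)] at hk
    rw [lt_div_iff₀ hT]
    linarith
  set N := (2 * (θ + k * (2 * Real.pi)) - φ T) / T with hN
  -- A tent over the linear interpolation: it keeps both end values, rises fast on the first half
  -- and falls fast on the second, and its only kink, at T/2, is placed at the angle θ + 2πk.
  let φ₁ : ℝ → ℝ := fun t => κ * t + N * min t (T - t)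
  let K : ℝ × ℝ → Matrix (Fin 2) (Fin 2) ℝ := fun p =>
    iwasawa ((1 - p.1) * φ p.2 + p.1 * φ₁ p.2) ((1 - p.1) * l p.2 + p.1 * (lam * p.2))
      ((1 - p.1) * m p.2 + p.1 * (ρ * p.2))
  have hφ₁c : Continuous φ₁ := by fun_prop
  have hKc : Continuous K := continuous_iwasawa (by fun_prop) (by fun_prop) (by fun_prop)
  have hKdet : ∀ p, (K p).det = 1 := fun p => det_iwasawa _ _ _
  have hK0 : ∀ t, K (0, t) = Ψ t := fun t => by simp [K, hΨ]
  have hKa : ∀ s, K (s, 0) = Ψ 0 := fun s => by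
    simp [K, hΨ 0, φ₁, hφ0, hl0, hm0, hT.le]
  have hKb : ∀ s, K (s, T) = Ψ T := fun s => by
    have e1 : κ * T = φ T := by rw [hκ]; field_simp
    have e2 : lam * T = l T := by rw [hlam]; field_simp
    have e3 : ρ * T = m T := by rw [hρ]; field_simp
    simp only [K, φ₁, hΨ T, e1, e2, e3, sub_self, min_eq_right hT.le, mul_zero, add_zero]
    congr 1 <;> ring
  have hK1 : ∀ t, K (1, t) = iwasawa (φ₁ t) (lam * t) (ρ * t) := fun t => by simp [K]
  have hhalf : K (1, T / 2) = iwasawa θ (lam * (T / 2)) (ρ * (T / 2)) := by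
    rw [hK1]
    have : φ₁ (T / 2) = θ + k * (2 * Real.pi) := by
      simp only [φ₁, show T - T / 2 = T / 2 by ring, min_self, hκ, hN]
      field_simp
      ring
    rw [this, iwasawa, iwasawa, Real.cos_add_nat_mul_two_pi, Real.sin_add_nat_mul_two_pi]
  set Λ' : ℝ → Submodule ℝ E := fun t => Submodule.span ℝ (range (z (K (1, t)))) with hΛ'
  have hreg : ∃ μ, HasRegularIndex ω Λ' (LinearMap.ker P) 0 T μ := by
    refine hM.exists_hasRegularIndex hT
      (h.isLagrangianFamilyOn hz (hKc.comp (by fun_prop)) (fun t => hKdet (1, t)) _) ?_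
    intro t ht hcross
    -- At the kink the subspace is transverse by the choice of θ, so differentiability is not needed
    -- there.
    have hne : t ≠ T / 2 := by
      rintro rfl
      refine hcross ?_
      rw [hΛ']
      simp only
      rw [hhalf, inf_ker_eq_bot_iff (hz.linearIndependent _ (det_iwasawa _ _ _))]
      exact hθ _ _
    have hdl : HasDerivWithinAt (fun y => lam * y) lam (Icc 0 T) t := by
      simpa using ((hasDerivAt_id t).const_mul lam).hasDerivWithinAt
    have hdρ : HasDerivWithinAt (fun y => ρ * y) ρ (Icc 0 T) t := by
      simpa using ((hasDerivAt_id t).const_mul ρ).hasDerivWithinAt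
    have hkbound : |ρ * Real.exp (2 * (lam * t))| ≤ |ρ| * Real.exp (2 * (|lam| * T)) := by
      rw [abs_mul, Real.abs_exp]
      refine mul_le_mul_of_nonneg_left (Real.exp_le_exp.2 ?_) (abs_nonneg _)
      have h1 : lam * t ≤ |lam| * t := mul_le_mul_of_nonneg_right (le_abs_self _) ht.1
      have h2 : |lam| * t ≤ |lam| * T := mul_le_mul_of_nonneg_left ht.2 (abs_nonneg _)
      linarith
    have hκ1 := le_abs_self κ
    have hκ2 := neg_abs_le κ
    have hmain : ∃ φ', HasDerivWithinAt φ₁ φ' (Icc 0 T) t ∧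
        (|lam| + |ρ * Real.exp (2 * (lam * t))| < φ' ∨
          |lam| + |ρ * Real.exp (2 * (lam * t))| < -φ') := by
      rcases lt_or_gt_of_ne hne with hlt | hgt
      · refine ⟨κ + N, ?_, Or.inl (by linarith)⟩
        have hd : HasDerivAt (fun y => κ * y + N * y) (κ + N) t := by
          simpa using ((hasDerivAt_id t).const_mul κ).fun_add ((hasDerivAt_id t).const_mul N)
        refine (hd.congr_of_eventuallyEq ?_).hasDerivWithinAt
        filter_upwards [eventually_lt_nhds hlt] with y hy
        simp only [φ₁]
        rw [min_eq_left (by linarith)]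
      · refine ⟨κ - N, ?_, Or.inr (by linarith)⟩
        have hd : HasDerivAt (fun y => κ * y + N * (T - y)) (κ - N) t := by
          have := ((hasDerivAt_id t).const_mul κ).fun_add
            (((hasDerivAt_id t).const_sub T).const_mul N)
          simpa [sub_eq_add_neg] using this
        refine (hd.congr_of_eventuallyEq ?_).hasDerivWithinAt
        filter_upwards [eventually_gt_nhds hgt] with y hy
        simp only [φ₁]
        rw [min_eq_right (by linarith)]
    obtain ⟨φ', hd', hbound⟩ := hmain
    refine hz.exists_crossingForm (K := fun t => K (1, t)) (fun t => hKdet (1, t))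
      (B := iwasawaLogDeriv (φ₁ t) φ' lam (ρ * Real.exp (2 * (lam * t)))) ?_ ?_
    · intro i j
      simp only [hK1]
      exact hasDerivWithinAt_iwasawa hd' hdl hdρ i j
    · rcases hbound with hb | hb
      · exact Or.inl fun x hx => omegaStd_iwasawaLogDeriv_pos hb hx
      · exact Or.inr fun x hx => omegaStd_iwasawaLogDeriv_neg hb hx
  obtain ⟨μ, hμ⟩ := hreg
  refine ⟨μ, Λ', ⟨fun p => Submodule.span ℝ (range (z (K p))),
    h.isLagrangianFamilyOn hz hKc hKdet _, fun t _ => by simp only [hK0], fun t _ => rfl,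
    fun s _ => ⟨by simp only [hKa], by simp only [hKb]⟩⟩, hμ⟩

end Existence

/-! ## The Maslov pairs of the axes and of the twisted diagonal -/

section Index

variable {E : Type*} [NormedAddCommGroup E] [NormedSpace ℝ E] {n : ℕ}
  {ω : LinearMap.BilinForm ℝ E} {c : ℝ} {Q P : E →ₗ[ℝ] (Fin n → ℝ)}

/-- The index of the Lagrangian path induced by a path of symplectic matrices, in terms of a
continuous argument of the complex determinant of its frames. -/
lemma IsDarboux.pi_mul_rsIndex (h : IsDarboux ω c Q P) {G : ℂ → ℝ → ℝ}
    (hG : ∀ (r : ℝ) D d, r ≠ 0 → G (r * D) (r * d) = G D d)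
    (hM : IsMaslovPair ω (LinearMap.ker P) (maslovSq Q P) (frameValue Q P G))
    {z : Matrix (Fin 2) (Fin 2) ℝ → Fin n → E} (hz : IsLagrangianFrameMap ω (LinearMap.ker P) z)
    {Ψ : ℝ → Matrix (Fin 2) (Fin 2) ℝ} (hc : Continuous Ψ) (hdet : ∀ t, (Ψ t).det = 1)
    (hone : Ψ 0 = 1) {T : ℝ} (hT : 0 < T) {θ : ℝ}
    (hθ : ∀ l m, momentumDet P (z (iwasawa θ l m)) ≠ 0) {α : ℝ → ℝ}
    (hα : IsArgLift (fun t => frameDet Q P (z (Ψ t))) α (Icc 0 T)) :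
    Real.pi * rsIndex ω (fun t => Submodule.span ℝ (range (z (Ψ t)))) (LinearMap.ker P) 0 T =
      (α T - G (frameDet Q P (z (Ψ T))) (momentumDet P (z (Ψ T)))) -
      (α 0 - G (frameDet Q P (z (Ψ 0))) (momentumDet P (z (Ψ 0)))) := by
  have hli := fun t => hz.linearIndependent _ (hdet t)
  have hlift : IsArgLift (fun t => maslovSq Q P (Submodule.span ℝ (range (z (Ψ t)))))
      (fun t => α t + α t) (Icc 0 T) := by
    have h0 : ∀ t ∈ Icc 0 T, 0 < (‖frameDet Q P (z (Ψ t))‖ ^ 2)⁻¹ := fun t _ => by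
      have := h.frameDet_ne_zero (hli t) (h.isLagrangian_span (hli t) (hz.isotropic _ (hdet t)))
      positivity
    refine ((hα.mul hα).pos_smul h0).congr fun t _ => ?_
    rw [maslovSq_eq (hli t) rfl]
    push_cast
    ring
  have := hM.rsIndex_eq hT (h.exists_isRSIndex hM hz hc hdet hone hT hθ) hlift
  simp only [frameValue_eq hG (hli _) rfl] at this
  linarith

end Index

lemma IsSymplectic.det_eq_one {M : Matrix (Fin 2) (Fin 2) ℝ} (h : IsSymplectic M) :
    M.det = 1 := by
  have := h ![1, 0] ![0, 1]
  rw [omegaStd_apply, omegaStd_apply] at this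
  rw [Matrix.det_fin_two, mul_comm (M 0 1)]
  simpa [Matrix.mulVec, dotProduct, Fin.sum_univ_two] using this

/-- The frame of the image of a coordinate axis under a matrix given by a column. -/
def columnFrame (k : Fin 2) (M : Matrix (Fin 2) (Fin 2) ℝ) : Fin 1 → Plane :=
  fun _ i => M i k

lemma isLagrangianFrameMap_columnFrame (k : Fin 2) (V : Submodule ℝ Plane) :
    IsLagrangianFrameMap omegaStd V (columnFrame k) where
  continuous := by unfold columnFrame; fun_prop
  linearIndependent M hM := by
    refine LinearIndependent.of_subsingleton 0 fun h => ?_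
    have h0 : ∀ i, M i k = 0 := fun i => congrFun h i
    rw [Matrix.det_eq_zero_of_column_eq_zero k h0] at hM
    exact zero_ne_one hM
  isotropic M _ i j := by
    rw [omegaStd_apply]
    simp only [columnFrame]
    ring
  exists_deriv B := by
    refine ⟨B.mulVecLin, fun M s t h => ?_, fun h v _ hv => h v hv, fun h v _ hv => h v hv⟩
    refine hasDerivWithinAt_pi.2 fun _ => hasDerivWithinAt_pi.2 fun i => ?_
    exact h i k

/-- The real parts of the points of the plane, as the position of a Darboux system. -/
def reCoord : Plane →ₗ[ℝ] (Fin 1 → ℝ) := LinearMap.pi fun _ => LinearMap.proj 0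

/-- The imaginary parts of the points of the plane, as a coordinate of a Darboux system. -/
def imCoord : Plane →ₗ[ℝ] (Fin 1 → ℝ) := LinearMap.pi fun _ => LinearMap.proj 1

lemma reCoord_apply (x : Plane) (i : Fin 1) : reCoord x i = x 0 := rfl

lemma imCoord_apply (x : Plane) (i : Fin 1) : imCoord x i = x 1 := rfl

lemma isDarboux_re_im : IsDarboux omegaStd 1 reCoord imCoord where
  pos := one_pos
  form x y := by
    simp [omegaStd_apply, dotProduct, reCoord_apply, imCoord_apply]
  bij := by
    refine ⟨fun x y h => ?_, fun p => ⟨![p.1 0, p.2 0], ?_⟩⟩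
    · have h1 : x 0 = y 0 := congrFun (congrArg Prod.fst h) 0
      have h2 : x 1 = y 1 := congrFun (congrArg Prod.snd h) 0
      ext i
      fin_cases i
      · exact h1
      · exact h2
    · refine Prod.ext (funext fun i => ?_) (funext fun i => ?_) <;> rw [Subsingleton.elim i 0] <;> rfl

/-- Exchanging the coordinates reverses the sign of the form; the minus sign restores it. The
momentum then vanishes on the imaginary axis. -/
lemma isDarboux_im_neg_re : IsDarboux omegaStd 1 imCoord (-reCoord) where
  pos := one_pos
  form x y := by
    simp [omegaStd_apply, dotProduct, reCoord_apply, imCoord_apply]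
    ring
  bij := by
    refine ⟨fun x y h => ?_, fun p => ⟨![-p.2 0, p.1 0], ?_⟩⟩
    · have h1 : x 1 = y 1 := congrFun (congrArg Prod.fst h) 0
      have h2 : -x 0 = -y 0 := congrFun (congrArg Prod.snd h) 0
      ext i
      fin_cases i
      · exact neg_injective h2
      · exact h1
    · refine Prod.ext (funext fun i => ?_) (funext fun i => ?_) <;> rw [Subsingleton.elim i 0]
      · rfl
      · exact neg_neg _

lemma ker_imCoord : LinearMap.ker imCoord = realAxis := by
  ext x
  rw [realAxis, Submodule.mem_span_singleton, LinearMap.mem_ker]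
  constructor
  · intro h
    have : x 1 = 0 := congrFun h 0
    exact ⟨x 0, by ext i; fin_cases i <;> simp [this]⟩
  · rintro ⟨r, rfl⟩
    ext i
    simp [imCoord_apply]

lemma ker_neg_reCoord : LinearMap.ker (-reCoord) = imagAxis := by
  ext x
  rw [imagAxis, Submodule.mem_span_singleton, LinearMap.mem_ker]
  constructor
  · intro h
    have : -x 0 = 0 := congrFun h 0
    exact ⟨x 1, by ext i; fin_cases i <;> simp [neg_eq_zero.1 this]⟩
  · rintro ⟨r, rfl⟩
    ext i
    simp [reCoord_apply]

lemma movedSubspace_realAxis (Ψ : ℝ → Matrix (Fin 2) (Fin 2) ℝ) :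
    movedSubspace Ψ realAxis = fun t => Submodule.span ℝ (range (columnFrame 0 (Ψ t))) := by
  funext t
  rw [movedSubspace, realAxis, Submodule.map_span, image_singleton]
  have : columnFrame 0 (Ψ t) = fun _ => (Ψ t).mulVecLin ![1, 0] := by
    funext _ i
    simp [columnFrame, Matrix.mulVec, dotProduct, Fin.sum_univ_two]
  rw [this, range_const]

lemma movedSubspace_imagAxis (Ψ : ℝ → Matrix (Fin 2) (Fin 2) ℝ) :
    movedSubspace Ψ imagAxis = fun t => Submodule.span ℝ (range (columnFrame 1 (Ψ t))) := by
  funext t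
  rw [movedSubspace, imagAxis, Submodule.map_span, image_singleton]
  have : columnFrame 1 (Ψ t) = fun _ => (Ψ t).mulVecLin ![0, 1] := by
    funext _ i
    simp [columnFrame, Matrix.mulVec, dotProduct, Fin.sum_univ_two]
  rw [this, range_const]

/-! ### Twisted graphs and the twisted diagonal -/

lemma omegaProd_apply (v w : Plane × Plane) :
    omegaProd v w = omegaStd v.2 w.2 - omegaStd v.1 w.1 := by
  simp [omegaProd]

/-- The frame of the twisted graph of a matrix over the standard basis. -/
def graphFrame (M : Matrix (Fin 2) (Fin 2) ℝ) : Fin 2 → Plane × Plane :=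
  fun i => (Pi.single i 1, fun j => -M j i)

lemma sum_smul_graphFrame (M : Matrix (Fin 2) (Fin 2) ℝ) (x : Plane) :
    ∑ i, x i • graphFrame M i = (x, -M.mulVec x) := by
  refine Prod.ext ?_ ?_ <;> ext j <;> fin_cases j <;>
    simp [graphFrame, Fin.sum_univ_two] <;> ring

lemma span_range_graphFrame (M : Matrix (Fin 2) (Fin 2) ℝ) :
    Submodule.span ℝ (range (graphFrame M)) = twistedGraph M := by
  ext v
  rw [Submodule.mem_span_range_iff_exists_fun, twistedGraph, LinearMap.mem_range]
  simp only [sum_smul_graphFrame]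
  rfl

/-- The position of the Darboux system adapted to the twisted diagonal. -/
def diffCoord : Plane × Plane →ₗ[ℝ] Plane := LinearMap.fst ℝ Plane Plane - LinearMap.snd ℝ Plane Plane

/-- The momentum of the Darboux system adapted to the twisted diagonal. -/
def rotSumCoord : Plane × Plane →ₗ[ℝ] Plane :=
  (Matrix.mulVecLin !![0, -1; 1, 0]).comp
    (LinearMap.fst ℝ Plane Plane + LinearMap.snd ℝ Plane Plane)

lemma diffCoord_apply (v : Plane × Plane) : diffCoord v = v.1 - v.2 := rfl

lemma rotSumCoord_zero (v : Plane × Plane) : rotSumCoord v 0 = -(v.1 1 + v.2 1) := by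
  simp [rotSumCoord, Matrix.mulVec, dotProduct, Fin.sum_univ_two]

lemma rotSumCoord_one (v : Plane × Plane) : rotSumCoord v 1 = v.1 0 + v.2 0 := by
  simp [rotSumCoord, Matrix.mulVec, dotProduct, Fin.sum_univ_two]

lemma isDarboux_diff_rotSum : IsDarboux omegaProd (1 / 2) diffCoord rotSumCoord where
  pos := by norm_num
  form v w := by
    simp only [omegaProd_apply, omegaStd_apply, dotProduct, Fin.sum_univ_two, diffCoord_apply,
      rotSumCoord_zero, rotSumCoord_one, Pi.sub_apply]
    ring
  bij := by
    refine ⟨fun v w h => ?_, fun p =>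
      ⟨(![(p.1 0 + p.2 1) / 2, (p.1 1 - p.2 0) / 2], ![(p.2 1 - p.1 0) / 2, -(p.1 1 + p.2 0) / 2]),
        ?_⟩⟩
    · have hq : diffCoord v = diffCoord w := congrArg Prod.fst h
      have hp : rotSumCoord v = rotSumCoord w := congrArg Prod.snd h
      have q0 := congrFun hq 0
      have q1 := congrFun hq 1
      have p0 := congrFun hp 0
      have p1 := congrFun hp 1
      simp only [diffCoord_apply, Pi.sub_apply] at q0 q1
      rw [rotSumCoord_zero, rotSumCoord_zero] at p0
      rw [rotSumCoord_one, rotSumCoord_one] at p1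
      refine Prod.ext ?_ ?_ <;> ext i <;> fin_cases i <;>
        simp only [Fin.zero_eta, Fin.mk_one] <;> linarith
    · refine Prod.ext (funext fun i => ?_) (funext fun i => ?_)
      · refine (congrFun (diffCoord_apply _) i).trans ?_
        fin_cases i <;> simp <;> ring
      · fin_cases i
        · refine (rotSumCoord_zero _).trans ?_
          simp
          ring
        · refine (rotSumCoord_one _).trans ?_
          simp
          ring

lemma mem_ker_rotSumCoord {v : Plane × Plane} : v ∈ LinearMap.ker rotSumCoord ↔ v.2 = -v.1 := by
  rw [LinearMap.mem_ker]
  constructor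
  · intro h
    have p0 := congrFun h 0
    have p1 := congrFun h 1
    rw [rotSumCoord_zero, Pi.zero_apply] at p0
    rw [rotSumCoord_one, Pi.zero_apply] at p1
    ext i
    fin_cases i <;> simp only [Fin.zero_eta, Fin.mk_one, Pi.neg_apply] <;> linarith
  · intro h
    ext i
    fin_cases i
    · exact (rotSumCoord_zero v).trans (by simp [h])
    · exact (rotSumCoord_one v).trans (by simp [h])

lemma ker_rotSumCoord : LinearMap.ker rotSumCoord = twistedDiagonal := by
  ext v
  rw [mem_ker_rotSumCoord, twistedDiagonal, LinearMap.mem_range]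
  constructor
  · intro h
    exact ⟨v.1, Prod.ext rfl h.symm⟩
  · rintro ⟨x, rfl⟩
    rfl

lemma isLagrangianFrameMap_graphFrame :
    IsLagrangianFrameMap omegaProd (LinearMap.ker rotSumCoord) graphFrame where
  continuous := by unfold graphFrame; fun_prop
  linearIndependent M _ := by
    rw [Fintype.linearIndependent_iff]
    intro x hx i
    rw [sum_smul_graphFrame] at hx
    exact congrFun (congrArg Prod.fst hx) i
  isotropic M hM i j := by
    rw [Matrix.det_fin_two] at hM
    rw [omegaProd_apply, omegaStd_apply, omegaStd_apply]
    fin_cases i <;> fin_cases j <;> simp [graphFrame] <;> linarith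
  exists_deriv B := by
    refine ⟨(LinearMap.inr ℝ Plane Plane).comp (B.mulVecLin.comp (LinearMap.snd ℝ Plane Plane)),
      fun M s t h => ?_, fun h v hv hv0 => ?_, fun h v hv hv0 => ?_⟩
    · refine hasDerivWithinAt_pi.2 fun i => ?_
      refine HasDerivWithinAt.prodMk (hasDerivWithinAt_const _ _ _)
        (hasDerivWithinAt_pi.2 fun j => ?_)
      refine ((h j i).fun_neg).congr_deriv ?_
      fin_cases j <;> simp [graphFrame, Matrix.mul_apply, Fin.sum_univ_two] <;> ring
    all_goals
      rw [mem_ker_rotSumCoord] at hv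
      have h2 : v.2 ≠ 0 := fun h2 => hv0 (Prod.ext (by rw [h2] at hv; simpa using hv.symm) h2)
      rw [omegaProd_apply]
      simpa [omegaStd_apply v.1] using h v.2 h2

lemma frameDet_graphFrame (M : Matrix (Fin 2) (Fin 2) ℝ) :
    frameDet diffCoord rotSumCoord (graphFrame M) =
      ((2 : ℝ) : ℂ) * ((M 0 0 + M 1 1 : ℝ) + (M 1 0 - M 0 1 : ℝ) * Complex.I) := by
  apply Complex.ext
  · rw [frameDet_two_re]
    simp [diffCoord_apply, rotSumCoord_zero, rotSumCoord_one, graphFrame]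
    ring
  · rw [frameDet_two_im]
    simp [diffCoord_apply, rotSumCoord_zero, rotSumCoord_one, graphFrame]
    ring

/-- The momentum of (x, -Mx) is the rotated vector (1 - M)x, so this is det(1 - M) for a matrix of
determinant one. -/
lemma momentumDet_graphFrame {M : Matrix (Fin 2) (Fin 2) ℝ} (hM : M.det = 1) :
    momentumDet rotSumCoord (graphFrame M) = 2 - (M 0 0 + M 1 1) := by
  rw [Matrix.det_fin_two] at hM
  rw [momentumDet_two]
  simp [rotSumCoord_zero, rotSumCoord_one, graphFrame]
  linear_combination hM

/-- The complex number `(M 0 0 + M 1 1) + i (M 1 0 - M 0 1)`, twice the complex linear part of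
`M`. -/
def linearPart (M : Matrix (Fin 2) (Fin 2) ℝ) : ℂ :=
  (M 0 0 + M 1 1 : ℝ) + (M 1 0 - M 0 1 : ℝ) * Complex.I

/-! ### The three indices as endpoint expressions -/

section Indices

variable {Ψ : ℝ → Matrix (Fin 2) (Fin 2) ℝ} {T : ℝ} {α : ℝ → ℝ}

/-- The angle π/2 used for existence carries the real axis to the imaginary one, whatever the
triangular factor. At time 0 the defect vanishes through 1 / 0 = 0. -/
lemma pi_mul_rsIndex_realAxis (hc : Continuous Ψ) (hdet : ∀ t, (Ψ t).det = 1) (hone : Ψ 0 = 1)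
    (hT : 0 < T) (hα : IsArgLift (fun t => (Ψ t 0 0 : ℂ) + Ψ t 1 0 * Complex.I) α (Icc 0 T))
    (h0 : α 0 = 0) :
    Real.pi * rsIndex omegaStd (movedSubspace Ψ realAxis) realAxis 0 T =
      α T + Real.arctan (Ψ T 0 0 / Ψ T 1 0) := by
  rw [movedSubspace_realAxis, ← ker_imCoord,
    isDarboux_re_im.pi_mul_rsIndex lineDefect_smul isDarboux_re_im.isMaslovPair_line
      (isLagrangianFrameMap_columnFrame 0 _) hc hdet hone hT (θ := Real.pi / 2)
      (fun l m => by simp [momentumDet_one, imCoord_apply, columnFrame, iwasawa])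
      (hα.congr fun t _ => by simp [frameDet_one, imCoord_apply, reCoord_apply, columnFrame])]
  simp [lineDefect, frameDet_one, imCoord_apply, reCoord_apply, columnFrame, hone, h0]

lemma pi_mul_rsIndex_imagAxis (hc : Continuous Ψ) (hdet : ∀ t, (Ψ t).det = 1) (hone : Ψ 0 = 1)
    (hT : 0 < T) (hα : IsArgLift (fun t => (Ψ t 1 1 : ℂ) - Ψ t 0 1 * Complex.I) α (Icc 0 T))
    (h0 : α 0 = 0) :
    Real.pi * rsIndex omegaStd (movedSubspace Ψ imagAxis) imagAxis 0 T =
      α T + Real.arctan (-Ψ T 1 1 / Ψ T 0 1) := by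
  rw [movedSubspace_imagAxis, ← ker_neg_reCoord,
    isDarboux_im_neg_re.pi_mul_rsIndex lineDefect_smul isDarboux_im_neg_re.isMaslovPair_line
      (isLagrangianFrameMap_columnFrame 1 _) hc hdet hone hT (θ := Real.pi / 2)
      (fun l m => by simp [momentumDet_one, reCoord_apply, columnFrame, iwasawa])
      (hα.congr fun t _ => by
        simp [frameDet_one, imCoord_apply, reCoord_apply, columnFrame, sub_eq_add_neg])]
  simp [lineDefect, frameDet_one, imCoord_apply, reCoord_apply, columnFrame, hone, h0, div_neg,
    neg_div, sub_eq_add_neg]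

/-- Scaling D and d by 1/2 does not change the defect, which explains the factor 2 in the
denominator. With rotation angle π the trace is negative, so 2 - tr ≠ 0 and the twisted graph is
transverse to the twisted diagonal. -/
lemma pi_mul_czIndex (hc : Continuous Ψ) (hdet : ∀ t, (Ψ t).det = 1) (hone : Ψ 0 = 1)
    (hT : 0 < T) (hα : IsArgLift (fun t => linearPart (Ψ t)) α (Icc 0 T)) (h0 : α 0 = 0) :
    Real.pi * czIndex Ψ T =
      α T - planeDefect (linearPart (Ψ T)) ((2 - (Ψ T 0 0 + Ψ T 1 1)) / 2) := by
  have hD : ∀ t, frameDet diffCoord rotSumCoord (graphFrame (Ψ t)) =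
      ((2 : ℝ) : ℂ) * linearPart (Ψ t) := fun t => frameDet_graphFrame (Ψ t)
  have hG : ∀ t, planeDefect (frameDet diffCoord rotSumCoord (graphFrame (Ψ t)))
      (momentumDet rotSumCoord (graphFrame (Ψ t))) =
      planeDefect (linearPart (Ψ t)) ((2 - (Ψ t 0 0 + Ψ t 1 1)) / 2) := fun t => by
    rw [hD, momentumDet_graphFrame (hdet t), ← planeDefect_smul 2 (linearPart (Ψ t)) _ two_ne_zero,
      mul_div_cancel₀ _ two_ne_zero]
  simp only [czIndex, ← span_range_graphFrame]
  rw [← ker_rotSumCoord,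
    isDarboux_diff_rotSum.pi_mul_rsIndex planeDefect_smul isDarboux_diff_rotSum.isMaslovPair_plane
      isLagrangianFrameMap_graphFrame hc hdet hone hT (θ := Real.pi)
      (fun l m => by
        rw [momentumDet_graphFrame (det_iwasawa _ _ _)]
        simp only [iwasawa, Real.cos_pi, Real.sin_pi]
        have := Real.exp_pos l
        have := Real.exp_pos (-l)
        simp
        linarith)
      ((hα.pos_smul (r := fun _ => 2) fun _ _ => two_pos).congr fun t _ => hD t), hG, hG]
  simp [planeDefect, linearPart, hone, h0]
  norm_num

end Indices

/-! ## Comparison of the arguments -/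

lemma arg_one_add_mul_I_mul (x y : ℝ) :
    ((1 + x * Complex.I) * (1 + y * Complex.I)).arg = Real.arctan x + Real.arctan y := by
  have h : ∀ u : ℝ, (1 + u * Complex.I) ≠ 0 := fun u h => by simpa using congrArg Complex.re h
  have hx1 := Real.arctan_lt_pi_div_two x
  have hx2 := Real.neg_pi_div_two_lt_arctan x
  have hy1 := Real.arctan_lt_pi_div_two y
  have hy2 := Real.neg_pi_div_two_lt_arctan y
  rw [Complex.arg_mul (h x) (h y), arg_one_add_mul_I, arg_one_add_mul_I]
  rw [arg_one_add_mul_I, arg_one_add_mul_I]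
  exact ⟨by linarith, by linarith⟩

lemma arg_eq_arctan_add_arctan {r x y : ℝ} (hr : 0 < r) {w : ℂ}
    (hw : w = r * ((1 + x * Complex.I) * (1 + y * Complex.I))) :
    w.arg = Real.arctan x + Real.arctan y := by
  rw [hw, Complex.arg_real_mul _ hr, arg_one_add_mul_I_mul]

/-- Either sum is π/2 or -π/2 according to the common sign of x and y. -/
lemma arctan_add_arctan_inv_eq {x y : ℝ} (h : 0 < x * y) :
    Real.arctan x + Real.arctan x⁻¹ = Real.arctan y + Real.arctan y⁻¹ := by
  rcases pos_and_pos_or_neg_and_neg_of_mul_pos h with ⟨hx, hy⟩ | ⟨hx, hy⟩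
  · rw [Real.arctan_inv_of_pos hx, Real.arctan_inv_of_pos hy]
    ring
  · rw [Real.arctan_inv_of_neg hx, Real.arctan_inv_of_neg hy]
    ring

/-- The real part is a² - bc and the imaginary part a(b + c). If the latter vanishes, then a = 0 and
the real part is 1, or c = -b and it is a² + b² > 0. -/
lemma mul_mem_slitPlane {a b c d : ℝ} (h : a * d - b * c = 1) :
    ((a + c * Complex.I) * (a + b * Complex.I) : ℂ) ∈ Complex.slitPlane := by
  rw [Complex.mem_slitPlane_iff]
  simp only [Complex.mul_re, Complex.mul_im, Complex.add_re, Complex.add_im, Complex.ofReal_re,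
    Complex.ofReal_im, Complex.I_re, Complex.I_im, mul_zero, mul_one, sub_zero, add_zero,
    zero_add]
  by_contra! hc
  obtain ⟨h1, h2⟩ := hc
  rcases mul_eq_zero.1 (show a * (b + c) = 0 by linarith) with ha | hb
  · subst ha
    linarith
  · obtain rfl : c = -b := by linarith
    have ha : a ^ 2 = 0 := by nlinarith [sq_nonneg a, sq_nonneg b]
    have hb : b ^ 2 = 0 := by nlinarith [sq_nonneg a, sq_nonneg b]
    rw [pow_eq_zero_iff two_ne_zero] at ha hb
    simp [ha, hb] at h

/-- The identity between the endpoint contributions of the three indices. -/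
lemma arg_sub_arg_eq_planeDefect {a b c d : ℝ} (h : a * d - b * c = 1) :
    ((d + c * Complex.I) * (d + b * Complex.I) : ℂ).arg -
      ((a + c * Complex.I) * (a + b * Complex.I) : ℂ).arg =
      planeDefect ((a - b * Complex.I) * (d + c * Complex.I)) (-(b * c)) + Real.arctan (a / c) +
        Real.arctan (-d / b) := by
  have hI : Complex.I ^ 2 = -1 := Complex.I_sq
  have hC : (a * d - b * c : ℂ) = 1 := by exact_mod_cast h
  have hpos : ∀ {x : ℝ}, x ≠ 0 → ((x + c * Complex.I) * (x + b * Complex.I) : ℂ).arg =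
      Real.arctan (c / x) + Real.arctan (b / x) := fun {x} hx => by
    have hx' : (x : ℂ) ≠ 0 := by exact_mod_cast hx
    refine arg_eq_arctan_add_arctan (r := x ^ 2) (by positivity) ?_
    push_cast
    field_simp
  -- The case bc = 0 is the degenerate one, det(Ψ(T) - 1) = 0; there d = a⁻¹ and the identity
  -- reduces to sums arctan x + arctan x⁻¹.
  by_cases hbc : b * c = 0
  · rw [planeDefect, if_neg (not_not.2 (neg_eq_zero.2 hbc))]
    have hre : ((a - b * Complex.I) * (d + c * Complex.I) : ℂ).re = 1 := by
      simp
      linear_combination h + 2 * hbc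
    have him : ((a - b * Complex.I) * (d + c * Complex.I) : ℂ).im = a * c - b * d := by
      simp
      ring
    have had : a * d = 1 := by linarith
    have ha : a ≠ 0 := left_ne_zero_of_mul_eq_one had
    have hd : d = a⁻¹ := eq_inv_of_mul_eq_one_right had
    have hd0 : d ≠ 0 := right_ne_zero_of_mul_eq_one had
    rw [hre, him, hpos hd0, hpos ha]
    rcases mul_eq_zero.1 hbc with rfl | rfl
    · by_cases hc : c = 0
      · simp [hc]
      · have := arctan_add_arctan_inv_eq (x := a * c) (y := c / a) (by
          have : a * c * (c / a) = c ^ 2 := by field_simp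
          rw [this]
          positivity)
        rw [inv_div] at this
        simp only [zero_div, Real.arctan_zero, div_zero, zero_mul, sub_zero, one_div, hd, div_inv_eq_mul,
          mul_comm c a]
        linarith
    · by_cases hb : b = 0
      · simp [hb]
      · have := arctan_add_arctan_inv_eq (x := a * b) (y := b / a) (by
          have : a * b * (b / a) = b ^ 2 := by field_simp
          rw [this]
          positivity)
        have e1 : 1 / (a * 0 - b * d) = -(b / a)⁻¹ := by
          rw [hd, mul_zero, zero_sub, one_div, inv_neg, div_eq_mul_inv]
        have e2 : -d / b = -(a * b)⁻¹ := by rw [hd]; field_simp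
        have e3 : b / d = a * b := by rw [hd, div_inv_eq_mul, mul_comm]
        rw [e1, e2, e3, Real.arctan_neg, Real.arctan_neg]
        simp only [zero_div, Real.arctan_zero, div_zero]
        linarith
  · obtain ⟨hb, hc⟩ := mul_ne_zero_iff.1 hbc
    have hb' : (b : ℂ) ≠ 0 := by exact_mod_cast hb
    have hc' : (c : ℂ) ≠ 0 := by exact_mod_cast hc
    -- Division by bc splits the product as (1 + i a/b)(1 - i d/c).
    have hg : planeDefect ((a - b * Complex.I) * (d + c * Complex.I)) (-(b * c)) =
        Real.arctan (a / b) + Real.arctan (-(d / c)) := by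
      rw [planeDefect, if_pos (neg_ne_zero.2 hbc)]
      refine arg_eq_arctan_add_arctan (r := 1) one_pos ?_
      push_cast
      field_simp
      linear_combination (a * d - b * c : ℂ) * hI
    rw [hg, neg_div, Real.arctan_neg, Real.arctan_neg]
    rcases lt_or_gt_of_ne hbc with hneg | hpos'
    · have key : ∀ x : ℝ, ((x + c * Complex.I) * (x + b * Complex.I) : ℂ).arg =
          Real.arctan (-(x / c)) + Real.arctan (-(x / b)) := fun x => by
        refine arg_eq_arctan_add_arctan (r := -(b * c)) (neg_pos.2 hneg) ?_
        push_cast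
        field_simp
        ring_nf
        simp only [hI]
        ring
      rw [key, key]
      simp only [Real.arctan_neg]
      ring
    · have had : 0 < a * d := by linarith
      have ha : a ≠ 0 := left_ne_zero_of_mul had.ne'
      have hd : d ≠ 0 := right_ne_zero_of_mul had.ne'
      rw [hpos ha, hpos hd]
      have key : ∀ x : ℝ, x ≠ 0 → Real.arctan (x / d) + Real.arctan (d / x) =
          Real.arctan (x / a) + Real.arctan (a / x) := fun x hx => by
        have := arctan_add_arctan_inv_eq (x := x / d) (y := x / a) (by
          have : x / d * (x / a) = x ^ 2 / (a * d) := by field_simp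
          rw [this]
          positivity)
        rwa [inv_div, inv_div] at this
      linarith [key b hb, key c hc]

/-! ## The path of matrices and its half -/

lemma linearPart_ne_zero {M : Matrix (Fin 2) (Fin 2) ℝ} (hM : M.det = 1) : linearPart M ≠ 0 := by
  rw [Matrix.det_fin_two] at hM
  intro h
  have h1 : M 0 0 + M 1 1 = 0 := by simpa [linearPart] using congrArg Complex.re h
  have h2 : M 1 0 - M 0 1 = 0 := by simpa [linearPart] using congrArg Complex.im h
  nlinarith [sq_nonneg (M 0 0 - M 1 1), sq_nonneg (M 0 1 + M 1 0)]

lemma conjMatrix_mul_self : conjMatrix * conjMatrix = 1 := by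
  ext i j
  fin_cases i <;> fin_cases j <;> simp [conjMatrix]

lemma linearPart_commutator (A : Matrix (Fin 2) (Fin 2) ℝ) :
    linearPart (conjMatrix * A.adjugate * conjMatrix * A) =
      ((2 : ℝ) : ℂ) * (((A 0 0 : ℂ) - A 0 1 * Complex.I) * (A 1 1 + A 1 0 * Complex.I)) := by
  apply Complex.ext <;>
  · simp [linearPart, conjMatrix, Matrix.adjugate_fin_two, Matrix.mul_apply, Fin.sum_univ_two]
    ring

lemma trace_commutator {A : Matrix (Fin 2) (Fin 2) ℝ} (hA : A.det = 1) :
    (2 - ((conjMatrix * A.adjugate * conjMatrix * A) 0 0 +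
      (conjMatrix * A.adjugate * conjMatrix * A) 1 1)) / 2 = 2 * -(A 0 1 * A 1 0) := by
  rw [Matrix.det_fin_two] at hA
  simp [conjMatrix, Matrix.adjugate_fin_two, Matrix.mul_apply, Fin.sum_univ_two]
  linear_combination -hA

section Halves

variable {Ψ : ℝ → Matrix (Fin 2) (Fin 2) ℝ} {T : ℝ}

/-- At t = -T/2 the two symmetries give Ψ(T/2) = I Ψ(T/2) I Ψ(T), which is solved for Ψ(T). -/
lemma apply_eq_commutator (hdet : ∀ t, (Ψ t).det = 1) (hper : ∀ t, Ψ (t + T) = Ψ t * Ψ T)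
    (hinv : ∀ t, Ψ (-t) = conjMatrix * Ψ t * conjMatrix) :
    Ψ T = conjMatrix * (Ψ (T / 2)).adjugate * conjMatrix * Ψ (T / 2) := by
  have h1 : Ψ (T / 2) = conjMatrix * Ψ (T / 2) * conjMatrix * Ψ T := by
    rw [← hinv, ← hper]
    congr 1
    ring
  have h2 : (Ψ (T / 2)).adjugate * Ψ (T / 2) = 1 := by
    rw [Matrix.adjugate_mul, hdet, one_smul]
  calc Ψ T = conjMatrix * ((Ψ (T / 2)).adjugate * (conjMatrix * conjMatrix) * Ψ (T / 2)) *
        conjMatrix * Ψ T := by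
        rw [conjMatrix_mul_self, mul_one, h2, mul_one, conjMatrix_mul_self, one_mul]
    _ = conjMatrix * (Ψ (T / 2)).adjugate * conjMatrix *
        (conjMatrix * Ψ (T / 2) * conjMatrix * Ψ T) := by simp only [mul_assoc]
    _ = conjMatrix * (Ψ (T / 2)).adjugate * conjMatrix * Ψ (T / 2) := by rw [← h1]

/-- The second half of the path is determined by the first: Ψ(t) = Ψ(-(T - t)) Ψ(T), and Ψ(T) is the
commutator. -/
lemma apply_eq_of_reflect (hdet : ∀ t, (Ψ t).det = 1) (hper : ∀ t, Ψ (t + T) = Ψ t * Ψ T)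
    (hinv : ∀ t, Ψ (-t) = conjMatrix * Ψ t * conjMatrix) (t : ℝ) :
    Ψ t = conjMatrix * Ψ (T - t) * (Ψ (T / 2)).adjugate * conjMatrix * Ψ (T / 2) := by
  have h1 : Ψ t = conjMatrix * Ψ (T - t) * conjMatrix * Ψ T := by
    rw [← hinv, ← hper]
    congr 1
    ring
  rw [h1, apply_eq_commutator hdet hper hinv]
  simp only [← mul_assoc]
  rw [mul_assoc (conjMatrix * _) conjMatrix conjMatrix, conjMatrix_mul_self, mul_one]

/-- The argument of the complex linear part along the whole path, in terms of the arguments of the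
columns along the first half. -/
lemma exists_isArgLift_linearPart (hT : 0 < T) (hc : Continuous Ψ) (hdet : ∀ t, (Ψ t).det = 1)
    (hone : Ψ 0 = 1) (hper : ∀ t, Ψ (t + T) = Ψ t * Ψ T)
    (hinv : ∀ t, Ψ (-t) = conjMatrix * Ψ t * conjMatrix) {α β : ℝ → ℝ}
    (hα : IsArgLift (fun t => (Ψ t 0 0 : ℂ) + Ψ t 1 0 * Complex.I) α (Icc 0 (T / 2)))
    (hα0 : α 0 = 0)
    (hβ : IsArgLift (fun t => (Ψ t 1 1 : ℂ) - Ψ t 0 1 * Complex.I) β (Icc 0 (T / 2)))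
    (hβ0 : β 0 = 0) :
    ∃ φ : ℝ → ℝ, IsArgLift (fun t => linearPart (Ψ t)) φ (Icc 0 T) ∧ φ 0 = 0 ∧
      φ T = α (T / 2) + β (T / 2) +
        ((Ψ (T / 2) 1 1 + Ψ (T / 2) 1 0 * Complex.I) *
          (Ψ (T / 2) 1 1 + Ψ (T / 2) 0 1 * Complex.I) : ℂ).arg -
        ((Ψ (T / 2) 0 0 + Ψ (T / 2) 1 0 * Complex.I) *
          (Ψ (T / 2) 0 0 + Ψ (T / 2) 0 1 * Complex.I) : ℂ).arg := by
  have hent : ∀ i j, Continuous fun t => Ψ t i j := fun i j => hc.matrix_elem i j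
  have hd : ∀ t, Ψ t 0 0 * Ψ t 1 1 - Ψ t 0 1 * Ψ t 1 0 = 1 := fun t => by
    rw [← Matrix.det_fin_two]; exact hdet t
  have hr : ∀ t, 0 < (Ψ t 0 0 ^ 2 + Ψ t 1 0 ^ 2) * (Ψ t 1 1 ^ 2 + Ψ t 0 1 ^ 2) / 2 := fun t => by
    have h1 : ∀ {x y u v : ℝ}, x * u - y * v = 1 → 0 < x ^ 2 + v ^ 2 := fun {x y u v} h => by
      by_contra! hc
      have hx : x ^ 2 = 0 := by nlinarith [sq_nonneg x, sq_nonneg v]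
      have hv : v ^ 2 = 0 := by nlinarith [sq_nonneg x, sq_nonneg v]
      rw [pow_eq_zero_iff two_ne_zero] at hx hv
      simp [hx, hv] at h
    have h2 := h1 (hd t)
    have h3 := h1 (show Ψ t 1 1 * Ψ t 0 0 - Ψ t 1 0 * Ψ t 0 1 = 1 by linarith [hd t])
    positivity
  -- N(τ, σ) = I Ψ(σ) Ψ(τ)⁻¹ I Ψ(τ) equals Ψ(τ) on the diagonal, the commutator on σ = 0, and Ψ(T -
  -- σ) on τ = T/2.
  let N : ℝ × ℝ → Matrix (Fin 2) (Fin 2) ℝ := fun p =>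
    conjMatrix * Ψ p.2 * (Ψ p.1).adjugate * conjMatrix * Ψ p.1
  have hNc : Continuous N := by
    have := hc.comp continuous_fst (X := ℝ × ℝ)
    have := hc.comp continuous_snd (X := ℝ × ℝ)
    have := (hc.comp continuous_fst (X := ℝ × ℝ)).matrix_adjugate
    fun_prop
  have hJ : conjMatrix.det = -1 := by simp [conjMatrix, Matrix.det_fin_two]
  have hNdet : ∀ p, (N p).det = 1 := fun p => by
    simp [N, hJ, hdet, Matrix.det_adjugate]
  have hN0 : ∀ τ, N (τ, 0) = conjMatrix * (Ψ τ).adjugate * conjMatrix * Ψ τ := fun τ => by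
    simp [N, hone]
  have hN00 : N (0, 0) = 1 := by simp [hN0, hone, conjMatrix_mul_self]
  have hNdiag : ∀ t, N (t, t) = Ψ t := fun t => by
    simp only [N]
    rw [mul_assoc conjMatrix, Matrix.mul_adjugate, hdet, one_smul, mul_one, conjMatrix_mul_self,
      one_mul]
  have hlc : Continuous fun p => linearPart (N p) := by
    have h := fun i j => hNc.matrix_elem i j
    have := h 0 0
    have := h 0 1
    have := h 1 0
    have := h 1 1
    unfold linearPart
    fun_prop
  obtain ⟨Φ, hΦ, hΦ0⟩ := exists_isArgLift hlc (fun p => linearPart_ne_zero (hNdet p)) (0, 0) 0 (by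
    rw [hN00]
    have : linearPart 1 = (2 : ℝ) := by simp [linearPart]; norm_num
    rw [this]
    simp)
  -- Ψ on [0, T] runs along the diagonal to (T/2, T/2) and then down to (T/2, 0). The lift Φ is
  -- defined on the whole plane, so its end value can be computed along the edge σ = 0 instead.
  refine ⟨fun t => Φ (min t (T / 2), min t (T - t)), ?_, ?_, ?_⟩
  · refine (hΦ.comp (u := fun t => (min t (T / 2), min t (T - t)))
      (Continuous.continuousOn (by fun_prop)) (mapsTo_univ _ _)).congr fun t _ => ?_
    simp only [Function.comp_apply]
    congr 1
    rcases le_total t (T / 2) with h | h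
    · rw [min_eq_left h, min_eq_left (by linarith), hNdiag]
    · rw [min_eq_right h, min_eq_right (by linarith)]
      exact apply_eq_of_reflect hdet hper hinv t
  · have : min (0 : ℝ) (T / 2) = 0 := min_eq_left (by linarith)
    simp [this, hT.le, hΦ0]
  · have hp : IsArgLift _ _ (Icc 0 (T / 2)) := isArgLift_arg
      (f := fun t => ((Ψ t 0 0 + Ψ t 1 0 * Complex.I) * (Ψ t 0 0 + Ψ t 0 1 * Complex.I) : ℂ))
      (by
        have := hent 0 0
        have := hent 0 1
        have := hent 1 0
        fun_prop) fun t _ => mul_mem_slitPlane (hd t)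
    have hq : IsArgLift _ _ (Icc 0 (T / 2)) := isArgLift_arg
      (f := fun t => ((Ψ t 1 1 + Ψ t 1 0 * Complex.I) * (Ψ t 1 1 + Ψ t 0 1 * Complex.I) : ℂ))
      (by
        have := hent 1 1
        have := hent 0 1
        have := hent 1 0
        fun_prop) fun t _ => mul_mem_slitPlane (d := Ψ t 0 0) (by linarith [hd t])
    -- The entries of Ψ(t) satisfy (a + ic) · conj((a + ic)(a + ib)) = |a + ic|² (a - ib) and (d -
    -- ib)(d + ic)(d + ib) = |d - ib|² (d + ic). The product of these is a positive multiple of the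
    -- linear part of the commutator.
    have h1 := (hα.mul hp.star).mul (hβ.mul hq)
    have h2 : IsArgLift (fun t => linearPart (N (t, 0))) (fun t => Φ (t, 0)) (Icc 0 (T / 2)) :=
      hΦ.comp (u := fun t => (t, 0)) (Continuous.continuousOn (by fun_prop)) (mapsTo_univ _ _)
    have h3 := h2.pos_smul (r := fun t => (Ψ t 0 0 ^ 2 + Ψ t 1 0 ^ 2) *
      (Ψ t 1 1 ^ 2 + Ψ t 0 1 ^ 2) / 2) (fun t _ => ?_)
    · have h4 := h3.eq_of_eq (h1.congr fun t _ => ?_) isPreconnected_Icc (fun t ht => ?_)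
        (left_mem_Icc.2 (by linarith)) ?_ (right_mem_Icc.2 (show (0 : ℝ) ≤ T / 2 by linarith))
      · have e1 : min T (T / 2) = T / 2 := min_eq_right (by linarith)
        simp only [e1, sub_self, min_eq_right hT.le]
        rw [h4]
        ring
      · simp only [hN0, linearPart_commutator, map_mul, map_add, Complex.conj_ofReal,
          Complex.conj_I]
        push_cast
        linear_combination ((Ψ t 0 0 : ℂ) - Ψ t 0 1 * Complex.I) * (Ψ t 1 1 + Ψ t 1 0 * Complex.I) *
          ((Ψ t 0 0 ^ 2 + Ψ t 1 0 ^ 2) * Ψ t 0 1 ^ 2 + (Ψ t 1 1 ^ 2 + Ψ t 0 1 ^ 2) * Ψ t 1 0 ^ 2 -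
            Ψ t 0 1 ^ 2 * Ψ t 1 0 ^ 2 * (Complex.I ^ 2 + 1)) * Complex.I_sq
      · exact mul_ne_zero (by exact_mod_cast (hr t).ne') (linearPart_ne_zero (hNdet _))
      · simp [hΦ0, hα0, hβ0, hone]
    · exact hr t

end Halves

end SymplecticIndex

end

theorem mainTheorem6 (T : ℝ) (hT : 0 < T) (Ψ : ℝ → Matrix (Fin 2) (Fin 2) ℝ)
    (hcont : Continuous Ψ) (hsymp : ∀ t, SymplecticIndex.IsSymplectic (Ψ t))
    (hone : Ψ 0 = 1) (hper : ∀ t, Ψ (t + T) = Ψ t * Ψ T)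
    (hinv : ∀ t, Ψ (-t) = SymplecticIndex.conjMatrix * Ψ t * SymplecticIndex.conjMatrix) :
    SymplecticIndex.czIndex Ψ T =
      SymplecticIndex.rsIndex SymplecticIndex.omegaStd
        (SymplecticIndex.movedSubspace Ψ SymplecticIndex.realAxis) SymplecticIndex.realAxis
        0 (T / 2) +
      SymplecticIndex.rsIndex SymplecticIndex.omegaStd
        (SymplecticIndex.movedSubspace Ψ SymplecticIndex.imagAxis) SymplecticIndex.imagAxis
        0 (T / 2) := by
  open SymplecticIndex in
  have hdet : ∀ t, (Ψ t).det = 1 := fun t => (hsymp t).det_eq_one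
  have hd : ∀ t, Ψ t 0 0 * Ψ t 1 1 - Ψ t 0 1 * Ψ t 1 0 = 1 := fun t => by
    rw [← Matrix.det_fin_two]; exact hdet t
  have hent : ∀ i j, Continuous fun t => Ψ t i j := fun i j => hcont.matrix_elem i j
  have h00 := hent 0 0
  have h01 := hent 0 1
  have h10 := hent 1 0
  have h11 := hent 1 1
  have hT2 : 0 < T / 2 := half_pos hT
  obtain ⟨α, hα, hα0⟩ := exists_isArgLift
    (f := fun t => (Ψ t 0 0 : ℂ) + Ψ t 1 0 * Complex.I) (by fun_prop) (fun t h => by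
      have e0 : Ψ t 0 0 = 0 := by simpa using congrArg Complex.re h
      have e1 : Ψ t 1 0 = 0 := by simpa using congrArg Complex.im h
      simpa [e0, e1] using hd t) 0 0 (by simp [hone])
  obtain ⟨β, hβ, hβ0⟩ := exists_isArgLift
    (f := fun t => (Ψ t 1 1 : ℂ) - Ψ t 0 1 * Complex.I) (by fun_prop) (fun t h => by
      have e0 : Ψ t 1 1 = 0 := by simpa using congrArg Complex.re h
      have e1 : Ψ t 0 1 = 0 := by simpa using congrArg Complex.im h
      simpa [e0, e1] using hd t) 0 0 (by simp [hone])
  have hα' := hα.mono (subset_univ (Icc 0 (T / 2)))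
  have hβ' := hβ.mono (subset_univ (Icc 0 (T / 2)))
  obtain ⟨φ, hφ, hφ0, hφT⟩ :=
    exists_isArgLift_linearPart hT hcont hdet hone hper hinv hα' hα0 hβ' hβ0
  have hre := pi_mul_rsIndex_realAxis hcont hdet hone hT2 hα' hα0
  have him := pi_mul_rsIndex_imagAxis hcont hdet hone hT2 hβ' hβ0
  have hcz := pi_mul_czIndex hcont hdet hone hT hφ hφ0
  have hkey := arg_sub_arg_eq_planeDefect (hd (T / 2))
  -- Both arguments of the defect at Ψ(T) carry a factor 2, which cancels; the defect then has the
  -- form it takes in the arctangent identity for A = Ψ(T/2).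
  rw [apply_eq_commutator hdet hper hinv, linearPart_commutator, trace_commutator (hdet _),
    planeDefect_smul _ _ _ two_ne_zero, hφT] at hcz
  have hfin : Real.pi * (czIndex Ψ T : ℝ) = Real.pi *
      ((rsIndex omegaStd (movedSubspace Ψ realAxis) realAxis 0 (T / 2) +
        rsIndex omegaStd (movedSubspace Ψ imagAxis) imagAxis 0 (T / 2) : ℚ) : ℝ) := by
    rw [Rat.cast_add, mul_add, hre, him, hcz]
    linarith
  exact_mod_cast mul_left_cancel₀ Real.pi_ne_zero hfin
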